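/- Let $n\ge 17$ be an integer, let $r\in\mathbb R$ (standing for $|\lambda|$) and let $\Lambda<0$ be fixed. Put $$m=\tfrac{(n-1)(n+2)}2,\quad \rho^2=\tfrac{(n-1)^2n}{12},\quad \mu_0=\tfrac{16(n-1)}n\,(r^2+\rho^2),\quad \bar\mu=\mu_0-\tfrac{(m-1)^2}4,\quad m_2=\tfrac{8(n-1)(n-2)}n ,$$ and assume $\bar\mu<0$ (this holds for instance if $\tfrac{16(n-1)}n r^2<238$). In the complex Hilbert space $\mathcal H=L^2((0,\infty),t^{3-4/n}dt)$ consider $$H_0u=t^{-(3-\frac4n)}\bigl\{-(t\,u')'-\bar\mu\, t^{-1}u+m_2|\Lambda|\,t^{3}u\bigr\},\qquad u\in C_c^\infty((0,\infty)),$$ and in $\hat{\mathcal H}=L^2((0,\infty),t^{m+2-4/n}dt)$ consider $$\hat H_0w=t^{-(m+2-\frac4n)}\bigl\{-(t^m w')'-\mu_0\, t^{m-2}w-m_2\Lambda\, t^{m+2}w\bigr\},\qquad w\in C_c^\infty((0,\infty)).$$ Denote by the same symbols the self-adjoint realisations of these operators with domain in the form domain, i.e. in the closure $\mathcal H_2$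 (resp. $\hat{\mathcal H}_2$) of $C_c^\infty((0,\infty))$ in the norm $\langle H_0u,u\rangle^{1/2}$ (resp. $\langle\hat H_0w,w\rangle^{1/2}$); that is, the Friedrichs extensions. Then: 1. $H_0$ and $\hat H_0$ are self-adjoint. If $-\bar\mu\ge 4(1-\frac1n)^2$, they are the closures of the operators on $C_c^\infty((0,\infty))$. 2. $w\mapsto t^{(m-1)/2}w$ is a unitary map $\hat{\mathcal H}\to\mathcal H$ that carries $\hat H_0$ onto $H_0$. 3. There are numbers $0<\lambda_0<\lambda_1<\cdots$ such that $\mathcal H$ has an orthonormal basis $(u_i)_{i\in\mathbb N}$ with $H_0u_i=\lambda_iu_i$ and $\hat{\mathcal H}$ has an orthonormal basis $(w_i)_{i\in\mathbb N}$ with $\hat H_0w_i=\lambda_iw_i$. For every $\beta>0$ the operators $e^{-\beta H_0}$ and $e^{-\beta\hat H_0}$ (the values at $\beta$ of the strongly continuous semigroups generated by $-H_0$ and $-\hat H_0$) are of trace class in $\mathcal H$ and $\hat{\mathcal H}$, and $$\operatorname{tr}(e^{-\beta H_0})=\operatorname{tr}(e^{-\beta\hat H_0})=\sum_{i=0}^\infty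 e^{-\beta\lambda_i}<\infty .$$ -/

import Mathlib

open MeasureTheory Set Filter Topology
open scoped NNReal ContDiff

noncomputable section

namespace WeightedBessel

/-! ### Operators in a complex Hilbert space -/

section Abstract

universe u

variable {E : Type u} [NormedAddCommGroup E] [InnerProductSpace ℂ E]

/-- The form domain of a densely defined nonnegative symmetric operator `T`: the vectors `x` that
are limits in `E` of a sequence in the domain of `T` which is Cauchy for the energy
`⟪T x, x⟫`. In other words, the completion of the domain of `T` in the form norm, realised inside
`E`. For nonnegative `T` these vectors already form a subspace, so that taking the span
does not add anything. -/
def formDomain (T : E →ₗ.[ℂ] E) : Submodule ℂ E :=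
  Submodule.span ℂ {x : E | ∃ s : ℕ → T.domain,
    Tendsto (fun k => (s k : E)) atTop (𝓝 x) ∧
    Tendsto (fun p : ℕ × ℕ =>
      (inner ℂ (T (s p.1 - s p.2)) ((s p.1 - s p.2 : T.domain) : E)).re) atTop (𝓝 0)}

/-- The Friedrichs extension of a densely defined nonnegative symmetric operator `T`: the
restriction of the adjoint of `T` to the vectors that lie in the form domain of `T`. -/
def friedrichs [CompleteSpace E] (T : E →ₗ.[ℂ] E) : E →ₗ.[ℂ] E :=
  T.adjoint.domRestrict (formDomain T)

/-- `T t = e^{-tH}` for `t ≥ 0`: the family `T` is a strongly continuous one-parameter semigroup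
of bounded operators, and its infinitesimal generator (with its exact domain) is `-H`. -/
structure IsExpSemigroup (H : E →ₗ.[ℂ] E) (T : ℝ≥0 → E →L[ℂ] E) : Prop where
  map_zero : T 0 = 1
  map_add : ∀ s t, T (s + t) = T s * T t
  continuous_apply : ∀ x, Continuous fun t => T t x
  generator : ∀ x y, (x, y) ∈ H.graph ↔
    Tendsto (fun h : ℝ≥0 => (((h : ℝ)⁻¹ : ℝ) : ℂ) • (x - T h x)) (𝓝[>] 0) (𝓝 y)

/-- A bounded operator `T` is of trace class if `|T| = (T* T)^{1/2}` has a finite trace, that is,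
`∑ ⟪b i, |T| b i⟫ < ∞` for all orthonormal bases `b`. -/
def IsTraceClass [CompleteSpace E] (T : E →L[ℂ] E) : Prop :=
  ∀ (ι : Type u) (b : HilbertBasis ι ℂ E),
    Summable fun i => (inner ℂ (b i) (CFC.abs T (b i))).re

/-- The trace of `T` exists and equals `c`, whatever orthonormal basis is used to compute it. -/
def HasTrace (T : E →L[ℂ] E) (c : ℂ) : Prop :=
  ∀ (ι : Type u) (b : HilbertBasis ι ℂ E), HasSum (fun i => inner ℂ (b i) (T (b i))) c

/-- `b` is an orthonormal basis of eigenvectors of `H` with eigenvalues `ev`. -/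
def IsEigenbasis (H : E →ₗ.[ℂ] E) (ev : ℕ → ℝ) (b : HilbertBasis ℕ ℂ E) : Prop :=
  ∀ i, (b i, ((ev i : ℝ) : ℂ) • b i) ∈ H.graph

end Abstract

/-! ### The weighted spaces and the differential operators on the half line -/

/-- The measure `t ^ q dt` on the half line `(0, ∞)`. -/
def powMeasure (q : ℝ) : Measure ℝ :=
  (volume.restrict (Ioi 0)).withDensity fun t => ENNReal.ofReal (t ^ q)

/-- The complex Hilbert space `L²((0, ∞), t ^ q dt)`. -/
abbrev L2pow (q : ℝ) : Type := Lp ℂ 2 (powMeasure q)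

/-- The complex valued test functions `C_c^∞((0, ∞))`. -/
def IsTest (u : ℝ → ℂ) : Prop :=
  ContDiff ℝ ∞ u ∧ HasCompactSupport u ∧ tsupport u ⊆ Ioi 0

/-- The exponent `k + 2 - 4 / n` of the weight. -/
def wt (n : ℕ) (k : ℝ) : ℝ := k + 2 - 4 / (n : ℝ)

/-- The differential expression
`t ^ (-(k + 2 - 4 / n)) * (-(t ^ k u')' - a t ^ (k - 2) u + b t ^ (k + 2) u)`. -/
def expr (n : ℕ) (k a b : ℝ) (u : ℝ → ℂ) (t : ℝ) : ℂ :=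
  ((t ^ (-wt n k) : ℝ) : ℂ) *
    (-deriv (fun s : ℝ => ((s ^ k : ℝ) : ℂ) * deriv u s) t
      - ((a * t ^ (k - 2) : ℝ) : ℂ) * u t + ((b * t ^ (k + 2) : ℝ) : ℂ) * u t)

lemma IsTest.add {u v : ℝ → ℂ} (hu : IsTest u) (hv : IsTest v) : IsTest (u + v) :=
  ⟨hu.1.add hv.1, hu.2.1.add hv.2.1,
    (tsupport_add u v).trans (union_subset hu.2.2 hv.2.2)⟩

lemma IsTest.smul {u : ℝ → ℂ} (c : ℂ) (hu : IsTest u) : IsTest (c • u) :=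
  ⟨contDiff_const.smul hu.1, hu.2.1.smul_left,
    (closure_mono (Function.support_const_smul_subset c u)).trans hu.2.2⟩

lemma IsTest.differentiableAt_flux {u : ℝ → ℂ} (hu : IsTest u) (k : ℝ) {t : ℝ} (ht : 0 < t) :
    DifferentiableAt ℝ (fun s : ℝ => ((s ^ k : ℝ) : ℂ) * deriv u s) t := by
  have h1 : DifferentiableAt ℝ (fun s : ℝ => ((s ^ k : ℝ) : ℂ)) t :=
    Complex.ofRealCLM.differentiableAt.comp t
      (Real.differentiableAt_rpow_const_of_ne k ht.ne')
  have h2 : ContDiff ℝ 1 (deriv u) := by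
    have : ContDiff ℝ (1 + 1) u := hu.1.of_le (by norm_cast)
    exact (contDiff_succ_iff_deriv.1 this).2.2
  exact h1.mul (h2.differentiable (by norm_num) t)

lemma IsTest.differentiable {u : ℝ → ℂ} (hu : IsTest u) : Differentiable ℝ u :=
  hu.1.differentiable (by simp)

lemma expr_add {u v : ℝ → ℂ} (hu : IsTest u) (hv : IsTest v) (n : ℕ) (k a b : ℝ) {t : ℝ}
    (ht : 0 < t) : expr n k a b (u + v) t = expr n k a b u t + expr n k a b v t := by
  have h : (fun s : ℝ => ((s ^ k : ℝ) : ℂ) * deriv (u + v) s)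
      = (fun s : ℝ => ((s ^ k : ℝ) : ℂ) * deriv u s)
        + fun s : ℝ => ((s ^ k : ℝ) : ℂ) * deriv v s := by
    funext s
    simp only [Pi.add_apply]
    rw [deriv_add (hu.differentiable s) (hv.differentiable s)]
    ring
  simp only [expr]
  rw [h, deriv_add (hu.differentiableAt_flux k ht) (hv.differentiableAt_flux k ht)]
  simp only [Pi.add_apply]
  ring

lemma expr_smul {u : ℝ → ℂ} (c : ℂ) (hu : IsTest u) (n : ℕ) (k a b : ℝ) {t : ℝ}
    (ht : 0 < t) : expr n k a b (c • u) t = c * expr n k a b u t := by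
  have h : (fun s : ℝ => ((s ^ k : ℝ) : ℂ) * deriv (c • u) s)
      = c • (fun s : ℝ => ((s ^ k : ℝ) : ℂ) * deriv u s) := by
    funext s
    simp only [Pi.smul_apply, smul_eq_mul]
    rw [deriv_const_smul c (hu.differentiable s), smul_eq_mul]
    ring
  simp only [expr]
  rw [h, deriv_const_smul c (hu.differentiableAt_flux k ht)]
  simp only [Pi.smul_apply, smul_eq_mul]
  ring

lemma ae_pos_powMeasure (q : ℝ) : ∀ᵐ t ∂(powMeasure q), 0 < t :=
  (withDensity_absolutelyContinuous _ _).ae_le (ae_restrict_mem measurableSet_Ioi)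

/-- The graph of the differential expression on the test functions. -/
def minGraph (n : ℕ) (k a b : ℝ) : Submodule ℂ (L2pow (wt n k) × L2pow (wt n k)) where
  carrier := {p | ∃ u : ℝ → ℂ, IsTest u ∧ p.1 =ᵐ[powMeasure (wt n k)] u ∧
    p.2 =ᵐ[powMeasure (wt n k)] expr n k a b u}
  zero_mem' := by
    refine ⟨0, ⟨contDiff_const, HasCompactSupport.zero, by simp⟩, Lp.coeFn_zero _ _ _, ?_⟩
    refine (Lp.coeFn_zero _ _ _).trans (Eventually.of_forall fun t => ?_)
    have : deriv (0 : ℝ → ℂ) = 0 := by funext s; exact deriv_const s 0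
    simp [expr, this]
  add_mem' := by
    rintro p q ⟨u, hu, hu1, hu2⟩ ⟨v, hv, hv1, hv2⟩
    refine ⟨u + v, hu.add hv, (Lp.coeFn_add _ _).trans (hu1.add hv1), ?_⟩
    refine (Lp.coeFn_add _ _).trans ((hu2.add hv2).trans ?_)
    filter_upwards [ae_pos_powMeasure (wt n k)] with t ht
    exact (expr_add hu hv n k a b ht).symm
  smul_mem' := by
    rintro c p ⟨u, hu, hu1, hu2⟩
    refine ⟨c • u, hu.smul c, (Lp.coeFn_smul _ _).trans (hu1.const_smul c), ?_⟩
    refine (Lp.coeFn_smul _ _).trans ((hu2.const_smul c).trans ?_)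
    filter_upwards [ae_pos_powMeasure (wt n k)] with t ht
    exact (expr_smul c hu n k a b ht).symm

/-- The operator in `L²((0, ∞), t ^ (k + 2 - 4 / n) dt)` with domain `C_c^∞((0, ∞))` that is given
by the differential expression. -/
def minOperator (n : ℕ) (k a b : ℝ) : L2pow (wt n k) →ₗ.[ℂ] L2pow (wt n k) :=
  (minGraph n k a b).toLinearPMap

/-! ### The constants and the two Hamiltonians -/

/-- `m = (n - 1)(n + 2) / 2`. -/
def mExp (n : ℕ) : ℝ := ((n : ℝ) - 1) * ((n : ℝ) + 2) / 2

/-- `|ρ|² = (n - 1)² n / 12`. -/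
def rhoSq (n : ℕ) : ℝ := ((n : ℝ) - 1) ^ 2 * (n : ℝ) / 12

/-- `μ₀ = 16 (n - 1) / n * (|λ|² + |ρ|²)`, where `r = |λ|`. -/
def mu0 (n : ℕ) (r : ℝ) : ℝ := 16 * ((n : ℝ) - 1) / n * (r ^ 2 + rhoSq n)

/-- `μ̄ = μ₀ - (m - 1)² / 4`. -/
def muBar (n : ℕ) (r : ℝ) : ℝ := mu0 n r - (mExp n - 1) ^ 2 / 4

/-- `m₂ = 8 (n - 1)(n - 2) / n`. -/
def m2 (n : ℕ) : ℝ := 8 * ((n : ℝ) - 1) * ((n : ℝ) - 2) / n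

/-- The operator
`u ↦ t ^ (-(3 - 4 / n)) * (-(t u')' - μ̄ t⁻¹ u + m₂ |Λ| t³ u)` on `C_c^∞((0, ∞))`
in `L²((0, ∞), t ^ (3 - 4 / n) dt)`. -/
def H0min (n : ℕ) (r L : ℝ) : L2pow (wt n 1) →ₗ.[ℂ] L2pow (wt n 1) :=
  minOperator n 1 (muBar n r) (m2 n * |L|)

/-- The temporal Hamiltonian
`w ↦ t ^ (-(m + 2 - 4 / n)) * (-(t ^ m w')' - μ₀ t ^ (m - 2) w - m₂ Λ t ^ (m + 2) w)`
on `C_c^∞((0, ∞))` in `L²((0, ∞), t ^ (m + 2 - 4 / n) dt)`. -/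
def hatH0min (n : ℕ) (r L : ℝ) : L2pow (wt n (mExp n)) →ₗ.[ℂ] L2pow (wt n (mExp n)) :=
  minOperator n (mExp n) (mu0 n r) (-(m2 n * L))

/-- The self-adjoint operator `H₀`: the realisation of the differential operator whose domain is
contained in the closure of the test functions in the form norm. -/
def H0 (n : ℕ) (r L : ℝ) : L2pow (wt n 1) →ₗ.[ℂ] L2pow (wt n 1) :=
  friedrichs (H0min n r L)

/-- The self-adjoint temporal Hamiltonian. -/
def hatH0 (n : ℕ) (r L : ℝ) : L2pow (wt n (mExp n)) →ₗ.[ℂ] L2pow (wt n (mExp n)) :=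
  friedrichs (hatH0min n r L)

end WeightedBessel

end

/-! Substitute t = e^x and multiply by t^((k-1)/2), where k is the exponent of the flux t^k u': k =
1 for H₀ and k = m for the temporal Hamiltonian. The first order term drops out, and both operators
become the same one, e^(-αx)(-φ'' + Vφ) in L²(e^(αx) dx) on the whole line, with α = 4 - 4/n and V =
-μ̄ + m₂|Λ|e^(4x) (`expr_exp`, `intertwines_logEquiv`). Friedrichs extensions are carried along by
unitary maps (`IsFormFactor.intertwines_friedrichs`), so everything may be proved on the line, and
the unitary map between the two half-line spaces is a composition of two substitutions.

The energy on the line is ∫|φ'|² + V|φ|². Let J be the inclusion into L² of the completion of the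
test functions in the norm "L² norm squared plus energy". The Friedrichs extension H satisfies (1 +
H)⁻¹ = J J* (`IsFormFactor.mem_friedrichs_graph_iff`), and self-adjointness follows from the
symmetry and injectivity of this bounded operator.

Spectrum: for each M, the energy is at least M‖φ‖² on the common kernel of at most C M^p functionals
(`exists_lineGrad_coercive`). Outside an interval whose length is logarithmic in M, V dominates M
e^(αx), because V is bounded below by a positive constant on the left and by a multiple of e^(4x), 4
> α, on the right; inside, a Poincaré inequality on short pieces does the rest. This makes J compact
and bounds the number of eigenvalues below M by a polynomial, so that ∑ e^(-βλ) converges.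
Eigenvalues are simple: an eigenfunction is a classical solution of y'' = (V - λe^(αx))y by
`exists_eq_solution`, and a solution that is square integrable at +∞ is determined by one value far
to the right.

Closure: it is enough that no nonzero x is orthogonal to the range of 1 + T on test functions. Such
an x solves y'' = (V + e^(αx))y. If V ≥ (α/2)² = 4(1 - 1/n)², a nonzero solution that is square
integrable at +∞ grows at least like e^(-αx/2) at -∞ and leaves the space.

The semigroup is diagonal in the eigenbasis, and its trace in any other basis is found by
interchanging two sums of nonnegative terms. -/

noncomputable section

namespace WeightedBessel

/-! ### The Friedrichs extension through the completed form domain -/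

section Friedrichs

universe u

variable {E : Type u} [NormedAddCommGroup E] [InnerProductSpace ℂ E]
variable {K : Type*} [NormedAddCommGroup K] [InnerProductSpace ℂ K]
variable {W : Type*} [AddCommGroup W] [Module ℂ W]

/-- The map `w ↦ (i w, δ w)` into the Hilbert sum. -/
def pairMap (i : W →ₗ[ℂ] E) (δ : W →ₗ[ℂ] K) : W →ₗ[ℂ] WithLp 2 (E × K) :=
  (WithLp.linearEquiv 2 ℂ (E × K)).symm.toLinearMap ∘ₗ i.prod δ

/-- The form domain as a Hilbert space: the closure of the vectors `(i w, δ w)`. -/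
def formSpace (i : W →ₗ[ℂ] E) (δ : W →ₗ[ℂ] K) : Submodule ℂ (WithLp 2 (E × K)) :=
  (LinearMap.range (pairMap i δ)).topologicalClosure

instance [CompleteSpace E] [CompleteSpace K] (i : W →ₗ[ℂ] E) (δ : W →ₗ[ℂ] K) :
    CompleteSpace (formSpace i δ) :=
  (Submodule.isClosed_topologicalClosure _).completeSpace_coe

/-- The inclusion of the form space into `E`. -/
def formIncl (i : W →ₗ[ℂ] E) (δ : W →ₗ[ℂ] K) : formSpace i δ →L[ℂ] E :=
  WithLp.fstL 2 ℂ E K ∘L (formSpace i δ).subtypeL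

/-- The second component of a vector of the form space. -/
def formGrad (i : W →ₗ[ℂ] E) (δ : W →ₗ[ℂ] K) : formSpace i δ →L[ℂ] K :=
  WithLp.sndL 2 ℂ E K ∘L (formSpace i δ).subtypeL

/-- A test vector as an element of the form space. -/
def formMk (i : W →ₗ[ℂ] E) (δ : W →ₗ[ℂ] K) : W →ₗ[ℂ] formSpace i δ :=
  (pairMap i δ).codRestrict _ fun w =>
    Submodule.le_topologicalClosure _ (LinearMap.mem_range_self _ w)

/-- The resolvent at `-1` of the Friedrichs extension. -/
def formResolvent [CompleteSpace E] [CompleteSpace K] (i : W →ₗ[ℂ] E) (δ : W →ₗ[ℂ] K) : E →L[ℂ] E :=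
  formIncl i δ ∘L (formIncl i δ).adjoint

variable {i τ : W →ₗ[ℂ] E} {δ : W →ₗ[ℂ] K}

@[simp] lemma formIncl_formMk (w : W) : formIncl i δ (formMk i δ w) = i w := rfl

@[simp] lemma formGrad_formMk (w : W) : formGrad i δ (formMk i δ w) = δ w := rfl

lemma formSpace_inner (v v' : formSpace i δ) : inner ℂ v v' =
    inner ℂ (formIncl i δ v) (formIncl i δ v') + inner ℂ (formGrad i δ v) (formGrad i δ v') := rfl

lemma formSpace_norm_sq (v : formSpace i δ) :
    ‖v‖ ^ 2 = ‖formIncl i δ v‖ ^ 2 + ‖formGrad i δ v‖ ^ 2 := by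
  have := congrArg Complex.re (formSpace_inner v v)
  simpa [inner_self_eq_norm_sq_to_K, ← Complex.ofReal_pow] using this

lemma denseRange_formMk : DenseRange (formMk i δ) := by
  intro v
  rw [closure_subtype]
  have hv : (v : WithLp 2 (E × K)) ∈ closure (LinearMap.range (pairMap i δ) : Set _) := v.2
  refine closure_mono ?_ hv
  rintro _ ⟨w, rfl⟩
  exact ⟨formMk i δ w, ⟨w, rfl⟩, rfl⟩

/-- `T` is the operator `i w ↦ τ w` with a dense domain, and `⟪T (i w), i w'⟫ = ⟪δ w, δ w'⟫`. -/
structure IsFormFactor (T : E →ₗ.[ℂ] E) (i τ : W →ₗ[ℂ] E) (δ : W →ₗ[ℂ] K) : Prop where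
  mem_graph : ∀ x y, (x, y) ∈ T.graph ↔ ∃ w, i w = x ∧ τ w = y
  denseRange : DenseRange i
  inner_eq : ∀ w w', inner ℂ (τ w) (i w') = inner ℂ (δ w) (δ w')

variable {T : E →ₗ.[ℂ] E}

namespace IsFormFactor

lemma dense_domain (h : IsFormFactor T i τ δ) : Dense (T.domain : Set E) := by
  refine h.denseRange.mono ?_
  rintro _ ⟨w, rfl⟩
  exact LinearPMap.mem_domain_of_mem_graph ((h.mem_graph _ _).2 ⟨w, rfl, rfl⟩)

lemma mem_adjoint_graph [CompleteSpace E] (h : IsFormFactor T i τ δ) (x y : E) :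
    (x, y) ∈ T.adjoint.graph ↔ ∀ w, inner ℂ (τ w) x = inner ℂ (i w) y := by
  rw [LinearPMap.adjoint_graph_eq_graph_adjoint h.dense_domain, Submodule.mem_adjoint_iff]
  constructor
  · intro H w
    exact sub_eq_zero.1 (H _ _ ((h.mem_graph _ _).2 ⟨w, rfl, rfl⟩))
  · intro H a b hab
    obtain ⟨w, rfl, rfl⟩ := (h.mem_graph _ _).1 hab
    exact sub_eq_zero.2 (H w)

lemma grad_inner (h : IsFormFactor T i τ δ) (w : W) (v : formSpace i δ) :
    inner ℂ (τ w) (formIncl i δ v) = inner ℂ (δ w) (formGrad i δ v) := by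
  refine denseRange_formMk.induction_on v (isClosed_eq ?_ ?_) fun w' => ?_
  · exact continuous_const.inner (formIncl i δ).continuous
  · exact continuous_const.inner (formGrad i δ).continuous
  · simpa using h.inner_eq w w'

/-- Closability of the form. If the first component of v vanishes, `grad_inner` makes the second
orthogonal to every δ w, hence by density to every second component, itself included. -/
lemma formIncl_injective (h : IsFormFactor T i τ δ) :
    Function.Injective (formIncl i δ) := by
  rw [injective_iff_map_eq_zero]
  intro v hv
  have h0 : ∀ v' : formSpace i δ, inner ℂ (formGrad i δ v') (formGrad i δ v) = 0 := by
    intro v'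
    refine denseRange_formMk.induction_on v' (isClosed_eq ?_ continuous_const) fun w => ?_
    · exact (formGrad i δ).continuous.inner continuous_const
    · rw [formGrad_formMk, ← h.grad_inner, hv, inner_zero_right]
  have h1 := formSpace_norm_sq v
  rw [hv, inner_self_eq_zero.1 (h0 v)] at h1
  simpa using h1

variable (h : IsFormFactor T i τ δ)
include h

lemma formDomain_eq [CompleteSpace E] [CompleteSpace K] :
    formDomain T = LinearMap.range (formIncl i δ : formSpace i δ →ₗ[ℂ] E) := by
  have hT : ∀ s : T.domain, ∃ w, i w = s ∧ τ w = T s := fun s =>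
    (h.mem_graph _ _).1 (T.mem_graph s)
  apply le_antisymm
  · refine Submodule.span_le.2 ?_
    rintro x ⟨s, hs, hq⟩
    choose w hw1 hw2 using fun k => hT (s k)
    have hcauchy : CauchySeq fun k => δ (w k) := by
      rw [Metric.cauchySeq_iff']
      intro ε hε
      obtain ⟨N, hN⟩ := eventually_atTop.1 (hq.eventually (gt_mem_nhds (sq_pos_of_pos hε)))
      -- The double limit provides one threshold per index; the sum dominates both.
      refine ⟨N.1 + N.2, fun k hk => ?_⟩
      have hk' := hN (k, N.1 + N.2) ⟨by simp; omega, by simp⟩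
      have e1 : T (s k - s (N.1 + N.2)) = τ (w k - w (N.1 + N.2)) := by
        rw [LinearPMap.map_sub, map_sub, hw2, hw2]
      have e2 : ((s k - s (N.1 + N.2) : T.domain) : E) = i (w k - w (N.1 + N.2)) := by
        rw [map_sub, hw1, hw1]; rfl
      rw [e1, e2, h.inner_eq, inner_self_eq_norm_sq_to_K] at hk'
      rw [dist_eq_norm, ← map_sub]
      refine lt_of_pow_lt_pow_left₀ 2 hε.le ?_
      simpa [← Complex.ofReal_pow] using hk'
    obtain ⟨k, hk⟩ := cauchySeq_tendsto_of_complete hcauchy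
    have hmem : WithLp.toLp 2 (x, k) ∈ formSpace i δ := by
      rw [formSpace, ← SetLike.mem_coe, Submodule.topologicalClosure_coe]
      refine mem_closure_of_tendsto (b := atTop) (f := fun n => pairMap i δ (w n)) ?_
        (Eventually.of_forall fun n => ⟨_, rfl⟩)
      have h1 : Tendsto (fun n => i (w n)) atTop (𝓝 x) := by simpa only [hw1] using hs
      exact ((WithLp.prod_continuous_toLp 2 E K).tendsto (x, k)).comp (h1.prodMk_nhds hk)
    exact ⟨⟨_, hmem⟩, rfl⟩
  · rintro _ ⟨v, rfl⟩
    refine Submodule.subset_span ?_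
    obtain ⟨z, hz, hzv⟩ := mem_closure_iff_seq_limit.1 (denseRange_formMk v)
    choose w hw using hz
    have hdom : ∀ w, i w ∈ T.domain := fun w =>
      LinearPMap.mem_domain_of_mem_graph ((h.mem_graph _ _).2 ⟨w, rfl, rfl⟩)
    have hTw : ∀ w, T ⟨i w, hdom w⟩ = τ w := fun w => by
      obtain ⟨w', h1, h2⟩ := hT ⟨i w, hdom w⟩
      have := T.mem_graph_snd_inj ((h.mem_graph _ _).2 ⟨w', h1, h2⟩)
        ((h.mem_graph _ _).2 ⟨w, rfl, rfl⟩) rfl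
      exact this
    refine ⟨fun k => ⟨i (w k), hdom _⟩, ?_, ?_⟩
    · have := ((formIncl i δ).continuous.tendsto v).comp hzv
      refine this.congr fun k => ?_
      simp [← hw k]
    · have hc : Tendsto (fun p : ℕ × ℕ => formGrad i δ (z p.1 - z p.2)) atTop (𝓝 0) := by
        have h1 : Tendsto (fun p : ℕ × ℕ => z p.1 - z p.2) atTop (𝓝 (v - v)) := by
          rw [← prod_atTop_atTop_eq]
          exact (hzv.comp tendsto_fst).sub (hzv.comp tendsto_snd)
        rw [sub_self] at h1
        have h2 := ((formGrad i δ).continuous.tendsto 0).comp h1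
        rwa [map_zero] at h2
      have hc2 := (hc.norm).pow 2
      simp only [norm_zero, ne_eq, OfNat.ofNat_ne_zero, not_false_eq_true, zero_pow] at hc2
      refine hc2.congr fun p => ?_
      have e2 : ((⟨i (w p.1), hdom _⟩ - ⟨i (w p.2), hdom _⟩ : T.domain) : E)
          = i (w p.1 - w p.2) := by rw [map_sub]; rfl
      rw [LinearPMap.map_sub, hTw, hTw, ← map_sub, e2, h.inner_eq, inner_self_eq_norm_sq_to_K,
        map_sub, ← hw, ← hw]
      simp [← Complex.ofReal_pow]

variable [CompleteSpace E] [CompleteSpace K]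

/-- Unfolds "adjoint restricted to the form domain" into a weak equation tested on W, the shape used
for the differential equation. -/
lemma mem_friedrichs_graph (x y : E) :
    (x, y) ∈ (friedrichs T).graph ↔
      (∃ v, formIncl i δ v = x) ∧ ∀ w, inner ℂ (τ w) x = inner ℂ (i w) y := by
  have hdom : (friedrichs T).domain = formDomain T ⊓ T.adjoint.domain := rfl
  rw [← h.mem_adjoint_graph]
  have key : (x, y) ∈ (friedrichs T).graph ↔ x ∈ formDomain T ∧ (x, y) ∈ T.adjoint.graph := by
    constructor
    · intro hx
      have h1 : x ∈ formDomain T ⊓ T.adjoint.domain :=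
        hdom ▸ LinearPMap.mem_domain_of_mem_graph hx
      exact ⟨h1.1, LinearPMap.le_graph_of_le LinearPMap.domRestrict_le hx⟩
    · rintro ⟨hx, hxy⟩
      have hx2 := LinearPMap.mem_domain_of_mem_graph hxy
      obtain ⟨⟨x', hx'⟩, e1, e2⟩ := (LinearPMap.mem_graph_iff _).1 hxy
      simp only at e1 e2
      subst e1
      refine (LinearPMap.mem_graph_iff _).2 ⟨⟨x', ⟨hx, hx2⟩⟩, rfl, ?_⟩
      rw [← e2]
      exact LinearPMap.domRestrict_apply rfl
  rw [key, h.formDomain_eq]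
  rfl

/-- The Friedrichs extension `H` is given by `(1 + H)⁻¹ = formResolvent i δ`. -/
theorem mem_friedrichs_graph_iff (x y : E) :
    (x, y) ∈ (friedrichs T).graph ↔ x = formResolvent i δ (x + y) := by
  rw [h.mem_friedrichs_graph]
  constructor
  · rintro ⟨⟨v, rfl⟩, hv⟩
    -- With the inner product of the form space, the weak equation says ⟪w, v⟫ = ⟪i w, x + y⟫ for
    -- all test vectors, which is the defining property of J*(x + y).
    have : (formIncl i δ).adjoint (formIncl i δ v + y) = v := by
      refine Dense.eq_of_inner_right ℂ (S := range (formMk i δ)) denseRange_formMk ?_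
      rintro _ ⟨w, rfl⟩
      rw [ContinuousLinearMap.adjoint_inner_right, formSpace_inner, inner_add_right,
        formIncl_formMk, formGrad_formMk, ← hv w, h.grad_inner]
    rw [formResolvent, ContinuousLinearMap.comp_apply, this]
  · intro hx
    set v := (formIncl i δ).adjoint (x + y) with hv
    have hvx : formIncl i δ v = x := hx.symm
    refine ⟨⟨v, hvx⟩, fun w => ?_⟩
    have h1 : inner ℂ (formMk i δ w) v = inner ℂ (i w) (x + y) := by
      rw [hv, ContinuousLinearMap.adjoint_inner_right, formIncl_formMk]
    rw [formSpace_inner, hvx, formIncl_formMk, formGrad_formMk, inner_add_right,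
      ← h.grad_inner, hvx] at h1
    exact add_left_cancel h1

omit h in
lemma _root_.WeightedBessel.formResolvent_isPositive : (formResolvent i δ).IsPositive :=
  ContinuousLinearMap.isPositive_self_comp_adjoint _

omit h in
lemma _root_.WeightedBessel.formResolvent_inner (x y : E) :
    inner ℂ (formResolvent i δ x) y = inner ℂ x (formResolvent i δ y) :=
  formResolvent_isPositive.isSymmetric x y

omit h in
lemma _root_.WeightedBessel.formResolvent_inner_self (x : E) :
    inner ℂ x (formResolvent i δ x) = (‖(formIncl i δ).adjoint x‖ : ℂ) ^ 2 := by
  rw [formResolvent, ContinuousLinearMap.comp_apply, ← ContinuousLinearMap.adjoint_inner_left,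
    inner_self_eq_norm_sq_to_K]
  rfl

lemma adjoint_formIncl_injective : Function.Injective (formIncl i δ).adjoint := by
  rw [injective_iff_map_eq_zero]
  intro x hx
  refine Dense.eq_zero_of_inner_left ℂ (S := range i) h.denseRange ?_
  rintro _ ⟨w, rfl⟩
  rw [← formIncl_formMk (δ := δ), ← ContinuousLinearMap.adjoint_inner_left, hx, inner_zero_left]

lemma formResolvent_injective : Function.Injective (formResolvent i δ) :=
  h.formIncl_injective.comp h.adjoint_formIncl_injective

lemma formResolvent_mem (f : E) :
    (formResolvent i δ f, f - formResolvent i δ f) ∈ (friedrichs T).graph := by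
  rw [h.mem_friedrichs_graph_iff, add_sub_cancel]

/-- The domain contains the range of the resolvent, and an injective symmetric bounded operator has
dense range. -/
lemma dense_friedrichs_domain : Dense ((friedrichs T).domain : Set E) := by
  have h1 : DenseRange (formResolvent i δ) := by
    rw [DenseRange, ← ContinuousLinearMap.coe_coe, ← LinearMap.coe_range,
      Submodule.dense_iff_topologicalClosure_eq_top, Submodule.topologicalClosure_eq_top_iff,
      Submodule.eq_bot_iff]
    intro x hx
    refine h.formResolvent_injective ?_
    rw [map_zero]
    refine inner_self_eq_zero (𝕜 := ℂ).1 ?_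
    rw [← formResolvent_inner]
    exact (Submodule.mem_orthogonal _ _).1 hx _ ⟨_, rfl⟩
  refine h1.mono ?_
  rintro _ ⟨f, rfl⟩
  exact LinearPMap.mem_domain_of_mem_graph (h.formResolvent_mem f)

theorem isSelfAdjoint_friedrichs : IsSelfAdjoint (friedrichs T) := by
  rw [LinearPMap.isSelfAdjoint_def]
  refine LinearPMap.eq_of_eq_graph ?_
  ext ⟨x, y⟩
  rw [LinearPMap.adjoint_graph_eq_graph_adjoint h.dense_friedrichs_domain,
    Submodule.mem_adjoint_iff, h.mem_friedrichs_graph_iff]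
  constructor
  · intro H
    refine ext_inner_left ℂ fun f => ?_
    -- The graph consists of the pairs (Rf, f - Rf) with R symmetric; testing the adjoint relation
    -- against them gives ⟪f, x⟫ = ⟪f, R(x + y)⟫.
    have := H _ _ (h.formResolvent_mem f)
    simp only [inner_sub_left, formResolvent_inner, map_add, inner_add_right] at this ⊢
    linear_combination this
  · intro hx a b hab
    rw [h.mem_friedrichs_graph_iff] at hab
    have h1 : inner ℂ (a + b) x = inner ℂ a (x + y) := by
      conv_lhs => rw [hx]
      conv_rhs => rw [hab]
      rw [formResolvent_inner]
    simp only [inner_add_left, inner_add_right] at h1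
    linear_combination h1

end IsFormFactor
end Friedrichs

/-! ### Operators diagonal in an orthonormal basis: semigroup and trace -/

section Diagonal

universe u

variable {E : Type u} [NormedAddCommGroup E] [InnerProductSpace ℂ E]

section Basis

variable {ι : Type*} (b : HilbertBasis ι ℂ E)
include b

lemma ext_basis {x y : E} (h : ∀ i, inner ℂ (b i) x = inner ℂ (b i) y) : x = y := by
  apply b.repr.injective
  ext i
  rw [b.repr_apply_apply, b.repr_apply_apply, h]

lemma hasSum_norm_sq_inner (x : E) : HasSum (fun i => ‖inner ℂ (b i) x‖ ^ 2) (‖x‖ ^ 2) := by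
  have h := b.hasSum_inner_mul_inner x x
  have h2 := Complex.hasSum_re h
  rw [inner_self_eq_norm_sq_to_K] at h2
  convert! h2 using 1
  · funext i
    rw [← inner_conj_symm x (b i), Complex.conj_mul', ← Complex.ofReal_pow, Complex.ofReal_re]
  · simp [← Complex.ofReal_pow]

/-- Dominated convergence for the Parseval sum: convergence of each coefficient suffices once the
coefficients are dominated by those of a fixed vector z. -/
lemma tendsto_of_tendsto_inner {α : Type*} {l : Filter α} {F : α → E} {x z : E}
    (h : ∀ i, Tendsto (fun a => inner ℂ (b i) (F a)) l (𝓝 (inner ℂ (b i) x)))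
    (hb : ∀ᶠ a in l, ∀ i, ‖inner ℂ (b i) (F a)‖ ≤ ‖inner ℂ (b i) z‖) :
    Tendsto F l (𝓝 x) := by
  rw [tendsto_iff_norm_sub_tendsto_zero]
  have key : Tendsto (fun a => ∑' i, ‖inner ℂ (b i) (F a - x)‖ ^ 2) l (𝓝 (∑' _ : ι, 0)) := by
    refine tendsto_tsum_of_dominated_convergence
      (bound := fun i => 2 * ‖inner ℂ (b i) z‖ ^ 2 + 2 * ‖inner ℂ (b i) x‖ ^ 2) ?_ ?_ ?_
    · exact ((hasSum_norm_sq_inner b z).summable.mul_left 2).add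
        ((hasSum_norm_sq_inner b x).summable.mul_left 2)
    · intro i
      have h1 := (((h i).sub_const (inner ℂ (b i) x)).norm).pow 2
      simpa [inner_sub_right] using h1
    · filter_upwards [hb] with a ha i
      rw [Real.norm_of_nonneg (by positivity), inner_sub_right]
      have h1 := norm_sub_le (inner ℂ (b i) (F a)) (inner ℂ (b i) x)
      have h2 := ha i
      have h3 := norm_nonneg (inner ℂ (b i) (F a) - inner ℂ (b i) x)
      have h4 := norm_nonneg (inner ℂ (b i) x)
      nlinarith [sq_nonneg (‖inner ℂ (b i) z‖ - ‖inner ℂ (b i) x‖)]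
  have h2 := key.sqrt
  simp only [tsum_zero, Real.sqrt_zero] at h2
  refine h2.congr fun a => ?_
  rw [(hasSum_norm_sq_inner b (F a - x)).tsum_eq, Real.sqrt_sq (norm_nonneg _)]

lemma exists_diagonal {a : ι → ℝ} (ha : ∀ i, |a i| ≤ 1) :
    ∃ D : E →L[ℂ] E, ∀ x i, inner ℂ (b i) (D x) = a i * inner ℂ (b i) x := by
  have hle : ∀ (f : lp (fun _ : ι => ℂ) 2) i, ‖(a i : ℂ) * f i‖ ≤ ‖f i‖ := fun f i => by
    rw [norm_mul, Complex.norm_real]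
    exact mul_le_of_le_one_left (norm_nonneg _) (ha i)
  let D₀ : lp (fun _ : ι => ℂ) 2 →ₗ[ℂ] lp (fun _ : ι => ℂ) 2 :=
    { toFun := fun f => ⟨fun i => (a i : ℂ) * f i, (lp.memℓp f).mono' (hle f)⟩
      map_add' := fun f g => by ext i; exact mul_add _ _ _
      map_smul' := fun c f => by ext i; simp [mul_left_comm] }
  let D₁ := D₀.mkContinuous 1 fun f => by
    rw [one_mul]
    exact lp.norm_mono (by norm_num) (hle f)
  refine ⟨(b.repr.symm.toContinuousLinearEquiv : _ →L[ℂ] E) ∘L D₁ ∘L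
    (b.repr.toContinuousLinearEquiv : E →L[ℂ] _), fun x i => ?_⟩
  rw [← b.repr_apply_apply, ← b.repr_apply_apply]
  simp [D₁, D₀]

end Basis

variable [CompleteSpace E] {H : E →ₗ.[ℂ] E} {ev : ℕ → ℝ} {b : HilbertBasis ℕ ℂ E}

/-- A self-adjoint operator with an eigenbasis is the maximal diagonal operator. Its graph equals
its adjoint graph: testing against the eigenpairs gives the coefficient relation, and Parseval gives
back the adjoint relation. -/
lemma IsEigenbasis.mem_graph_iff (hb : IsEigenbasis H ev b) (hH : IsSelfAdjoint H) (x y : E) :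
    (x, y) ∈ H.graph ↔ ∀ i, inner ℂ (b i) y = ev i * inner ℂ (b i) x := by
  have hg : H.graph = H.graph.adjoint := by
    rw [← LinearPMap.adjoint_graph_eq_graph_adjoint hH.dense_domain,
      LinearPMap.isSelfAdjoint_def.1 hH]
  constructor
  · intro h i
    rw [hg, Submodule.mem_adjoint_iff] at h
    have := h _ _ (hb i)
    simp only [inner_smul_left, Complex.conj_ofReal] at this
    linear_combination -this
  · intro h
    rw [hg, Submodule.mem_adjoint_iff]
    intro c d hcd
    have hc : ∀ i, inner ℂ (b i) d = ev i * inner ℂ (b i) c := by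
      intro i
      rw [hg, Submodule.mem_adjoint_iff] at hcd
      have := hcd _ _ (hb i)
      simp only [inner_smul_left, Complex.conj_ofReal] at this
      linear_combination -this
    rw [sub_eq_zero]
    rw [← b.tsum_inner_mul_inner d x, ← b.tsum_inner_mul_inner c y]
    refine tsum_congr fun i => ?_
    rw [← inner_conj_symm d, hc, h i, ← inner_conj_symm c, map_mul, Complex.conj_ofReal]
    ring

/-- The diagonal operators `e^{-tH}`. -/
lemma IsEigenbasis.exists_expSemigroup (hb : IsEigenbasis H ev b) (hH : IsSelfAdjoint H)
    (hev : ∀ i, 0 ≤ ev i) : ∃ T : ℝ≥0 → E →L[ℂ] E, IsExpSemigroup H T ∧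
      ∀ t x i, inner ℂ (b i) (T t x) = Real.exp (-(t : ℝ) * ev i) * inner ℂ (b i) x := by
  have hle : ∀ (t : ℝ≥0) i, |Real.exp (-(t : ℝ) * ev i)| ≤ 1 := fun t i => by
    rw [Real.abs_exp, Real.exp_le_one_iff]
    have := mul_nonneg t.2 (hev i)
    simp only [NNReal.val_eq_coe] at this
    linarith
  choose T hT using fun t : ℝ≥0 => exists_diagonal b (hle t)
  have hTn : ∀ t x i, ‖inner ℂ (b i) (T t x)‖ ≤ ‖inner ℂ (b i) x‖ := fun t x i => by
    rw [hT, norm_mul, Complex.norm_real]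
    exact mul_le_of_le_one_left (norm_nonneg _) (hle t i)
  refine ⟨T, ⟨?_, ?_, ?_, ?_⟩, hT⟩
  · ext x
    exact ext_basis b fun i => by simp [hT]
  · intro s t
    ext x
    refine ext_basis b fun i => ?_
    rw [mul_apply_eq_comp, hT, hT, hT, ← mul_assoc, ← Complex.ofReal_mul,
      ← Real.exp_add]
    congr 3
    push_cast
    ring
  · intro x
    refine continuous_iff_continuousAt.2 fun t => ?_
    refine tendsto_of_tendsto_inner b (z := x) (fun i => ?_)
      (Eventually.of_forall fun s i => hTn s x i)
    simp only [hT]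
    refine Continuous.tendsto ?_ t
    fun_prop
  · intro x y
    rw [hb.mem_graph_iff hH]
    have hco : ∀ (h : ℝ≥0) i, inner ℂ (b i) ((((h : ℝ)⁻¹ : ℝ) : ℂ) • (x - T h x)) =
        (((h : ℝ)⁻¹ * (1 - Real.exp (-(h : ℝ) * ev i)) : ℝ) : ℂ) * inner ℂ (b i) x := by
      intro h i
      rw [inner_smul_right, inner_sub_right, hT]
      push_cast
      ring
    have hlim : ∀ i, Tendsto (fun h : ℝ≥0 => (h : ℝ)⁻¹ * (1 - Real.exp (-(h : ℝ) * ev i)))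
        (𝓝[>] 0) (𝓝 (ev i)) := by
      intro i
      -- The limit of (1 - e^(-hλ))/h is a derivative at 0.
      have hd : HasDerivAt (fun h : ℝ => -Real.exp (-h * ev i)) (ev i) 0 := by
        have := ((hasDerivAt_id (0 : ℝ)).neg.mul_const (ev i)).exp.neg
        simpa using! this
      have h1 := hasDerivAt_iff_tendsto_slope_zero.1 hd
      have h2 : Tendsto (fun h : ℝ≥0 => (h : ℝ)) (𝓝[>] 0) (𝓝[≠] 0) := by
        refine tendsto_nhdsWithin_iff.2 ⟨?_, ?_⟩
        · exact (NNReal.continuous_coe.tendsto 0).mono_left nhdsWithin_le_nhds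
        · filter_upwards [self_mem_nhdsWithin] with h hh
          exact_mod_cast (ne_of_gt hh)
      refine (h1.comp h2).congr fun h => ?_
      simp only [Function.comp_apply, smul_eq_mul, zero_add, neg_zero, zero_mul, Real.exp_zero]
      ring
    constructor
    · intro h
      refine tendsto_of_tendsto_inner b (z := y) (fun i => ?_) ?_
      · simp only [hco, h i]
        exact ((Complex.continuous_ofReal.tendsto _).comp (hlim i)).mul_const _
      -- From 1 - e^(-sλ) ≤ sλ, the coefficients of the difference quotient are dominated by those
      -- of y = Hx.
      · filter_upwards [self_mem_nhdsWithin] with s hs i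
        have hs' : (0 : ℝ) < s := by exact_mod_cast hs
        rw [hco, h i, norm_mul, norm_mul, Complex.norm_real, Complex.norm_real]
        refine mul_le_mul_of_nonneg_right ?_ (norm_nonneg _)
        have h1 : Real.exp (-(s : ℝ) * ev i) ≤ 1 := (le_abs_self _).trans (hle s i)
        rw [Real.norm_of_nonneg (mul_nonneg (by positivity) (by linarith)),
          Real.norm_of_nonneg (hev i), inv_mul_le_iff₀ hs']
        have := Real.add_one_le_exp (-(s : ℝ) * ev i)
        linarith
    · intro h i
      have h1 : Tendsto (fun s : ℝ≥0 => inner ℂ (b i) ((((s : ℝ)⁻¹ : ℝ) : ℂ) • (x - T s x)))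
          (𝓝[>] 0) (𝓝 (inner ℂ (b i) y)) :=
        ((innerSL ℂ (b i)).continuous.tendsto y).comp h
      simp only [hco] at h1
      have hne : (𝓝[>] (0 : ℝ≥0)).NeBot := inferInstance
      exact tendsto_nhds_unique h1
        (((Complex.continuous_ofReal.tendsto _).comp (hlim i)).mul_const _)

section Trace

variable {ι κ : Type*} (b : HilbertBasis ι ℂ E) {a : ι → ℝ} (ha : ∀ i, 0 ≤ a i)
  {D : E →L[ℂ] E} (hD : ∀ x i, inner ℂ (b i) (D x) = a i * inner ℂ (b i) x)
include ha hD

omit [CompleteSpace E] in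
lemma isPositive_of_diagonal : D.IsPositive := by
  have hs : ∀ x y, inner ℂ x (D y) = ∑' i, (a i : ℂ) * (inner ℂ x (b i) * inner ℂ (b i) y) := by
    intro x y
    rw [← b.tsum_inner_mul_inner]
    refine tsum_congr fun i => ?_
    rw [hD]
    ring
  rw [ContinuousLinearMap.isPositive_iff]
  constructor
  · intro x y
    change inner ℂ (D x) y = inner ℂ x (D y)
    rw [← inner_conj_symm, hs, hs, Complex.conj_tsum]
    refine tsum_congr fun i => ?_
    rw [map_mul, map_mul, Complex.conj_ofReal, inner_conj_symm, inner_conj_symm]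
    ring
  · intro x
    rw [← inner_conj_symm, hs]
    have h1 : ∀ i, (a i : ℂ) * (inner ℂ x (b i) * inner ℂ (b i) x)
        = ((a i * ‖inner ℂ (b i) x‖ ^ 2 : ℝ) : ℂ) := fun i => by
      rw [← inner_conj_symm x (b i), Complex.conj_mul']
      push_cast
      ring
    simp only [h1]
    rw [← Complex.ofReal_tsum, Complex.conj_ofReal]
    exact_mod_cast tsum_nonneg fun i => mul_nonneg (ha i) (sq_nonneg _)

-- Basis independence of the trace: the double family a i * |⟪c j, b i⟫|² is nonnegative. Summed
-- over j first it gives a i, since b i has norm one; summed over i first it gives ⟪c j, D (c j)⟫.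
omit [CompleteSpace E] in
lemma hasSum_inner_of_diagonal (hsum : Summable a) (c : HilbertBasis κ ℂ E) :
    HasSum (fun j => inner ℂ (c j) (D (c j))) ((∑' i, a i : ℝ) : ℂ) := by
  have h1 : ∀ i, HasSum (fun j => a i * ‖inner ℂ (c j) (b i)‖ ^ 2) (a i) := fun i => by
    simpa [b.orthonormal.1 i] using (hasSum_norm_sq_inner c (b i)).mul_left (a i)
  have h2 : ∀ x, HasSum (fun i => a i * ‖inner ℂ (b i) x‖ ^ 2) (inner ℂ x (D x)).re := fun x => by
    convert! Complex.hasSum_re (b.hasSum_inner_mul_inner x (D x)) using 1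
    funext i
    rw [hD, mul_left_comm, ← inner_conj_symm x (b i), Complex.conj_mul', ← Complex.ofReal_pow,
      ← Complex.ofReal_mul, Complex.ofReal_re]
  have hp : Summable fun p : ι × κ => a p.1 * ‖inner ℂ (c p.2) (b p.1)‖ ^ 2 := by
    refine (summable_prod_of_nonneg fun p => mul_nonneg (ha _) (sq_nonneg _)).2
      ⟨fun i => (h1 i).summable, ?_⟩
    simpa only [fun i => (h1 i).tsum_eq] using hsum
  have h3 : HasSum (fun p : ι × κ => a p.1 * ‖inner ℂ (c p.2) (b p.1)‖ ^ 2) (∑' i, a i) := by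
    have h4 := hp.hasSum
    have h5 := h4.prod_fiberwise h1
    rwa [h5.tsum_eq]
  have h4 : HasSum (fun j => (inner ℂ (c j) (D (c j))).re) (∑' i, a i) := by
    refine ((Equiv.prodComm κ ι).hasSum_iff.2 h3).prod_fiberwise fun j => ?_
    simp only [Function.comp_apply, Equiv.prodComm_apply, Prod.fst_swap, Prod.snd_swap]
    convert! h2 (c j) using 4 with i
    rw [norm_inner_symm]
  have h5 : HasSum (fun j => (((inner ℂ (c j) (D (c j))).re : ℝ) : ℂ)) ((∑' i, a i : ℝ) : ℂ) :=
    Complex.hasSum_ofReal.2 h4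
  convert! h5 using 2 with j
  have h6 : ∀ x, HasSum (fun i => ((a i * ‖inner ℂ (b i) x‖ ^ 2 : ℝ) : ℂ)) (inner ℂ x (D x)) := by
    intro x
    convert! b.hasSum_inner_mul_inner x (D x) using 1
    funext i
    rw [hD, mul_left_comm, ← inner_conj_symm x (b i), Complex.conj_mul', ← Complex.ofReal_pow,
      ← Complex.ofReal_mul]
  exact (h6 _).unique (Complex.hasSum_ofReal.2 (h2 _))

end Trace

theorem IsEigenbasis.exists_traceClass_expSemigroup (hb : IsEigenbasis H ev b)
    (hH : IsSelfAdjoint H) (hev : ∀ i, 0 ≤ ev i)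
    (hsum : ∀ β : ℝ≥0, 0 < β → Summable fun i => Real.exp (-(β : ℝ) * ev i)) :
    ∃ T, IsExpSemigroup H T ∧ ∀ β : ℝ≥0, 0 < β → IsTraceClass (T β) ∧
      HasTrace (T β) ((∑' i, Real.exp (-(β : ℝ) * ev i) : ℝ) : ℂ) := by
  obtain ⟨T, hT, hD⟩ := hb.exists_expSemigroup hH hev
  refine ⟨T, hT, fun β hβ => ?_⟩
  have htr : HasTrace (T β) ((∑' i, Real.exp (-(β : ℝ) * ev i) : ℝ) : ℂ) := fun ι c =>
    hasSum_inner_of_diagonal b (fun i => (Real.exp_pos _).le) (hD β) (hsum β hβ) c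
  refine ⟨fun ι c => ?_, htr⟩
  have hpos : (0 : E →L[ℂ] E) ≤ T β := (ContinuousLinearMap.nonneg_iff_isPositive _).2
    (isPositive_of_diagonal b (fun i => (Real.exp_pos _).le) (hD β))
  -- A positive operator is its own absolute value, so the trace series itself proves the trace
  -- class property.
  rw [CFC.abs_of_nonneg _ hpos]
  exact (Complex.hasSum_re (htr ι c)).summable

end Diagonal

/-! ### Enumerating a discrete set of eigenvalues and summing exponentials -/

section Enumeration

/-- The number of elements of S below s is a strictly increasing function of s ∈ S. It identifies S
with an infinite subset of ℕ, which is order isomorphic to ℕ. -/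
lemma exists_strictMono_range_eq {S : Set ℝ} (hS : S.Infinite)
    (hfin : ∀ M : ℝ, (S ∩ Iio M).Finite) : ∃ ev : ℕ → ℝ, StrictMono ev ∧ range ev = S := by
  have : Infinite S := hS.to_subtype
  let cnt : S → ℕ := fun s => (S ∩ Iio (s : ℝ)).ncard
  have hcnt : StrictMono cnt := fun s t hst => by
    refine ncard_lt_ncard ?_ (hfin t)
    refine ⟨fun x hx => ⟨hx.1, lt_trans (show x < s from hx.2) hst⟩, fun h => ?_⟩
    exact lt_irrefl (s : ℝ) (h ⟨s.2, hst⟩).2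
  have : Infinite (range cnt) := (infinite_range_of_injective hcnt.injective).to_subtype
  classical
  let e : ℕ ≃o S := (Nat.Subtype.orderIsoOfNat (range cnt)).trans (hcnt.orderIso cnt).symm
  refine ⟨fun k => e k, fun k l hkl => e.strictMono hkl, ?_⟩
  ext x
  constructor
  · rintro ⟨k, rfl⟩
    exact (e k).2
  · intro hx
    exact ⟨e.symm ⟨x, hx⟩, by simp⟩

/-- Polynomial counting means k + 1 ≤ C (ev k + 2)^p, while e^(-βx) decays faster than x^(-2p); so
the terms are O((k + 1)⁻²). -/
lemma summable_exp_of_card_le {ev : ℕ → ℝ} (hmono : StrictMono ev) (h0 : 0 < ev 0) {C p : ℕ}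
    (hcard : ∀ (M : ℕ) (k : ℕ), 1 ≤ M → ev k < M → k + 1 ≤ C * M ^ p) {β : ℝ} (hβ : 0 < β) :
    Summable fun i => Real.exp (-β * ev i) := by
  have hpos : ∀ i, 0 < ev i := fun i => h0.trans_le (hmono.monotone (Nat.zero_le i))
  have hle : ∀ i : ℕ, ((i : ℝ) + 1) ≤ C * (ev i + 2) ^ p := fun i => by
    have h1 := hcard (⌊ev i⌋₊ + 1) i (by omega) (by exact_mod_cast Nat.lt_floor_add_one (ev i))
    have h2 : ((i + 1 : ℕ) : ℝ) ≤ ((C * (⌊ev i⌋₊ + 1) ^ p : ℕ) : ℝ) := by exact_mod_cast h1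
    push_cast at h2
    refine h2.trans ?_
    have h3 := Nat.floor_le (hpos i).le
    gcongr
    linarith
  -- The factor e^(2β) pays for the shift from ev i to ev i + 2, and (2p)!/β^(2p) comes from e^x ≥
  -- x^(2p)/(2p)!.
  set D : ℝ := Real.exp (2 * β) * ((2 * p).factorial / β ^ (2 * p)) * C ^ 2 with hD
  have hs : Summable fun i : ℕ => D * (1 / ((i : ℝ) + 1) ^ 2) := by
    refine Summable.mul_left _ ?_
    have := (summable_nat_add_iff 1).2 (Real.summable_one_div_nat_pow.2 one_lt_two)
    simpa using this
  refine Summable.of_nonneg_of_le (fun i => (Real.exp_pos _).le) (fun i => ?_) hs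
  have hx : 0 < ev i + 2 := by linarith [hpos i]
  have h1 := Real.pow_div_factorial_le_exp (β * (ev i + 2)) (by positivity) (2 * p)
  have h2 : Real.exp (-β * ev i) = Real.exp (2 * β) * (Real.exp (β * (ev i + 2)))⁻¹ := by
    rw [← Real.exp_neg, ← Real.exp_add]
    ring_nf
  have h3 : (Real.exp (β * (ev i + 2)))⁻¹ ≤ ((β * (ev i + 2)) ^ (2 * p) / (2 * p).factorial)⁻¹ :=
    inv_anti₀ (by positivity) h1
  have hi : (0 : ℝ) < (i : ℝ) + 1 := by positivity
  have h4 : 1 / (ev i + 2) ^ (2 * p) ≤ C ^ 2 * (1 / ((i : ℝ) + 1) ^ 2) := by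
    rw [mul_one_div, div_le_div_iff₀ (by positivity) (by positivity), one_mul]
    have := pow_le_pow_left₀ hi.le (hle i) 2
    rw [mul_pow, ← pow_mul, mul_comm p 2] at this
    exact this
  calc Real.exp (-β * ev i) ≤ Real.exp (2 * β) *
        ((β * (ev i + 2)) ^ (2 * p) / (2 * p).factorial)⁻¹ := by
        rw [h2]; gcongr
    _ = Real.exp (2 * β) * ((2 * p).factorial / β ^ (2 * p)) * (1 / (ev i + 2) ^ (2 * p)) := by
        rw [mul_pow]; field_simp
    _ ≤ Real.exp (2 * β) * ((2 * p).factorial / β ^ (2 * p)) * (C ^ 2 * (1 / ((i : ℝ) + 1) ^ 2)) := by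
        gcongr
    _ = _ := by rw [hD]; ring

end Enumeration

/-! ### Spectral theory from coercivity modulo finitely many functionals -/

section Spectral

universe u

variable {E : Type u} [NormedAddCommGroup E] [InnerProductSpace ℂ E] [CompleteSpace E]
variable {K : Type*} [NormedAddCommGroup K] [InnerProductSpace ℂ K] [CompleteSpace K]
variable {W : Type*} [AddCommGroup W] [Module ℂ W]
variable {i τ : W →ₗ[ℂ] E} {δ : W →ₗ[ℂ] K} {T : E →ₗ.[ℂ] E}

omit [CompleteSpace E] [CompleteSpace K] in
lemma formSpace_coercive {M B : ℝ} {N : ℕ} {g : Fin N → E}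
    (hg : ∀ w, M * ‖i w‖ ^ 2 ≤ ‖δ w‖ ^ 2 + B * ∑ j, ‖inner ℂ (g j) (i w)‖ ^ 2)
    (v : formSpace i δ) : M * ‖formIncl i δ v‖ ^ 2 ≤
      ‖formGrad i δ v‖ ^ 2 + B * ∑ j, ‖inner ℂ (g j) (formIncl i δ v)‖ ^ 2 := by
  refine denseRange_formMk.induction_on v (isClosed_le ?_ ?_) fun w => by simpa using hg w
  · exact continuous_const.mul ((formIncl i δ).continuous.norm.pow 2)
  · refine ((formGrad i δ).continuous.norm.pow 2).add (continuous_const.mul ?_)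
    refine continuous_finsetSum _ fun j _ => ?_
    exact ((continuous_const.inner (formIncl i δ).continuous).norm).pow 2

/-- If the functionals g j vanish on v, then M‖Jv‖² is at most the energy of v. Thus J is small on a
subspace of finite codimension and is a norm limit of the finite rank operators J P, with P the
projections onto the spans of the J* g j. -/
lemma isCompactOperator_formIncl
    (hco : ∀ M : ℕ, 1 ≤ M → ∃ (N : ℕ) (g : Fin N → E) (B : ℝ),
      ∀ w, M * ‖i w‖ ^ 2 ≤ ‖δ w‖ ^ 2 + B * ∑ j, ‖inner ℂ (g j) (i w)‖ ^ 2) :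
    IsCompactOperator (formIncl i δ) := by
  -- The shift by one meets the condition 1 ≤ M and makes the error bound (M + 1)^(-1/2).
  choose N g B hB using fun M : ℕ => hco (M + 1) (by omega)
  let U : ℕ → Submodule ℂ (formSpace i δ) := fun M =>
    Submodule.span ℂ (range fun j => (formIncl i δ).adjoint (g M j))
  have hfd : ∀ M, FiniteDimensional ℂ (U M) := fun M =>
    FiniteDimensional.span_of_finite ℂ (finite_range _)
  have hcp : ∀ M, (U M).HasOrthogonalProjection := fun M => inferInstance
  refine isCompactOperator_of_tendsto (l := atTop)
    (F := fun M => formIncl i δ ∘L (U M).starProjection) ?_ (Eventually.of_forall fun M => ?_)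
  · refine (tendsto_iff_norm_sub_tendsto_zero (E := formSpace i δ →L[ℂ] E)).2 ?_
    have hlim : Tendsto (fun M : ℕ => Real.sqrt (1 / ((M : ℝ) + 1))) atTop (𝓝 0) := by
      simpa using (tendsto_one_div_add_atTop_nhds_zero_nat (𝕜 := ℝ)).sqrt
    refine squeeze_zero
      (fun M => norm_nonneg (formIncl i δ ∘L (U M).starProjection - formIncl i δ))
      (fun M => ?_) hlim
    refine ContinuousLinearMap.opNorm_le_bound _ (Real.sqrt_nonneg _) fun v => ?_
    set v' := v - (U M).starProjection v with hv'
    have h1 : formIncl i δ v' = -((formIncl i δ ∘L (U M).starProjection - formIncl i δ) v) := by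
      simp [hv']
    have h2 : ∀ j, inner ℂ (g M j) (formIncl i δ v') = 0 := fun j => by
      have hmem : (formIncl i δ).adjoint (g M j) ∈ U M := Submodule.subset_span ⟨j, rfl⟩
      rw [← ContinuousLinearMap.adjoint_inner_left, ← inner_conj_symm, hv',
        Submodule.starProjection_inner_eq_zero _ _ hmem, map_zero]
    have h3 := formSpace_coercive (hB M) v'
    simp only [h2, norm_zero, ne_eq, OfNat.ofNat_ne_zero, not_false_eq_true, zero_pow,
      Finset.sum_const_zero, mul_zero, add_zero] at h3
    have h4 : ‖v'‖ ≤ ‖v‖ := by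
      have h5 : v' = (U M)ᗮ.starProjection v := by
        rw [Submodule.starProjection_orthogonal_val]
      rw [h5]
      exact Submodule.norm_starProjection_apply_le _ _
    have h5 := formSpace_norm_sq v'
    rw [← norm_neg, ← h1, ← Real.sqrt_sq (norm_nonneg v), ← Real.sqrt_mul (by positivity)]
    refine Real.le_sqrt_of_sq_le ?_
    rw [one_div_mul_eq_div, le_div_iff₀ (by positivity)]
    have h6 := pow_le_pow_left₀ (norm_nonneg v') h4 2
    push_cast at h3
    nlinarith [sq_nonneg ‖formIncl i δ v'‖]
  · have h1 : IsCompactOperator (U M).subtypeL := isCompactOperator_of_locallyCompactSpace_rng _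
    exact (h1.comp_clm (U M).orthogonalProjectionOnto).clm_comp (formIncl i δ)

namespace IsFormFactor

variable (h : IsFormFactor T i τ δ)
include h

/-- The eigenvectors of the Friedrichs extension for the real number `l`. -/
lemma mem_friedrichs_graph_smul_iff {l : ℝ} (hl : 0 < 1 + l) (x : E) :
    (x, (l : ℂ) • x) ∈ (friedrichs T).graph ↔
      formResolvent i δ x = ((1 + l : ℝ) : ℂ)⁻¹ • x := by
  have hl' : ((1 + l : ℝ) : ℂ) ≠ 0 := by exact_mod_cast hl.ne'
  have e : x + (l : ℂ) • x = ((1 + l : ℝ) : ℂ) • x := by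
    push_cast
    rw [add_smul, one_smul]
  rw [h.mem_friedrichs_graph_iff, e, map_smul, eq_comm, eq_inv_smul_iff₀ hl']

lemma friedrichs_coercive {M B : ℝ} {N : ℕ} {g : Fin N → E}
    (hg : ∀ w, M * ‖i w‖ ^ 2 ≤ ‖δ w‖ ^ 2 + B * ∑ j, ‖inner ℂ (g j) (i w)‖ ^ 2)
    {x y : E} (hxy : (x, y) ∈ (friedrichs T).graph) :
    M * ‖x‖ ^ 2 ≤ (inner ℂ x y).re + B * ∑ j, ‖inner ℂ (g j) x‖ ^ 2 := by
  obtain ⟨⟨v, rfl⟩, hv⟩ := (h.mem_friedrichs_graph _ _).1 hxy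
  have h1 : ∀ v' : formSpace i δ, inner ℂ (formGrad i δ v') (formGrad i δ v)
      = inner ℂ (formIncl i δ v') y := fun v' => by
    refine denseRange_formMk.induction_on v' (isClosed_eq ?_ ?_) fun w => ?_
    · exact (formGrad i δ).continuous.inner continuous_const
    · exact (formIncl i δ).continuous.inner continuous_const
    · rw [formGrad_formMk, formIncl_formMk, ← hv, h.grad_inner]
  have h2 : (inner ℂ (formIncl i δ v) y).re = ‖formGrad i δ v‖ ^ 2 := by
    rw [← h1, inner_self_eq_norm_sq_to_K]
    simp [← Complex.ofReal_pow]
  rw [h2]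
  exact formSpace_coercive hg v

lemma symmetric_friedrichs {x y x' y' : E} (hxy : (x, y) ∈ (friedrichs T).graph)
    (hxy' : (x', y') ∈ (friedrichs T).graph) : inner ℂ y x' = inner ℂ x y' := by
  have h1 := h.isSelfAdjoint_friedrichs
  rw [← LinearPMap.isSelfAdjoint_def.1 h1, LinearPMap.adjoint_graph_eq_graph_adjoint h1.dense_domain,
    Submodule.mem_adjoint_iff] at hxy'
  exact sub_eq_zero.1 (hxy' _ _ hxy)

/-- The minimax argument: among more than N eigenvectors some nonzero combination is killed by all N
functionals. Coercivity gives it energy at least M times its squared norm, but its energy is a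
combination of eigenvalues below M. -/
lemma card_eigenvalues_le {M B : ℝ} {N : ℕ} {g : Fin N → E}
    (hg : ∀ w, M * ‖i w‖ ^ 2 ≤ ‖δ w‖ ^ 2 + B * ∑ j, ‖inner ℂ (g j) (i w)‖ ^ 2)
    {κ : Type*} [Fintype κ] {ev : κ → ℝ} {e : κ → E} (he : Orthonormal ℂ e)
    (hev : ∀ k, (e k, (ev k : ℂ) • e k) ∈ (friedrichs T).graph) (hlt : ∀ k, ev k < M) :
    Fintype.card κ ≤ N := by
  by_contra! hcard
  let f : (κ → ℂ) →ₗ[ℂ] (Fin N → ℂ) :=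
    { toFun := fun c j => inner ℂ (g j) (∑ k, c k • e k)
      map_add' := fun c d => by
        ext j; simp [add_smul, Finset.sum_add_distrib]
      map_smul' := fun a c => by
        ext j; simp [mul_smul, ← Finset.smul_sum] }
  have hker := LinearMap.ker_ne_bot_of_finrank_lt (f := f) (by simpa using hcard)
  obtain ⟨c, hc, hc0⟩ := (Submodule.ne_bot_iff _).1 hker
  have hfc : ∀ j, inner ℂ (g j) (∑ k, c k • e k) = 0 := fun j =>
    congrFun (LinearMap.mem_ker.1 hc) j
  have hmem : (∑ k, c k • e k, ∑ k, c k • (ev k : ℂ) • e k) ∈ (friedrichs T).graph := by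
    have : (∑ k, c k • e k, ∑ k, c k • (ev k : ℂ) • e k)
        = ∑ k, c k • (e k, (ev k : ℂ) • e k) := by
      ext <;> simp [Prod.fst_sum, Prod.snd_sum]
    rw [this]
    exact Submodule.sum_mem _ fun k _ => Submodule.smul_mem _ _ (hev k)
  have h1 := h.friedrichs_coercive hg hmem
  simp only [hfc, norm_zero, ne_eq, OfNat.ofNat_ne_zero, not_false_eq_true, zero_pow,
      Finset.sum_const_zero, mul_zero, add_zero] at h1
  have h2 : (inner ℂ (∑ k, c k • e k) (∑ k, c k • (ev k : ℂ) • e k)).re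
      = ∑ k, ev k * ‖c k‖ ^ 2 := by
    simp only [← mul_smul]
    rw [he.inner_sum, Complex.re_sum]
    refine Finset.sum_congr rfl fun k _ => ?_
    rw [← mul_assoc, Complex.conj_mul', ← Complex.ofReal_pow, ← Complex.ofReal_mul,
      Complex.ofReal_re, mul_comm]
  have h3 : ‖∑ k, c k • e k‖ ^ 2 = ∑ k, ‖c k‖ ^ 2 := by
    have h4 : (inner ℂ (∑ k, c k • e k) (∑ k, c k • e k)).re = ∑ k, ‖c k‖ ^ 2 := by
      rw [he.inner_sum, Complex.re_sum]
      refine Finset.sum_congr rfl fun k _ => ?_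
      rw [Complex.conj_mul', ← Complex.ofReal_pow, Complex.ofReal_re]
    rw [← h4, inner_self_eq_norm_sq_to_K]
    simp [← Complex.ofReal_pow]
  rw [h2, h3, Finset.mul_sum] at h1
  obtain ⟨k, hk⟩ := Function.ne_iff.1 hc0
  refine absurd h1 (not_le.2 (Finset.sum_lt_sum (fun k _ => ?_) ⟨k, Finset.mem_univ k, ?_⟩))
  · exact mul_le_mul_of_nonneg_right (hlt k).le (sq_nonneg _)
  · exact mul_lt_mul_of_pos_right (hlt k) (by have := norm_pos_iff.2 hk; positivity)

/-- The spectral theorem for the compact operator J J*, whose eigenvalues μ correspond to l = 1/μ -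
1. Simplicity allows one unit vector per eigenvalue, so that the basis is indexed by the set of
eigenvalues itself. -/
theorem exists_eigenbasis {C p : ℕ} {c₀ : ℝ} (hc₀ : 0 < c₀)
    (hpos : ∀ w, c₀ * ‖i w‖ ^ 2 ≤ ‖δ w‖ ^ 2)
    (hco : ∀ M : ℕ, 1 ≤ M → ∃ (N : ℕ) (g : Fin N → E) (B : ℝ), N ≤ C * M ^ p ∧
      ∀ w, M * ‖i w‖ ^ 2 ≤ ‖δ w‖ ^ 2 + B * ∑ j, ‖inner ℂ (g j) (i w)‖ ^ 2)
    (hsimple : ∀ (l : ℝ) (x y : E), (x, (l : ℂ) • x) ∈ (friedrichs T).graph →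
      (y, (l : ℂ) • y) ∈ (friedrichs T).graph → x ≠ 0 → ∃ c : ℂ, y = c • x)
    (hinf : ¬ FiniteDimensional ℂ E) :
    ∃ ev : ℕ → ℝ, 0 < ev 0 ∧ StrictMono ev ∧ (∃ b, IsEigenbasis (friedrichs T) ev b) ∧
      ∀ β : ℝ≥0, 0 < β → Summable fun i => Real.exp (-(β : ℝ) * ev i) := by
  have hcompact : IsCompactOperator (formResolvent i δ) := by
    have h1 : IsCompactOperator (formIncl i δ) := isCompactOperator_formIncl fun M hM => by
      obtain ⟨N, g, B, -, hB⟩ := hco M hM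
      exact ⟨N, g, B, hB⟩
    exact h1.comp_clm (formIncl i δ).adjoint
  have hspec := ContinuousLinearMap.orthogonalComplement_iSup_eigenspaces_eq_bot hcompact
    (formResolvent_isPositive (i := i) (δ := δ)).isSymmetric
  let S : Set ℝ := {l | ∃ x : E, x ≠ 0 ∧ (x, (l : ℂ) • x) ∈ (friedrichs T).graph}
  have hSpos : ∀ l ∈ S, c₀ ≤ l := by
    rintro l ⟨x, hx0, hx⟩
    have h1 := h.friedrichs_coercive (M := c₀) (B := 0) (N := 0) (g := Fin.elim0)
      (fun w => by simpa using hpos w) hx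
    have h2 : (inner ℂ x ((l : ℂ) • x)).re = l * ‖x‖ ^ 2 := by
      rw [inner_smul_right, inner_self_eq_norm_sq_to_K]
      simp [← Complex.ofReal_pow]
    rw [h2, zero_mul, add_zero] at h1
    exact le_of_mul_le_mul_right h1 (by have := norm_pos_iff.2 hx0; positivity)
  have hunit : ∀ l : S, ∃ x : E, ‖x‖ = 1 ∧ (x, ((l : ℝ) : ℂ) • x) ∈ (friedrichs T).graph := by
    rintro ⟨l, x, hx0, hx⟩
    refine ⟨((‖x‖ : ℂ)⁻¹) • x, ?_, ?_⟩
    · rw [norm_smul, norm_inv, Complex.norm_real, norm_norm,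
        inv_mul_cancel₀ (norm_ne_zero_iff.2 hx0)]
    · have := Submodule.smul_mem _ ((‖x‖ : ℂ)⁻¹) hx
      rwa [Prod.smul_mk, smul_comm] at this
  choose e he1 he2 using hunit
  have heo : Orthonormal ℂ e := by
    refine ⟨he1, fun l l' hll => ?_⟩
    have h1 := h.symmetric_friedrichs (he2 l) (he2 l')
    rw [inner_smul_left, inner_smul_right, Complex.conj_ofReal, ← sub_eq_zero, ← sub_mul] at h1
    refine (mul_eq_zero.1 h1).resolve_left ?_
    rw [← Complex.ofReal_sub]
    exact_mod_cast sub_ne_zero.2 fun h => hll (Subtype.ext h)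
  have hspan : (Submodule.span ℂ (range e))ᗮ = ⊥ := by
    refine le_bot_iff.1 (le_trans (Submodule.orthogonal_le ?_) hspec.le)
    refine iSup_le fun μ x hx => ?_
    have hx' : formResolvent i δ x = μ • x := Module.End.mem_eigenspace_iff.1 hx
    by_cases hx0 : x = 0
    · rw [hx0]; exact Submodule.zero_mem _
    have hJ : (formIncl i δ).adjoint x ≠ 0 := fun h0 =>
      hx0 (h.adjoint_formIncl_injective (by rw [h0, map_zero]))
    have h1 := formResolvent_inner_self (i := i) (δ := δ) x
    rw [hx', inner_smul_right, inner_self_eq_norm_sq_to_K] at h1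
    -- The Rayleigh quotient of J J* at x. It equals the complex eigenvalue μ, which is therefore
    -- real, and it is positive because J* is injective.
    set α : ℝ := ‖(formIncl i δ).adjoint x‖ ^ 2 / ‖x‖ ^ 2 with hα
    have hxn := norm_pos_iff.2 hx0
    have hJn := norm_pos_iff.2 hJ
    have hαpos : 0 < α := by positivity
    have hμ : μ = α := by
      rw [hα, Complex.ofReal_div, eq_div_iff (by exact_mod_cast (by positivity : ‖x‖ ^ 2 ≠ 0))]
      push_cast
      exact h1
    have hl : (1 + (α⁻¹ - 1)) = α⁻¹ := by ring
    have hg : (x, ((α⁻¹ - 1 : ℝ) : ℂ) • x) ∈ (friedrichs T).graph := by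
      rw [h.mem_friedrichs_graph_smul_iff (by rw [hl]; positivity), hl, hx', hμ]
      simp
    have hS : α⁻¹ - 1 ∈ S := ⟨x, hx0, hg⟩
    obtain ⟨c, hc⟩ := hsimple _ _ _ (he2 ⟨_, hS⟩) hg
      (norm_ne_zero_iff.1 (by rw [he1]; exact one_ne_zero))
    rw [hc]
    exact Submodule.smul_mem _ _ (Submodule.subset_span ⟨_, rfl⟩)
  classical
  have hcount : ∀ (M : ℕ), 1 ≤ M → ∀ F : Finset S, (∀ l ∈ F, (l : ℝ) < M) → F.card ≤ C * M ^ p := by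
    intro M hM F hF
    obtain ⟨N, g, B, hN, hB⟩ := hco M hM
    have := h.card_eigenvalues_le hB (heo.comp (fun l : F => (l : S)) Subtype.val_injective)
      (fun l => he2 l) (fun l => hF l l.2)
    rw [Fintype.card_coe] at this
    exact this.trans hN
  have hfin : ∀ M : ℝ, (S ∩ Iio M).Finite := by
    intro M
    by_contra hinfM
    obtain ⟨F, hF, hFc⟩ := Set.Infinite.exists_subset_card_eq hinfM (C * (⌈M⌉₊ + 1) ^ p + 1)
    have h1 : ∀ l ∈ F, l ∈ S := fun l hl => (hF hl).1
    have h2 := hcount (⌈M⌉₊ + 1) (by omega) (F.subtype (· ∈ S)) (fun l hl => by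
      have h3 : (l : ℝ) < M := (hF (Finset.mem_subtype.1 hl)).2
      have h4 := Nat.le_ceil M
      push_cast
      linarith)
    rw [Finset.card_subtype, Finset.filter_true_of_mem h1, hFc] at h2
    omega
  -- Finitely many simple eigenvalues would have a finite dimensional span with trivial orthogonal
  -- complement.
  have hSinf : S.Infinite := by
    intro hSfin
    have : Finite S := hSfin
    refine hinf ?_
    have hfd : FiniteDimensional ℂ (Submodule.span ℂ (range e)) :=
      FiniteDimensional.span_of_finite ℂ (finite_range _)
    rw [Submodule.orthogonal_eq_bot_iff] at hspan
    rw [hspan] at hfd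
    exact Module.Finite.equiv (Submodule.topEquiv (R := ℂ) (M := E))
  obtain ⟨ev, hmono, hrange⟩ := exists_strictMono_range_eq hSinf hfin
  have hevS : ∀ k, ev k ∈ S := fun k => hrange ▸ mem_range_self k
  have hev0 : 0 < ev 0 := hc₀.trans_le (hSpos _ (hevS 0))
  refine ⟨ev, hev0, hmono, ?_, fun β hβ => ?_⟩
  · have ho : Orthonormal ℂ fun k => e ⟨ev k, hevS k⟩ :=
      heo.comp _ fun k l hkl => hmono.injective (congrArg Subtype.val hkl)
    have hr : range (fun k => e ⟨ev k, hevS k⟩) = range e := by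
      ext x
      constructor
      · rintro ⟨k, rfl⟩
        exact ⟨_, rfl⟩
      · rintro ⟨l, rfl⟩
        have hl : (l : ℝ) ∈ range ev := by rw [hrange]; exact l.2
        obtain ⟨k, hk⟩ := hl
        exact ⟨k, congrArg e (Subtype.ext hk)⟩
    refine ⟨HilbertBasis.mkOfOrthogonalEqBot ho (by rw [hr, hspan]), fun k => ?_⟩
    rw [HilbertBasis.coe_mkOfOrthogonalEqBot]
    exact he2 _
  · refine summable_exp_of_card_le hmono hev0 (C := C) (p := p) (fun M k hM hk => ?_) hβ
    have h1 := hcount M hM ((Finset.range (k + 1)).map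
      ⟨fun j => ⟨ev j, hevS j⟩, fun a b hab => hmono.injective (congrArg Subtype.val hab)⟩) ?_
    · simpa using h1
    · intro l hl
      obtain ⟨j, hj, rfl⟩ := Finset.mem_map.1 hl
      refine lt_of_le_of_lt (hmono.monotone ?_) hk
      have := Finset.mem_range.1 hj
      omega

/-- If `-1` is not an eigenvalue of the adjoint, the operator is essentially self-adjoint. -/
theorem closure_eq_friedrichs
    (hker : ∀ x, (∀ w, inner ℂ (i w + τ w) x = 0) → x = 0) : T.closure = friedrichs T := by
  have hle : T.graph ≤ (friedrichs T).graph := by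
    rintro ⟨x, y⟩ hxy
    obtain ⟨w, rfl, rfl⟩ := (h.mem_graph _ _).1 hxy
    refine (h.mem_friedrichs_graph _ _).2 ⟨⟨formMk i δ w, rfl⟩, fun w' => ?_⟩
    rw [h.inner_eq, ← inner_conj_symm, ← h.inner_eq, inner_conj_symm]
  have hcl : (friedrichs T).IsClosed := h.isSelfAdjoint_friedrichs.isClosed
  have hcable : T.IsClosable :=
    hcl.isClosable.leIsClosable (LinearPMap.le_of_le_graph hle)
  refine LinearPMap.eq_of_eq_graph ?_
  rw [← hcable.graph_closure_eq_closure_graph]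
  refine le_antisymm (Submodule.topologicalClosure_minimal _ hle hcl) ?_
  -- The range of 1 + T is dense, so any x + y is a limit of vectors (1 + T) i w; the bounded
  -- resolvent turns this into convergence in the graph.
  have hdense : DenseRange (i + τ) := by
    have h0 : Dense ((LinearMap.range (i + τ) : Submodule ℂ E) : Set E) := by
      rw [Submodule.dense_iff_topologicalClosure_eq_top, Submodule.topologicalClosure_eq_top_iff,
        Submodule.eq_bot_iff]
      intro x hx
      exact hker x fun w => (Submodule.mem_orthogonal _ _).1 hx _ ⟨w, rfl⟩
    rwa [LinearMap.coe_range] at h0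
  rintro ⟨x, y⟩ hxy
  rw [h.mem_friedrichs_graph_iff] at hxy
  rw [← SetLike.mem_coe, Submodule.topologicalClosure_coe]
  obtain ⟨z, hz, hzlim⟩ := mem_closure_iff_seq_limit.1 (hdense (x + y))
  choose w hw using hz
  have hiw : ∀ k, i (w k) = formResolvent i δ (z k) := fun k => by
    have h1 : (i (w k), τ (w k)) ∈ (friedrichs T).graph :=
      hle ((h.mem_graph _ _).2 ⟨w k, rfl, rfl⟩)
    rw [h.mem_friedrichs_graph_iff] at h1
    rw [← hw]
    exact h1
  have h1 : Tendsto (fun k => i (w k)) atTop (𝓝 x) := by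
    rw [hxy]
    simp only [hiw]
    exact ((formResolvent i δ).continuous.tendsto _).comp hzlim
  have h2 : Tendsto (fun k => τ (w k)) atTop (𝓝 y) := by
    have h3 := hzlim.sub h1
    rw [add_sub_cancel_left] at h3
    refine h3.congr fun k => ?_
    rw [← hw]
    simp
  exact mem_closure_of_tendsto (h1.prodMk_nhds h2)
    (Eventually.of_forall fun k => (h.mem_graph _ _).2 ⟨w k, rfl, rfl⟩)

end IsFormFactor
end Spectral

/-! ### The model operator on the line and its energy -/

section Line

/-- The measure `e^{αx} dx` on the real line. -/
def expMeasure (α : ℝ) : Measure ℝ :=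
  volume.withDensity fun x => ENNReal.ofReal (Real.exp (α * x))

instance (α : ℝ) : IsLocallyFiniteMeasure (expMeasure α) :=
  IsLocallyFiniteMeasure.withDensity_ofReal (by fun_prop)

lemma integral_expMeasure {F : Type*} [NormedAddCommGroup F] [NormedSpace ℝ F] (α : ℝ)
    (f : ℝ → F) : ∫ x, f x ∂(expMeasure α) = ∫ x, Real.exp (α * x) • f x := by
  rw [expMeasure, integral_withDensity_eq_integral_toReal_smul (by fun_prop) (by simp)]
  simp [ENNReal.toReal_ofReal, Real.exp_nonneg]

lemma setIntegral_expMeasure {F : Type*} [NormedAddCommGroup F] [NormedSpace ℝ F] (α : ℝ)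
    (f : ℝ → F) {s : Set ℝ} (hs : MeasurableSet s) :
    ∫ x in s, f x ∂(expMeasure α) = ∫ x in s, Real.exp (α * x) • f x := by
  rw [expMeasure, setIntegral_withDensity_eq_setIntegral_toReal_smul (by fun_prop) (by simp) _ hs]
  simp [ENNReal.toReal_ofReal, Real.exp_nonneg]

lemma ae_expMeasure_iff {α : ℝ} {p : ℝ → Prop} :
    (∀ᵐ x ∂(expMeasure α), p x) ↔ ∀ᵐ x, p x := by
  rw [expMeasure, ae_withDensity_iff (by fun_prop)]
  simp [Real.exp_pos]

lemma ae_expMeasure (α : ℝ) : ae (expMeasure α) = ae volume :=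
  Filter.ext fun _ => ae_expMeasure_iff

/-- Continuous functions with compact support. -/
def ccSpace : Submodule ℂ (ℝ → ℂ) where
  carrier := {f | Continuous f ∧ HasCompactSupport f}
  zero_mem' := ⟨continuous_const, HasCompactSupport.zero⟩
  add_mem' hf hg := ⟨hf.1.add hg.1, hf.2.add hg.2⟩
  smul_mem' c _ hf := ⟨hf.1.const_smul c, hf.2.smul_left (f := fun _ => c)⟩

lemma memLp_ccSpace (f : ccSpace) (μ : Measure ℝ) [IsLocallyFiniteMeasure μ] (p : ENNReal) :
    MemLp (f : ℝ → ℂ) p μ :=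
  f.2.1.memLp_of_hasCompactSupport f.2.2

/-- The inclusion of the continuous functions with compact support into `L²`. -/
def ccToLp (μ : Measure ℝ) [IsLocallyFiniteMeasure μ] : ccSpace →ₗ[ℂ] Lp ℂ 2 μ where
  toFun f := (memLp_ccSpace f μ 2).toLp
  map_add' _ _ := rfl
  map_smul' _ _ := rfl

lemma coeFn_ccToLp (μ : Measure ℝ) [IsLocallyFiniteMeasure μ] (f : ccSpace) :
    ccToLp μ f =ᵐ[μ] f := (memLp_ccSpace f μ 2).coeFn_toLp

lemma inner_ccToLp (μ : Measure ℝ) [IsLocallyFiniteMeasure μ] (f : ccSpace) (g : Lp ℂ 2 μ) :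
    inner ℂ (ccToLp μ f) g = ∫ x, (starRingEnd ℂ) ((f : ℝ → ℂ) x) * g x ∂μ := by
  rw [L2.inner_def]
  refine integral_congr_ae ?_
  filter_upwards [coeFn_ccToLp μ f] with x hx
  rw [hx, RCLike.inner_apply, mul_comm]

lemma inner_ccToLp_ccToLp (μ : Measure ℝ) [IsLocallyFiniteMeasure μ] (f g : ccSpace) :
    inner ℂ (ccToLp μ f) (ccToLp μ g) =
      ∫ x, (starRingEnd ℂ) ((f : ℝ → ℂ) x) * (g : ℝ → ℂ) x ∂μ := by
  rw [inner_ccToLp]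
  refine integral_congr_ae ?_
  filter_upwards [coeFn_ccToLp μ g] with x hx
  rw [hx]

lemma norm_sq_ccToLp (μ : Measure ℝ) [IsLocallyFiniteMeasure μ] (f : ccSpace) :
    ‖ccToLp μ f‖ ^ 2 = ∫ x, ‖(f : ℝ → ℂ) x‖ ^ 2 ∂μ := by
  have h := inner_ccToLp_ccToLp μ f f
  rw [inner_self_eq_norm_sq_to_K] at h
  have h2 : ∀ x, (starRingEnd ℂ) ((f : ℝ → ℂ) x) * (f : ℝ → ℂ) x
      = ((‖(f : ℝ → ℂ) x‖ ^ 2 : ℝ) : ℂ) := fun x => by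
    rw [Complex.conj_mul']; push_cast; rfl
  simp only [h2, integral_complex_ofReal] at h
  apply Complex.ofReal_injective
  rw [← h]
  push_cast
  rfl

/-- Multiplication by a real continuous function. -/
def ccMul (g : C(ℝ, ℝ)) : ccSpace →ₗ[ℂ] ccSpace where
  toFun f := ⟨fun x => (g x : ℂ) * (f : ℝ → ℂ) x,
    (Complex.continuous_ofReal.comp g.continuous).mul f.2.1, f.2.2.mul_left⟩
  map_add' f₁ f₂ := by ext x; simp [mul_add]
  map_smul' c f := by ext x; simp [mul_left_comm]

@[simp] lemma ccMul_apply (g : C(ℝ, ℝ)) (f : ccSpace) (x : ℝ) :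
    (ccMul g f : ℝ → ℂ) x = (g x : ℂ) * (f : ℝ → ℂ) x := rfl

/-- The test functions on the real line. -/
def testSpace : Submodule ℂ (ℝ → ℂ) where
  carrier := {f | ContDiff ℝ ∞ f ∧ HasCompactSupport f}
  zero_mem' := ⟨contDiff_const, HasCompactSupport.zero⟩
  add_mem' hf hg := ⟨hf.1.add hg.1, hf.2.add hg.2⟩
  smul_mem' c _ hf := ⟨contDiff_const.smul hf.1, hf.2.smul_left (f := fun _ => c)⟩

/-- Test functions are continuous with compact support. -/
def testVal : testSpace →ₗ[ℂ] ccSpace where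
  toFun f := ⟨f, f.2.1.continuous, f.2.2⟩
  map_add' _ _ := rfl
  map_smul' _ _ := rfl

lemma testSpace_differentiable (f : testSpace) : Differentiable ℝ (f : ℝ → ℂ) :=
  f.2.1.differentiable (by simp)

lemma testSpace_contDiff_deriv (f : testSpace) : ContDiff ℝ ∞ (deriv (f : ℝ → ℂ)) :=
  (contDiff_infty_iff_deriv.1 f.2.1).2

/-- The derivative of a test function. -/
def testDeriv : testSpace →ₗ[ℂ] testSpace where
  toFun f := ⟨deriv f, testSpace_contDiff_deriv f, f.2.2.deriv⟩
  map_add' f g := by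
    ext x
    exact deriv_add (testSpace_differentiable f x) (testSpace_differentiable g x)
  map_smul' c f := by
    ext x
    exact deriv_const_smul c (testSpace_differentiable f x)

@[simp] lemma testVal_apply (f : testSpace) : (testVal f : ℝ → ℂ) = f := rfl

@[simp] lemma testDeriv_apply (f : testSpace) : (testDeriv f : ℝ → ℂ) = deriv f := rfl

lemma testSpace_hasDerivAt (f : testSpace) (x : ℝ) :
    HasDerivAt (f : ℝ → ℂ) ((testDeriv f : ℝ → ℂ) x) x :=
  (testSpace_differentiable f x).hasDerivAt

/-- The function `e^{βx}`. -/
def expWeight (β : ℝ) : C(ℝ, ℝ) := ⟨fun x => Real.exp (β * x), by fun_prop⟩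

/-- The square root of a continuous function. -/
def sqrtWeight (V : C(ℝ, ℝ)) : C(ℝ, ℝ) := ⟨fun x => Real.sqrt (V x), by fun_prop⟩

@[simp] lemma sqrtWeight_apply (V : C(ℝ, ℝ)) (x : ℝ) : sqrtWeight V x = Real.sqrt (V x) := rfl

/-- The inclusion of the test functions into `L²(e^{αx} dx)`. -/
def lineIncl (α : ℝ) : testSpace →ₗ[ℂ] Lp ℂ 2 (expMeasure α) := ccToLp (expMeasure α) ∘ₗ testVal

/-- The operator `φ ↦ e^{-αx} (-φ'' + V φ)`. -/
def lineExpr (α : ℝ) (V : C(ℝ, ℝ)) : testSpace →ₗ[ℂ] ccSpace :=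
  ccMul (expWeight (-α)) ∘ₗ (ccMul V ∘ₗ testVal - testVal ∘ₗ testDeriv ∘ₗ testDeriv)

/-- The operator `φ ↦ e^{-αx} (-φ'' + V φ)` with values in `L²(e^{αx} dx)`. -/
def lineOp (α : ℝ) (V : C(ℝ, ℝ)) : testSpace →ₗ[ℂ] Lp ℂ 2 (expMeasure α) :=
  ccToLp (expMeasure α) ∘ₗ lineExpr α V

lemma lineExpr_apply (α : ℝ) (V : C(ℝ, ℝ)) (φ : testSpace) (x : ℝ) :
    (lineExpr α V φ : ℝ → ℂ) x = (Real.exp (-α * x) : ℂ) *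
      ((V x : ℂ) * (φ : ℝ → ℂ) x - (testDeriv (testDeriv φ) : ℝ → ℂ) x) := rfl

/-- The map `φ ↦ (φ', V^{1/2} φ)`. -/
def lineGrad (V : C(ℝ, ℝ)) : testSpace →ₗ[ℂ]
    WithLp 2 (Lp ℂ 2 (volume : Measure ℝ) × Lp ℂ 2 (volume : Measure ℝ)) :=
  (WithLp.linearEquiv 2 ℂ _).symm.toLinearMap ∘ₗ
    (ccToLp volume ∘ₗ testVal ∘ₗ testDeriv).prod
      (ccToLp volume ∘ₗ ccMul (sqrtWeight V) ∘ₗ testVal)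

lemma integral_conj_testDeriv (φ ψ : testSpace) :
    ∫ x, (starRingEnd ℂ) ((testDeriv φ : ℝ → ℂ) x) * (ψ : ℝ → ℂ) x =
      -∫ x, (starRingEnd ℂ) ((φ : ℝ → ℂ) x) * (testDeriv ψ : ℝ → ℂ) x := by
  have hint : ∀ f g : testSpace,
      Integrable ((fun x => (starRingEnd ℂ) ((f : ℝ → ℂ) x)) * (g : ℝ → ℂ)) := fun f g =>
    ((Complex.continuous_conj.comp f.2.1.continuous).mul
      g.2.1.continuous).integrable_of_hasCompactSupport g.2.2.mul_left
  have h := integral_mul_deriv_eq_deriv_mul_of_integrable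
    (u := fun x => (starRingEnd ℂ) ((φ : ℝ → ℂ) x)) (v := (ψ : ℝ → ℂ))
    (u' := fun x => (starRingEnd ℂ) ((testDeriv φ : ℝ → ℂ) x)) (v' := (testDeriv ψ : ℝ → ℂ))
    (fun x _ => (testSpace_hasDerivAt φ x).star)
    (fun x _ => testSpace_hasDerivAt ψ x)
    (hint φ (testDeriv ψ)) (hint (testDeriv φ) ψ) (hint φ ψ)
  rw [h, neg_neg]

/-- The weight e^(αx) cancels against the factor e^(-αx) of the operator, and one integration by
parts leaves the energy, which does not depend on α. -/
lemma inner_lineOp {V : C(ℝ, ℝ)} (hV : ∀ x, 0 ≤ V x) (α : ℝ) (φ ψ : testSpace) :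
    inner ℂ (lineOp α V φ) (lineIncl α ψ) = inner ℂ (lineGrad V φ) (lineGrad V ψ) := by
  have h1 : inner ℂ (lineGrad V φ) (lineGrad V ψ) =
      inner ℂ (ccToLp volume (testVal (testDeriv φ))) (ccToLp volume (testVal (testDeriv ψ))) +
      inner ℂ (ccToLp volume (ccMul (sqrtWeight V) (testVal φ)))
        (ccToLp volume (ccMul (sqrtWeight V) (testVal ψ))) := rfl
  have h2 : inner ℂ (lineOp α V φ) (lineIncl α ψ) =
    inner ℂ (ccToLp (expMeasure α) (lineExpr α V φ)) (ccToLp (expMeasure α) (testVal ψ)) := rfl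
  rw [h1, h2, inner_ccToLp_ccToLp, inner_ccToLp_ccToLp, inner_ccToLp_ccToLp,
    integral_expMeasure]
  have hc : ∀ f : ccSpace, Continuous fun x => (starRingEnd ℂ) ((f : ℝ → ℂ) x) := fun f =>
    Complex.continuous_conj.comp f.2.1
  have hint : ∀ f g : ccSpace,
      Integrable (fun x => (starRingEnd ℂ) ((f : ℝ → ℂ) x) * (g : ℝ → ℂ) x) := fun f g =>
    ((hc f).mul g.2.1).integrable_of_hasCompactSupport g.2.2.mul_left
  have h3 := integral_conj_testDeriv (testDeriv φ) ψ
  rw [eq_neg_iff_add_eq_zero, add_comm, ← eq_neg_iff_add_eq_zero] at h3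
  simp only [testVal_apply]
  rw [h3, ← integral_neg, ← integral_add]
  · refine integral_congr_ae (Eventually.of_forall fun x => ?_)
    have hs : ((Real.sqrt (V x) : ℝ) : ℂ) * (Real.sqrt (V x) : ℝ) = (V x : ℂ) := by
      rw [← Complex.ofReal_mul, Real.mul_self_sqrt (hV x)]
    have he : ((Real.exp (α * x) : ℝ) : ℂ) * (Real.exp (-α * x) : ℝ) = 1 := by
      rw [← Complex.ofReal_mul, ← Real.exp_add]
      simp
    simp only [lineExpr_apply, ccMul_apply, testVal_apply, sqrtWeight_apply, map_mul, map_sub,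
      Complex.conj_ofReal, Complex.real_smul]
    linear_combination (starRingEnd ℂ ((φ : ℝ → ℂ) x) * (ψ : ℝ → ℂ) x) * ((V x : ℂ) * he - hs) -
      (starRingEnd ℂ ((testDeriv (testDeriv φ) : ℝ → ℂ) x) * (ψ : ℝ → ℂ) x) * he
  · exact (hint (testVal (testDeriv (testDeriv φ))) (testVal ψ)).neg
  · exact hint (ccMul (sqrtWeight V) (testVal φ)) (ccMul (sqrtWeight V) (testVal ψ))

lemma denseRange_lineIncl (α : ℝ) : DenseRange (lineIncl α) := by
  refine (Lp.dense_hasCompactSupport_contDiff (E := ℝ) (F := ℂ) (μ := expMeasure α) (p := 2)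
    (by simp)).mono ?_
  rintro f ⟨g, hfg, hg1, hg2⟩
  refine ⟨⟨g, hg2, hg1⟩, ?_⟩
  exact Lp.ext ((coeFn_ccToLp _ _).trans hfg.symm)

lemma norm_sq_lineIncl (α : ℝ) (φ : testSpace) :
    ‖lineIncl α φ‖ ^ 2 = ∫ x, Real.exp (α * x) * ‖(φ : ℝ → ℂ) x‖ ^ 2 := by
  rw [lineIncl, LinearMap.comp_apply, norm_sq_ccToLp, integral_expMeasure]
  rfl

lemma integrable_mul_norm_sq (f : ccSpace) {g : ℝ → ℝ} (hg : Continuous g) :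
    Integrable fun x => g x * ‖(f : ℝ → ℂ) x‖ ^ 2 := by
  refine (hg.mul (f.2.1.norm.pow 2)).integrable_of_hasCompactSupport ?_
  refine HasCompactSupport.mul_left ?_
  simpa [pow_two] using f.2.2.norm.mul_left (f := fun x => ‖(f : ℝ → ℂ) x‖)

lemma norm_sq_lineGrad {V : C(ℝ, ℝ)} (hV : ∀ x, 0 ≤ V x) (φ : testSpace) :
    ‖lineGrad V φ‖ ^ 2 = (∫ x, ‖(testDeriv φ : ℝ → ℂ) x‖ ^ 2) +
      ∫ x, V x * ‖(φ : ℝ → ℂ) x‖ ^ 2 := by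
  have h : ‖lineGrad V φ‖ ^ 2 = ‖ccToLp volume (testVal (testDeriv φ))‖ ^ 2 +
      ‖ccToLp volume (ccMul (sqrtWeight V) (testVal φ))‖ ^ 2 :=
    WithLp.prod_norm_sq_eq_of_L2 _
  rw [h, norm_sq_ccToLp, norm_sq_ccToLp]
  congr 2
  funext x
  rw [ccMul_apply, norm_mul, mul_pow, Complex.norm_real, Real.norm_eq_abs, sq_abs,
    sqrtWeight_apply, Real.sq_sqrt (hV x)]
  rfl

/-- The potential term alone controls the norm; the gradient term is discarded. -/
lemma lineIncl_le_lineGrad {V : C(ℝ, ℝ)} (hV : ∀ x, 0 ≤ V x) {α c₀ : ℝ}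
    (hc : ∀ x, c₀ * Real.exp (α * x) ≤ V x) (φ : testSpace) :
    c₀ * ‖lineIncl α φ‖ ^ 2 ≤ ‖lineGrad V φ‖ ^ 2 := by
  rw [norm_sq_lineIncl, norm_sq_lineGrad hV, ← integral_const_mul]
  have h1 : 0 ≤ ∫ x, ‖(testDeriv φ : ℝ → ℂ) x‖ ^ 2 := integral_nonneg fun x => sq_nonneg _
  have h2 : ∫ x, c₀ * (Real.exp (α * x) * ‖(φ : ℝ → ℂ) x‖ ^ 2) ≤
      ∫ x, V x * ‖(φ : ℝ → ℂ) x‖ ^ 2 := by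
    refine integral_mono ((integrable_mul_norm_sq (testVal φ) (by fun_prop)).const_mul _)
      (integrable_mul_norm_sq (testVal φ) V.continuous) fun x => ?_
    simp only [← mul_assoc]
    exact mul_le_mul_of_nonneg_right (hc x) (sq_nonneg _)
  linarith

/-- The indicators of the intervals (k, k + 1] are orthogonal and nonzero. -/
lemma not_finiteDimensional_expMeasure (α : ℝ) :
    ¬ FiniteDimensional ℂ (Lp ℂ 2 (expMeasure α)) := by
  intro hfd
  have hfin : ∀ k : ℕ, expMeasure α (Ioc (k : ℝ) (k + 1)) ≠ ⊤ := fun k =>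
    measure_Ioc_lt_top.ne
  let v : ℕ → Lp ℂ 2 (expMeasure α) := fun k => indicatorConstLp 2 measurableSet_Ioc (hfin k) 1
  have hdisj : ∀ k l : ℕ, k ≠ l → Ioc (k : ℝ) (k + 1) ∩ Ioc (l : ℝ) (l + 1) = ∅ := by
    intro k l hkl
    ext x
    simp only [mem_inter_iff, mem_Ioc, mem_empty_iff_false, iff_false, not_and, not_le, and_imp]
    intro h1 h2 h3
    rcases lt_or_gt_of_ne hkl with h | h
    · have : (k : ℝ) + 1 ≤ l := by exact_mod_cast h
      linarith
    · have : (l : ℝ) + 1 ≤ k := by exact_mod_cast h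
      linarith
  have hv : LinearIndependent ℂ v := by
    refine linearIndependent_of_ne_zero_of_inner_eq_zero (fun k h0 => ?_) fun k l hkl => ?_
    · have h1 : ‖v k‖ = 0 := by rw [h0, norm_zero]
      rw [norm_indicatorConstLp (by simp) (by simp), norm_one, one_mul,
        Real.rpow_eq_zero measureReal_nonneg (by simp), measureReal_eq_zero_iff (hfin k)] at h1
      have h2 : (Ioc (k : ℝ) (k + 1))ᶜ ∈ ae (expMeasure α) := by rwa [compl_mem_ae_iff]
      rw [ae_expMeasure, compl_mem_ae_iff] at h2
      simp at h2
    · simp only [v]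
      rw [L2.inner_indicatorConstLp_indicatorConstLp _ _ (hfin k) (hfin l), hdisj k l hkl]
      simp
  have := hv.lt_aleph0_of_finiteDimensional
  simp at this

end Line

/-! ### Coercivity on the line with polynomially many functionals -/

section Coercivity

/-- Nonnegativity of the variance of f, with s the mean value. -/
lemma sq_intervalIntegral_le {f : ℝ → ℝ} (hf : Continuous f) {p q : ℝ} (hpq : p < q) :
    (∫ x in p..q, f x) ^ 2 ≤ (q - p) * ∫ x in p..q, f x ^ 2 := by
  set A := ∫ x in p..q, f x with hA
  have hh : 0 < q - p := sub_pos.2 hpq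
  set s := A / (q - p) with hs
  have h1 : 0 ≤ ∫ x in p..q, (f x - s) ^ 2 :=
    intervalIntegral.integral_nonneg hpq.le fun x _ => sq_nonneg _
  have h2 : ∫ x in p..q, (f x - s) ^ 2 = (∫ x in p..q, f x ^ 2) - 2 * s * A + s ^ 2 * (q - p) := by
    have e : ∀ x, (f x - s) ^ 2 = f x ^ 2 - 2 * s * f x + s ^ 2 := fun x => by ring
    simp only [e]
    have i1 : IntervalIntegrable (fun x => f x ^ 2) volume p q := (hf.pow 2).intervalIntegrable _ _
    have i2 : IntervalIntegrable (fun x => 2 * s * f x) volume p q :=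
      (continuous_const.mul hf).intervalIntegrable _ _
    rw [intervalIntegral.integral_add (i1.sub i2) (by simp), intervalIntegral.integral_sub i1 i2,
      intervalIntegral.integral_const_mul, intervalIntegral.integral_const, smul_eq_mul, ← hA]
    ring
  rw [h2] at h1
  have h3 : A = s * (q - p) := by rw [hs]; field_simp
  rw [h3] at h1 ⊢
  nlinarith

/-- A Poincaré inequality with a weighted mean. -/
lemma integral_weight_mul_norm_sq_le (φ : testSpace) {ϱ : ℝ → ℝ} (hw : Continuous ϱ)
    (hpos : ∀ x, 0 < ϱ x) {p q : ℝ} (hpq : p < q) :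
    ∫ x in p..q, ϱ x * ‖(φ : ℝ → ℂ) x‖ ^ 2 ≤
      2 * (q - p) * (∫ x in p..q, ϱ x) * (∫ x in p..q, ‖(testDeriv φ : ℝ → ℂ) x‖ ^ 2) +
      2 / (∫ x in p..q, ϱ x) * ‖∫ x in p..q, ϱ x • (φ : ℝ → ℂ) x‖ ^ 2 := by
  set m := ∫ x in p..q, ϱ x with hm
  set D := ∫ x in p..q, ‖(testDeriv φ : ℝ → ℂ) x‖ ^ 2 with hD
  set I := ∫ x in p..q, ϱ x • (φ : ℝ → ℂ) x with hI
  set a := ∫ x in p..q, ‖(testDeriv φ : ℝ → ℂ) x‖ with ha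
  have hφc : Continuous (φ : ℝ → ℂ) := φ.2.1.continuous
  have hdc : Continuous (testDeriv φ : ℝ → ℂ) := (testDeriv φ).2.1.continuous
  have hmpos : 0 < m :=
    intervalIntegral.intervalIntegral_pos_of_pos (hw.intervalIntegrable _ _) hpos hpq
  have haD : a ^ 2 ≤ (q - p) * D := sq_intervalIntegral_le hdc.norm hpq
  have ha0 : 0 ≤ a := intervalIntegral.integral_nonneg hpq.le fun x _ => norm_nonneg _
  have hdiff : ∀ x ∈ Icc p q, ∀ y ∈ Icc p q, ‖(φ : ℝ → ℂ) x - (φ : ℝ → ℂ) y‖ ≤ a := by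
    intro x hx y hy
    rw [← intervalIntegral.integral_eq_sub_of_hasDerivAt (fun z _ => testSpace_hasDerivAt φ z)
      (hdc.intervalIntegrable _ _)]
    refine (intervalIntegral.norm_integral_le_abs_integral_norm).trans ?_
    refine (intervalIntegral.abs_integral_mono_interval ?_ ?_ ?_).trans_eq (abs_of_nonneg ha0)
    · rw [uIoc_of_le hpq.le]
      exact Ioc_subset_Ioc (le_min hy.1 hx.1) (max_le hy.2 hx.2)
    · exact Eventually.of_forall fun z => norm_nonneg _
    · exact hdc.norm.intervalIntegrable _ _
  have hpt : ∀ x ∈ Icc p q, ‖(φ : ℝ → ℂ) x‖ ^ 2 ≤ 2 * (q - p) * D + 2 / m ^ 2 * ‖I‖ ^ 2 := by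
    -- Comparison of φ(x) with the weighted mean I/m: the oscillation of φ on the interval is at
    -- most a, the integral of |φ'|.
    intro x hx
    have h1 : (m : ℂ) * (φ : ℝ → ℂ) x =
        (∫ y in p..q, ϱ y • ((φ : ℝ → ℂ) x - (φ : ℝ → ℂ) y)) + I := by
      simp only [smul_sub]
      have i1 : IntervalIntegrable (fun y => ϱ y • (φ : ℝ → ℂ) x) volume p q :=
        (hw.smul continuous_const).intervalIntegrable _ _
      have i2 : IntervalIntegrable (fun y => ϱ y • (φ : ℝ → ℂ) y) volume p q :=
        (hw.smul hφc).intervalIntegrable _ _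
      rw [intervalIntegral.integral_sub i1 i2, sub_add_cancel,
        intervalIntegral.integral_smul_const, Complex.real_smul]
    have h2 : ‖∫ y in p..q, ϱ y • ((φ : ℝ → ℂ) x - (φ : ℝ → ℂ) y)‖ ≤ m * a := by
      have h3 : ∫ y in p..q, ϱ y * a = m * a := by
        rw [intervalIntegral.integral_mul_const]
      rw [← h3]
      refine intervalIntegral.norm_integral_le_of_norm_le hpq.le
        (Eventually.of_forall fun y hy => ?_) ((hw.mul continuous_const).intervalIntegrable _ _)
      rw [norm_smul, Real.norm_of_nonneg (hpos y).le]
      exact mul_le_mul_of_nonneg_left (hdiff x hx y ⟨hy.1.le, hy.2⟩) (hpos y).le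
    have h3 : m * ‖(φ : ℝ → ℂ) x‖ ≤ m * a + ‖I‖ := by
      have h4 := congrArg norm h1
      rw [norm_mul, Complex.norm_real, Real.norm_of_nonneg hmpos.le] at h4
      rw [h4]
      exact (norm_add_le _ _).trans (by gcongr)
    have h4 : ‖(φ : ℝ → ℂ) x‖ ≤ a + ‖I‖ / m := by
      rw [← sub_le_iff_le_add', le_div_iff₀ hmpos]
      linarith
    have h5 : ‖(φ : ℝ → ℂ) x‖ ^ 2 ≤ (a + ‖I‖ / m) ^ 2 := by gcongr
    have h6 : 2 / m ^ 2 * ‖I‖ ^ 2 = 2 * (‖I‖ / m) ^ 2 := by field_simp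
    rw [h6]
    nlinarith [sq_nonneg (a - ‖I‖ / m)]
  have h7 : ∫ x in p..q, ϱ x * ‖(φ : ℝ → ℂ) x‖ ^ 2 ≤
      ∫ x in p..q, ϱ x * (2 * (q - p) * D + 2 / m ^ 2 * ‖I‖ ^ 2) := by
    refine intervalIntegral.integral_mono_on hpq.le
      ((hw.mul (hφc.norm.pow 2)).intervalIntegrable _ _)
      ((hw.mul continuous_const).intervalIntegrable _ _) fun x hx => ?_
    exact mul_le_mul_of_nonneg_left (hpt x hx) (hpos x).le
  refine h7.trans_eq ?_
  rw [intervalIntegral.integral_mul_const, ← hm]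
  field_simp

lemma inner_indicator_lineIncl (α : ℝ) {p q : ℝ} (hpq : p ≤ q) (φ : testSpace) :
    inner ℂ (indicatorConstLp 2 (measurableSet_Ioc (a := p) (b := q))
      (measure_Ioc_lt_top (μ := expMeasure α)).ne (1 : ℂ)) (lineIncl α φ) =
      ∫ x in p..q, Real.exp (α * x) • (φ : ℝ → ℂ) x := by
  rw [L2.inner_indicatorConstLp_one, intervalIntegral.integral_of_le hpq,
    ← setIntegral_expMeasure α _ measurableSet_Ioc]
  exact integral_congr_ae (ae_restrict_of_ae (coeFn_ccToLp _ _))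

/-- The functionals are the weighted integrals of φ over N equal pieces of (-L, L]. The Poincaré
inequality acts on each piece, and `hNM` is what makes its gradient constant at most 1; outside (-L,
L] the potential suffices. -/
lemma lineGrad_coercive {V : C(ℝ, ℝ)} (hV : ∀ x, 0 ≤ V x) {α M L : ℝ} {N : ℕ} (hα : 0 ≤ α)
    (hM : 0 ≤ M) (hL : 0 < L) (hN : 0 < N)
    (hMV : ∀ x, x ∉ Ioc (-L) L → M * Real.exp (α * x) ≤ V x)
    (hNM : 2 * M * (2 * L / N) ^ 2 * Real.exp (α * L) ≤ 1) :
    ∃ (g : Fin N → Lp ℂ 2 (expMeasure α)) (B : ℝ), ∀ φ,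
      M * ‖lineIncl α φ‖ ^ 2 ≤ ‖lineGrad V φ‖ ^ 2 + B * ∑ j, ‖inner ℂ (g j) (lineIncl α φ)‖ ^ 2 := by
  set η : ℝ := 2 * L / N with hη
  have hN' : (0 : ℝ) < N := by exact_mod_cast hN
  have hηpos : 0 < η := by positivity
  let a : ℕ → ℝ := fun j => -L + j * η
  have ha : ∀ j, a j < a (j + 1) := fun j => by
    simp only [a]; push_cast; linarith
  have ha1 : ∀ j, a (j + 1) - a j = η := fun j => by
    simp only [a]; push_cast; ring
  have ha0 : a 0 = -L := by simp [a]
  have haN : a N = L := by simp only [a, hη]; field_simp; ring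
  have haL : ∀ j, j < N → a (j + 1) ≤ L := fun j hj => by
    rw [← haN]
    simp only [a]
    have : ((j + 1 : ℕ) : ℝ) ≤ N := by exact_mod_cast hj
    gcongr
  let ϱ : ℝ → ℝ := fun x => Real.exp (α * x)
  have hw : Continuous ϱ := by fun_prop
  have hwpos : ∀ x, 0 < ϱ x := fun x => Real.exp_pos _
  let m : ℕ → ℝ := fun j => ∫ x in a j..a (j + 1), ϱ x
  have hm : ∀ j, 0 < m j := fun j =>
    intervalIntegral.intervalIntegral_pos_of_pos (hw.intervalIntegrable _ _) hwpos (ha j)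
  have hmle : ∀ j, j < N → m j ≤ η * Real.exp (α * L) := fun j hj => by
    have h1 : m j ≤ ∫ x in a j..a (j + 1), Real.exp (α * L) := by
      refine intervalIntegral.integral_mono_on (ha j).le (hw.intervalIntegrable _ _)
        (by simp) fun x hx => ?_
      exact Real.exp_le_exp.2 (mul_le_mul_of_nonneg_left (hx.2.trans (haL j hj)) hα)
    rwa [intervalIntegral.integral_const, smul_eq_mul, ha1] at h1
  refine ⟨fun j => indicatorConstLp 2 (measurableSet_Ioc (a := a j) (b := a (j + 1)))
      (measure_Ioc_lt_top (μ := expMeasure α)).ne (1 : ℂ),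
    ∑ j ∈ Finset.range N, M * (2 / m j), fun φ => ?_⟩
  -- The sum serves as a common bound for the constants M * (2 / m j) of the pieces.
  set B := ∑ j ∈ Finset.range N, M * (2 / m j) with hB
  simp only [fun j => inner_indicator_lineIncl α (ha j).le φ]
  rw [Fin.sum_univ_eq_sum_range
    (fun j => ‖∫ x in a j..a (j + 1), Real.exp (α * x) • (φ : ℝ → ℂ) x‖ ^ 2) N,
    norm_sq_lineIncl, norm_sq_lineGrad hV]
  have hφc : Continuous (φ : ℝ → ℂ) := φ.2.1.continuous
  have hdc : Continuous (testDeriv φ : ℝ → ℂ) := (testDeriv φ).2.1.continuous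
  let l : ℕ → ℝ := fun j => ‖∫ x in a j..a (j + 1), ϱ x • (φ : ℝ → ℂ) x‖ ^ 2
  have hlpos : ∀ j, 0 ≤ l j := fun j => sq_nonneg _
  let D : ℕ → ℝ := fun j => ∫ x in a j..a (j + 1), ‖(testDeriv φ : ℝ → ℂ) x‖ ^ 2
  have hDpos : ∀ j, 0 ≤ D j := fun j =>
    intervalIntegral.integral_nonneg (ha j).le fun x _ => sq_nonneg _
  have hpiece : ∀ j, j < N → M * ∫ x in a j..a (j + 1), ϱ x * ‖(φ : ℝ → ℂ) x‖ ^ 2 ≤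
      D j + B * l j := by
    intro j hj
    have h1 := integral_weight_mul_norm_sq_le φ hw hwpos (ha j)
    rw [ha1] at h1
    have h2 := mul_le_mul_of_nonneg_left h1 hM
    have h3 : M * (2 * η * m j) ≤ 1 := by
      refine le_trans ?_ hNM
      have := mul_le_mul_of_nonneg_left (hmle j hj) (by positivity : 0 ≤ 2 * M * η)
      nlinarith
    have h4 : M * (2 / m j) ≤ B :=
      Finset.single_le_sum (f := fun j => M * (2 / m j))
        (fun k _ => mul_nonneg hM (div_nonneg zero_le_two (hm k).le)) (Finset.mem_range.2 hj)
    have h5 := mul_le_mul_of_nonneg_right h3 (hDpos j)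
    have h6 := mul_le_mul_of_nonneg_right h4 (hlpos j)
    refine h2.trans ?_
    calc M * (2 * η * m j * D j + 2 / m j * l j)
        = M * (2 * η * m j) * D j + M * (2 / m j) * l j := by ring
      _ ≤ _ := by linarith
  have hmid : M * ∫ x in Ioc (-L) L, ϱ x * ‖(φ : ℝ → ℂ) x‖ ^ 2 ≤
      (∫ x in Ioc (-L) L, ‖(testDeriv φ : ℝ → ℂ) x‖ ^ 2) + B * ∑ j ∈ Finset.range N, l j := by
    have hLL : -L ≤ L := by linarith
    have i1 : ∀ k < N, IntervalIntegrable (fun x => ϱ x * ‖(φ : ℝ → ℂ) x‖ ^ 2) volume (a k)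
        (a (k + 1)) := fun k _ => (hw.mul (hφc.norm.pow 2)).intervalIntegrable _ _
    have i2 : ∀ k < N, IntervalIntegrable (fun x => ‖(testDeriv φ : ℝ → ℂ) x‖ ^ 2) volume (a k)
        (a (k + 1)) := fun k _ => (hdc.norm.pow 2).intervalIntegrable _ _
    rw [← intervalIntegral.integral_of_le hLL, ← intervalIntegral.integral_of_le hLL, ← ha0, ← haN,
      ← intervalIntegral.sum_integral_adjacent_intervals i1,
      ← intervalIntegral.sum_integral_adjacent_intervals i2, Finset.mul_sum, Finset.mul_sum, ← Finset.sum_add_distrib]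
    exact Finset.sum_le_sum fun j hj => hpiece j (Finset.mem_range.1 hj)
  have hi1 : Integrable fun x => ϱ x * ‖(φ : ℝ → ℂ) x‖ ^ 2 :=
    integrable_mul_norm_sq (testVal φ) hw
  have hi2 : Integrable fun x => V x * ‖(φ : ℝ → ℂ) x‖ ^ 2 :=
    integrable_mul_norm_sq (testVal φ) V.continuous
  have hi3 : Integrable fun x => ‖(testDeriv φ : ℝ → ℂ) x‖ ^ 2 := by
    simpa using integrable_mul_norm_sq (testVal (testDeriv φ)) (g := fun _ => 1) continuous_const
  have htail : M * ∫ x in (Ioc (-L) L)ᶜ, ϱ x * ‖(φ : ℝ → ℂ) x‖ ^ 2 ≤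
      ∫ x in (Ioc (-L) L)ᶜ, V x * ‖(φ : ℝ → ℂ) x‖ ^ 2 := by
    rw [← integral_const_mul]
    refine setIntegral_mono_on (hi1.const_mul M).integrableOn hi2.integrableOn
      measurableSet_Ioc.compl fun x hx => ?_
    rw [← mul_assoc]
    exact mul_le_mul_of_nonneg_right (hMV x hx) (sq_nonneg _)
  have hV1 : ∫ x in (Ioc (-L) L)ᶜ, V x * ‖(φ : ℝ → ℂ) x‖ ^ 2 ≤ ∫ x, V x * ‖(φ : ℝ → ℂ) x‖ ^ 2 :=
    setIntegral_le_integral hi2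
      (Eventually.of_forall fun x => mul_nonneg (hV x) (sq_nonneg _))
  have hd1 : ∫ x in Ioc (-L) L, ‖(testDeriv φ : ℝ → ℂ) x‖ ^ 2 ≤
      ∫ x, ‖(testDeriv φ : ℝ → ℂ) x‖ ^ 2 :=
    setIntegral_le_integral hi3 (Eventually.of_forall fun x => sq_nonneg _)
  have hsplit := integral_add_compl (measurableSet_Ioc (a := -L) (b := L)) hi1
  change M * ∫ x, ϱ x * ‖(φ : ℝ → ℂ) x‖ ^ 2 ≤ _
  rw [← hsplit, mul_add]
  linarith

/-- The number of functionals grows at most polynomially in the spectral parameter. -/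
lemma exists_lineGrad_coercive {n : ℕ} (hn : 2 ≤ n) {V : C(ℝ, ℝ)} {b c : ℝ} (hb : 0 < b)
    (hc : 0 < c) (hVc : ∀ x, c ≤ V x) (hVb : ∀ x, b * Real.exp (4 * x) ≤ V x) :
    ∃ C p : ℕ, ∀ M : ℕ, 1 ≤ M →
      ∃ (N : ℕ) (g : Fin N → Lp ℂ 2 (expMeasure (4 - 4 / n))) (B : ℝ), N ≤ C * M ^ p ∧
      ∀ φ, M * ‖lineIncl (4 - 4 / n) φ‖ ^ 2 ≤ ‖lineGrad V φ‖ ^ 2 +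
        B * ∑ j, ‖inner ℂ (g j) (lineIncl (4 - 4 / n) φ)‖ ^ 2 := by
  -- With this K₀, the number P = K₀ M satisfies P ≥ 2, P ≥ M, bP ≥ M and cP ≥ M.
  obtain ⟨K₀, hK₀⟩ := exists_nat_ge (2 + 1 / b + 1 / c)
  have hb' := one_div_pos.2 hb
  have hc' := one_div_pos.2 hc
  have hn' : (2 : ℝ) ≤ n := by exact_mod_cast hn
  have h4n : 4 / (n : ℝ) ≤ 2 := by rw [div_le_iff₀ (by linarith)]; linarith
  have h4n0 : 0 < 4 / (n : ℝ) := by positivity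
  refine ⟨3 * K₀ ^ (4 * n), 4 * n, fun M hM => ?_⟩
  set P : ℝ := K₀ * M with hP
  have hM1 : (1 : ℝ) ≤ M := by exact_mod_cast hM
  have hPK : (K₀ : ℝ) ≤ P := le_mul_of_one_le_right (by linarith) hM1
  have hP2 : 2 ≤ P := by linarith
  have hPM : (M : ℝ) ≤ P := le_mul_of_one_le_left (by linarith) (by linarith)
  have hPb : (M : ℝ) ≤ b * P := by
    have h1 : 1 ≤ b * K₀ := by
      rw [← div_le_iff₀' hb]; linarith
    calc (M : ℝ) = 1 * M := (one_mul _).symm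
      _ ≤ (b * K₀) * M := by gcongr
      _ = b * P := by rw [hP]; ring
  have hPc : (M : ℝ) ≤ c * P := by
    have h1 : 1 ≤ c * K₀ := by
      rw [← div_le_iff₀' hc]; linarith
    calc (M : ℝ) = 1 * M := (one_mul _).symm
      _ ≤ (c * K₀) * M := by gcongr
      _ = c * P := by rw [hP]; ring
  -- Then e^L = P^n. The multiple n is needed at the right end, where only e^((4/n)x) is gained over
  -- the weight: at x = L this gain is P^4.
  set L : ℝ := n * Real.log P with hL
  have hlog : 0 < Real.log P := Real.log_pos (by linarith)
  have hLpos : 0 < L := by positivity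
  have hexpL : Real.exp L = P ^ n := by
    rw [hL, Real.exp_nat_mul, Real.exp_log (by linarith)]
  have hPn : P ≤ P ^ n := le_self_pow₀ (by linarith) (by omega)
  obtain ⟨g, B, hB⟩ := lineGrad_coercive (V := V) (α := 4 - 4 / n) (M := M) (L := L)
    (N := 3 * (K₀ * M) ^ (4 * n)) (fun x => hc.le.trans (hVc x)) (by linarith) (by linarith) hLpos
    (by
      have h1 : 0 < K₀ * M := by
        have : (0 : ℝ) < P := by linarith
        rw [hP] at this
        exact_mod_cast this
      positivity)
    (fun x hx => by
      rw [mem_Ioc, not_and_or, not_lt, not_le] at hx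
      rcases hx with hx | hx
      -- Left end: 4 - 4/n ≥ 1, so the weight is at most e^(-L) ≤ 1/P, and M/P ≤ c.
      · refine le_trans ?_ (hVc x)
        have h1 : Real.exp ((4 - 4 / n) * x) ≤ Real.exp (-L) := by
          refine Real.exp_le_exp.2 ?_
          nlinarith
        have h2 : Real.exp (-L) ≤ P⁻¹ := by
          rw [Real.exp_neg, hexpL]
          exact inv_anti₀ (by linarith) hPn
        calc (M : ℝ) * Real.exp ((4 - 4 / n) * x) ≤ M * P⁻¹ := by gcongr; exact h1.trans h2
          _ ≤ c := by rw [← div_eq_mul_inv, div_le_iff₀ (by linarith)]; exact hPc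
      · refine le_trans ?_ (hVb x)
        have h1 : P ≤ Real.exp (4 / n * x) := by
          have h2 : Real.exp (4 / n * L) = P ^ 4 := by
            have : 4 / (n : ℝ) * L = (4 : ℕ) * Real.log P := by
              rw [hL]; push_cast; field_simp
            rw [this, Real.exp_nat_mul, Real.exp_log (by linarith)]
          calc P ≤ P ^ 4 := le_self_pow₀ (by linarith) (by norm_num)
            _ = Real.exp (4 / n * L) := h2.symm
            _ ≤ _ := Real.exp_le_exp.2 (by gcongr)
        have h3 : Real.exp (4 * x) = Real.exp (4 / n * x) * Real.exp ((4 - 4 / n) * x) := by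
          rw [← Real.exp_add]; ring_nf
        rw [h3, ← mul_assoc]
        refine mul_le_mul_of_nonneg_right ?_ (Real.exp_pos _).le
        exact hPb.trans (by gcongr))
    (by
      -- The choice of 3 P^(4n) pieces balances all powers of P in the Poincaré constant and leaves
      -- 8/9.
      have h1 : Real.exp ((4 - 4 / n) * L) ≤ P ^ (4 * n) := by
        rw [mul_comm 4 n, pow_mul, ← hexpL, ← Real.exp_nat_mul]
        refine Real.exp_le_exp.2 ?_
        push_cast
        nlinarith
      have h2 : L ≤ P ^ n := by
        rw [← hexpL]; linarith [Real.add_one_le_exp L]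
      have h3 : (M : ℝ) ≤ P ^ (2 * n) := hPM.trans (le_self_pow₀ (by linarith) (by omega))
      push_cast
      rw [← hP]
      have hPpos : 0 < P := by linarith
      calc 2 * (M : ℝ) * (2 * L / (3 * P ^ (4 * n))) ^ 2 * Real.exp ((4 - 4 / n) * L)
          ≤ 2 * P ^ (2 * n) * (2 * P ^ n / (3 * P ^ (4 * n))) ^ 2 * P ^ (4 * n) := by gcongr
        _ = 8 / 9 := by
          have e4 : P ^ (4 * n) = (P ^ n) ^ 4 := by rw [← pow_mul, mul_comm]
          have e2 : P ^ (2 * n) = (P ^ n) ^ 2 := by rw [← pow_mul, mul_comm]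
          have hq : P ^ n ≠ 0 := by positivity
          rw [e4, e2]
          field_simp
          norm_num
        _ ≤ 1 := by norm_num)
  exact ⟨_, g, B, by rw [mul_pow, mul_assoc], hB⟩

end Coercivity

/-! ### Weak solutions of y'' = Qy are classical -/

section Regularity

lemma exists_support_subset_Ioo {f : ℝ → ℝ} (hf : HasCompactSupport f) :
    ∃ R : ℝ, 0 < R ∧ ∀ x, f x ≠ 0 → x ∈ Ioo (-R) R := by
  obtain ⟨R, hR⟩ := hf.isBounded.subset_ball 0
  refine ⟨max R 1, by positivity, fun x hx => ?_⟩
  have h1 := hR (subset_tsupport f hx)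
  rw [Metric.mem_ball, dist_zero_right, Real.norm_eq_abs, abs_lt] at h1
  exact ⟨by linarith [le_max_left R 1, h1.1], h1.2.trans_le (le_max_left R 1)⟩

/-- The primitive from the left end vanishes to the right of the support exactly because the mean of
ψ is zero. -/
lemma exists_antideriv {ψ : ℝ → ℝ} (hψ : ContDiff ℝ ∞ ψ) (hs : HasCompactSupport ψ)
    (h0 : ∫ x, ψ x = 0) : ∃ φ : ℝ → ℝ, ContDiff ℝ ∞ φ ∧ HasCompactSupport φ ∧ deriv φ = ψ := by
  obtain ⟨R, hRpos, hR⟩ := exists_support_subset_Ioo hs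
  have hd : ∀ x, HasDerivAt (fun x => ∫ t in (-R)..x, ψ t) (ψ x) x := fun x =>
    intervalIntegral.integral_hasDerivAt_right (hψ.continuous.intervalIntegrable _ _)
      (hψ.continuous.stronglyMeasurableAtFilter _ _) hψ.continuous.continuousAt
  have hderiv : deriv (fun x => ∫ t in (-R)..x, ψ t) = ψ := funext fun x => (hd x).deriv
  refine ⟨fun x => ∫ t in (-R)..x, ψ t, ?_, ?_, hderiv⟩
  · rw [contDiff_infty_iff_deriv, hderiv]
    exact ⟨fun x => (hd x).differentiableAt, hψ⟩
  · refine HasCompactSupport.intro (isCompact_Icc (a := -R) (b := R)) fun x hx => ?_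
    rw [mem_Icc, not_and_or, not_le, not_le] at hx
    rcases hx with hx | hx
    · refine intervalIntegral.integral_zero_ae (Eventually.of_forall fun t ht => ?_)
      rw [uIoc_of_ge hx.le] at ht
      by_contra hne
      exact absurd (hR t hne).1 (not_lt.2 ht.2)
    · rw [intervalIntegral.integral_eq_integral_of_support_subset, h0]
      intro t ht
      have := hR t ht
      exact ⟨this.1, this.2.le.trans hx.le⟩

lemma exists_unit_bump : ∃ η : ℝ → ℝ, ContDiff ℝ ∞ η ∧ HasCompactSupport η ∧ ∫ x, η x = 1 := by
  let f : ContDiffBump (0 : ℝ) := ⟨1, 2, one_pos, one_lt_two⟩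
  exact ⟨f.normed volume, f.contDiff_normed, f.hasCompactSupport_normed, f.integral_normed⟩

lemma integrable_mul_locallyIntegrable {h ψ : ℝ → ℝ} (hh : LocallyIntegrable h)
    (hψ : Continuous ψ) (hs : HasCompactSupport ψ) : Integrable fun x => h x * ψ x := by
  have := hh.integrable_smul_left_of_hasCompactSupport hψ hs
  simpa [mul_comm] using this

/-- The lemma of du Bois-Reymond. -/
lemma ae_const_of_integral_mul_deriv_eq_zero {h : ℝ → ℝ} (hh : LocallyIntegrable h)
    (h0 : ∀ φ : ℝ → ℝ, ContDiff ℝ ∞ φ → HasCompactSupport φ → ∫ x, h x * deriv φ x = 0) :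
    ∃ c : ℝ, ∀ᵐ x, h x = c := by
  obtain ⟨η, hη, hηs, hη1⟩ := exists_unit_bump
  refine ⟨∫ x, h x * η x, ?_⟩
  refine ae_eq_of_integral_contDiff_smul_eq hh (locallyIntegrable_const _) fun ψ hψ hs => ?_
  have hint : Integrable ψ := hψ.continuous.integrable_of_hasCompactSupport hs
  have hintη : Integrable η := hη.continuous.integrable_of_hasCompactSupport hηs
  -- Subtracting (∫ψ)η, with η of integral one, leaves mean zero; so h pairs with ψ as the constant
  -- ∫hη does.
  obtain ⟨φ, hφ, hφs, hd⟩ := exists_antideriv (ψ := fun x => ψ x - (∫ t, ψ t) * η x)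
    (hψ.sub (contDiff_const.mul hη)) (hs.sub hηs.mul_left) (by
      rw [integral_sub hint (hintη.const_mul _), integral_const_mul, hη1, mul_one, sub_self])
  have h1 := h0 φ hφ hφs
  rw [hd] at h1
  have e : ∀ x, h x * (ψ x - (∫ t, ψ t) * η x) = h x * ψ x - (∫ t, ψ t) * (h x * η x) :=
    fun x => by ring
  simp only [e] at h1
  rw [integral_sub (integrable_mul_locallyIntegrable hh hψ.continuous hs)
    ((integrable_mul_locallyIntegrable hh hη.continuous hηs).const_mul _), integral_const_mul,
    sub_eq_zero] at h1
  simp only [smul_eq_mul]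
  rw [integral_mul_const, ← h1]
  exact integral_congr_ae (Eventually.of_forall fun x => mul_comm _ _)

lemma intervalIntegrable_of_locallyIntegrable {h : ℝ → ℝ} (hh : LocallyIntegrable h) (a b : ℝ) :
    IntervalIntegrable h volume a b :=
  intervalIntegrable_iff.2
    ((hh.integrableOn_isCompact isCompact_uIcc).mono_set uIoc_subset_uIcc)

/-- Integration by parts for a primitive of a locally integrable function. -/
lemma integral_primitive_mul_deriv {g : ℝ → ℝ} (hg : LocallyIntegrable g) {φ : ℝ → ℝ}
    (hφ : ContDiff ℝ ∞ φ) (hs : HasCompactSupport φ) :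
    ∫ x, (∫ t in (0 : ℝ)..x, g t) * deriv φ x = -∫ x, g x * φ x := by
  obtain ⟨R, hRpos, hR⟩ := exists_support_subset_Ioo hs
  obtain ⟨R', -, hR'⟩ := exists_support_subset_Ioo hs.deriv
  set S := max R R' with hS
  have hSR : ∀ x, φ x ≠ 0 → x ∈ Ioo (-S) S := fun x hx =>
    ⟨by linarith [(hR x hx).1, le_max_left R R'], (hR x hx).2.trans_le (le_max_left _ _)⟩
  have hSR' : ∀ x, deriv φ x ≠ 0 → x ∈ Ioo (-S) S := fun x hx =>
    ⟨by linarith [(hR' x hx).1, le_max_right R R'], (hR' x hx).2.trans_le (le_max_right _ _)⟩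
  have hSpos : 0 < S := hRpos.trans_le (le_max_left _ _)
  have hgi := intervalIntegrable_of_locallyIntegrable hg (-S) S
  have h0mem : (0 : ℝ) ∈ uIcc (-S) S := by
    rw [uIcc_of_le (by linarith)]; exact ⟨by linarith, hSpos.le⟩
  have hac := hgi.absolutelyContinuousOnInterval_intervalIntegral h0mem
  have hacφ : AbsolutelyContinuousOnInterval φ (-S) S :=
    ContDiffOn.absolutelyContinuousOnInterval ((hφ.of_le (by norm_cast)).contDiffOn)
  have hparts := hac.integral_mul_deriv_eq_deriv_mul hacφ
  have hφS : φ S = 0 := by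
    by_contra hne
    exact lt_irrefl _ (hSR S hne).2
  have hφS' : φ (-S) = 0 := by
    by_contra hne
    exact lt_irrefl _ (hSR (-S) hne).1
  rw [hφS, hφS', mul_zero, mul_zero, sub_zero, zero_sub] at hparts
  have e1 : ∫ x in (-S)..S, (∫ t in (0 : ℝ)..x, g t) * deriv φ x =
      ∫ x, (∫ t in (0 : ℝ)..x, g t) * deriv φ x := by
    refine intervalIntegral.integral_eq_integral_of_support_subset fun x hx => ?_
    exact Ioo_subset_Ioc_self (hSR' x (right_ne_zero_of_mul hx))
  have e2 : ∫ x in (-S)..S, g x * φ x = ∫ x, g x * φ x := by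
    refine intervalIntegral.integral_eq_integral_of_support_subset fun x hx => ?_
    exact Ioo_subset_Ioc_self (hSR x (right_ne_zero_of_mul hx))
  rw [← e1, hparts, ← e2]
  congr 1
  refine intervalIntegral.integral_congr_ae ?_
  filter_upwards [LocallyIntegrable.ae_hasDerivAt_integral hg] with x hx _
  rw [(hx 0).deriv]

/-- Let G be a double primitive of Qv. Then v - G annihilates all second derivatives of test
functions, hence is affine almost everywhere, and v agrees with a function that can be
differentiated twice. -/
lemma exists_eq_solution_real {v : ℝ → ℝ} (hv : LocallyIntegrable v) {Q : ℝ → ℝ}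
    (hQ : Continuous Q)
    (h0 : ∀ φ : ℝ → ℝ, ContDiff ℝ ∞ φ → HasCompactSupport φ →
      ∫ x, v x * (deriv (deriv φ) x - Q x * φ x) = 0) :
    ∃ y y₁ : ℝ → ℝ, (∀ x, HasDerivAt y (y₁ x) x) ∧ (∀ x, HasDerivAt y₁ (Q x * y x) x) ∧
      ∀ᵐ x, v x = y x := by
  have hg : LocallyIntegrable fun x => Q x * v x := by
    have := (hv.locallyIntegrableOn univ).continuousOn_smul isOpen_univ.isLocallyClosed
      hQ.continuousOn
    rw [locallyIntegrableOn_univ] at this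
    exact this
  set G₁ : ℝ → ℝ := fun x => ∫ t in (0 : ℝ)..x, Q t * v t with hG₁
  have hG₁c : Continuous G₁ := intervalIntegral.continuous_primitive
    (fun a b => intervalIntegrable_of_locallyIntegrable hg a b) 0
  set G : ℝ → ℝ := fun x => ∫ t in (0 : ℝ)..x, G₁ t with hG
  have hGd : ∀ x, HasDerivAt G (G₁ x) x := fun x =>
    intervalIntegral.integral_hasDerivAt_right (hG₁c.intervalIntegrable _ _)
      (hG₁c.stronglyMeasurableAtFilter _ _) hG₁c.continuousAt
  have hGc : Continuous G := continuous_iff_continuousAt.2 fun x => (hGd x).continuousAt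
  have hvG : LocallyIntegrable fun x => v x - G x := hv.sub hGc.locallyIntegrable
  have hcd : ∀ φ : ℝ → ℝ, ContDiff ℝ ∞ φ → ContDiff ℝ ∞ (deriv φ) := fun φ hφ =>
    (contDiff_infty_iff_deriv.1 hφ).2
  have hstep : ∀ φ : ℝ → ℝ, ContDiff ℝ ∞ φ → HasCompactSupport φ →
      ∫ x, (v x - G x) * deriv (deriv φ) x = 0 := by
    intro φ hφ hs
    have h1 : ∫ x, G x * deriv (deriv φ) x = -∫ x, G₁ x * deriv φ x :=
      integral_primitive_mul_deriv hG₁c.locallyIntegrable (hcd φ hφ) hs.deriv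
    have h2 : ∫ x, G₁ x * deriv φ x = -∫ x, Q x * v x * φ x :=
      integral_primitive_mul_deriv hg hφ hs
    have h3 := h0 φ hφ hs
    have i1 : Integrable fun x => v x * deriv (deriv φ) x :=
      integrable_mul_locallyIntegrable hv (hcd _ (hcd _ hφ)).continuous hs.deriv.deriv
    have i2 : Integrable fun x => Q x * v x * φ x :=
      integrable_mul_locallyIntegrable hg hφ.continuous hs
    have i3 : Integrable fun x => G x * deriv (deriv φ) x :=
      integrable_mul_locallyIntegrable hGc.locallyIntegrable (hcd _ (hcd _ hφ)).continuous
        hs.deriv.deriv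
    have e : ∀ x, v x * (deriv (deriv φ) x - Q x * φ x) =
        v x * deriv (deriv φ) x - Q x * v x * φ x := fun x => by ring
    simp only [e] at h3
    rw [integral_sub i1 i2] at h3
    simp only [sub_mul]
    rw [integral_sub i1 i3, h1, h2]
    linarith
  obtain ⟨η, hη, hηs, hη1⟩ := exists_unit_bump
  -- Minus the slope of v - G: adding Bx leaves a function that annihilates every ψ', to which du
  -- Bois-Reymond applies.
  set B := ∫ x, (v x - G x) * deriv η x with hB
  have hlin : LocallyIntegrable fun x : ℝ => B * x := (by fun_prop : Continuous _).locallyIntegrable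
  obtain ⟨A, hA⟩ := ae_const_of_integral_mul_deriv_eq_zero (h := fun x => v x - G x + B * x)
    (hvG.add hlin) fun ψ hψ hs => by
      have hint : Integrable ψ := hψ.continuous.integrable_of_hasCompactSupport hs
      have hintη : Integrable η := hη.continuous.integrable_of_hasCompactSupport hηs
      obtain ⟨φ, hφ, hφs, hd⟩ := exists_antideriv (ψ := fun x => ψ x - (∫ t, ψ t) * η x)
        (hψ.sub (contDiff_const.mul hη)) (hs.sub hηs.mul_left) (by
          rw [integral_sub hint (hintη.const_mul _), integral_const_mul, hη1, mul_one, sub_self])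
      have h1 := hstep φ hφ hφs
      have hdd : ∀ x, deriv (deriv φ) x = deriv ψ x - (∫ t, ψ t) * deriv η x := fun x => by
        rw [hd]
        exact ((hψ.differentiable (by simp) x).hasDerivAt.sub
          ((hη.differentiable (by simp) x).hasDerivAt.const_mul _)).deriv
      have j1 : Integrable fun x => (v x - G x) * deriv ψ x :=
        integrable_mul_locallyIntegrable hvG (hcd _ hψ).continuous hs.deriv
      have j2 : Integrable fun x => (v x - G x) * deriv η x :=
        integrable_mul_locallyIntegrable hvG (hcd _ hη).continuous hηs.deriv
      have j3 : Integrable fun x => (B * x) * deriv ψ x :=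
        integrable_mul_locallyIntegrable hlin (hcd _ hψ).continuous hs.deriv
      have e : ∀ x, (v x - G x) * deriv (deriv φ) x =
          (v x - G x) * deriv ψ x - (∫ t, ψ t) * ((v x - G x) * deriv η x) := fun x => by
        rw [hdd]; ring
      simp only [e] at h1
      rw [integral_sub j1 (j2.const_mul _), integral_const_mul, ← hB] at h1
      have h2 : ∫ x, x * deriv ψ x = -∫ x, ψ x := by
        have := integral_primitive_mul_deriv (g := fun _ => (1 : ℝ)) (locallyIntegrable_const _)
          hψ hs
        simpa using this
      simp only [add_mul]
      rw [integral_add j1 j3]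
      simp only [mul_assoc]
      rw [integral_const_mul, h2]
      linarith
  have hvy : ∀ᵐ x, v x = A - B * x + G x := by
    filter_upwards [hA] with x hx
    linarith
  have hyc : Continuous fun x => A - B * x + G x := by fun_prop
  -- Bootstrap: with v replaced by its continuous representative, G₁ is differentiable at every
  -- point and not only almost everywhere.
  have hG₁' : ∀ x, G₁ x = ∫ t in (0 : ℝ)..x, Q t * (A - B * t + G t) := fun x => by
    refine intervalIntegral.integral_congr_ae ?_
    filter_upwards [hvy] with t ht _
    rw [ht]
  refine ⟨fun x => A - B * x + G x, fun x => -B + G₁ x, fun x => ?_, fun x => ?_, hvy⟩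
  · have := (((hasDerivAt_id x).const_mul B).const_sub A).add (hGd x)
    simpa using! this
  · have h1 : HasDerivAt G₁ (Q x * (A - B * x + G x)) x := by
      rw [funext hG₁']
      exact intervalIntegral.integral_hasDerivAt_right ((hQ.mul hyc).intervalIntegrable _ _)
        ((hQ.mul hyc).stronglyMeasurableAtFilter _ _) (hQ.mul hyc).continuousAt
    exact h1.const_add (-B)

/-- A weak solution of `y'' = Q y` is a classical solution. -/
theorem exists_eq_solution {v : ℝ → ℂ} (hv : LocallyIntegrable v) {Q : ℝ → ℝ}
    (hQ : Continuous Q)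
    (h0 : ∀ φ : testSpace,
      ∫ x, v x * ((testDeriv (testDeriv φ) : ℝ → ℂ) x - Q x * (φ : ℝ → ℂ) x) = 0) :
    ∃ y y₁ : ℝ → ℂ, (∀ x, HasDerivAt y (y₁ x) x) ∧ (∀ x, HasDerivAt y₁ (Q x * y x) x) ∧
      ∀ᵐ x, v x = y x := by
  have hre : LocallyIntegrable fun x => (v x).re := fun x => by
    obtain ⟨s, hs, hi⟩ := hv x
    exact ⟨s, hs, hi.re⟩
  have him : LocallyIntegrable fun x => (v x).im := fun x => by
    obtain ⟨s, hs, hi⟩ := hv x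
    exact ⟨s, hs, hi.im⟩
  have key : ∀ φ : ℝ → ℝ, ContDiff ℝ ∞ φ → HasCompactSupport φ →
      ∫ x, v x * ((deriv (deriv φ) x - Q x * φ x : ℝ) : ℂ) = 0 ∧
      Integrable fun x => v x * ((deriv (deriv φ) x - Q x * φ x : ℝ) : ℂ) := by
    intro φ hφ hs
    have hφ' := (contDiff_infty_iff_deriv.1 hφ).2
    have hφ'' := (contDiff_infty_iff_deriv.1 hφ').2
    let Φ : testSpace := ⟨fun x => (φ x : ℂ), Complex.ofRealCLM.contDiff.comp hφ,
      hs.comp_left (g := fun x : ℝ => (x : ℂ)) Complex.ofReal_zero⟩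
    have hd1 : (testDeriv Φ : ℝ → ℂ) = fun x => ((deriv φ x : ℝ) : ℂ) := funext fun x =>
      ((hφ.differentiable (by simp) x).hasDerivAt.ofReal_comp).deriv
    have hd2 : (testDeriv (testDeriv Φ) : ℝ → ℂ) = fun x => ((deriv (deriv φ) x : ℝ) : ℂ) := by
      rw [testDeriv_apply, hd1]
      exact funext fun x => ((hφ'.differentiable (by simp) x).hasDerivAt.ofReal_comp).deriv
    constructor
    · have := h0 Φ
      rw [hd2] at this
      rw [← this]
      refine integral_congr_ae (Eventually.of_forall fun x => ?_)
      simp [Φ]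
    · have hc : Continuous fun x => deriv (deriv φ) x - Q x * φ x :=
        hφ''.continuous.sub (hQ.mul hφ.continuous)
      have hcs : HasCompactSupport fun x => deriv (deriv φ) x - Q x * φ x :=
        hs.deriv.deriv.sub hs.mul_left
      have := hv.integrable_smul_left_of_hasCompactSupport hc hcs
      simpa [mul_comm, Complex.real_smul] using this
  obtain ⟨y, y₁, hy, hy₁, hvy⟩ := exists_eq_solution_real hre hQ fun φ hφ hs => by
    obtain ⟨h1, h2⟩ := key φ hφ hs
    have h3 := congrArg Complex.re h1
    rw [← RCLike.re_eq_complex_re, ← integral_re h2] at h3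
    simpa using h3
  obtain ⟨z, z₁, hz, hz₁, hvz⟩ := exists_eq_solution_real him hQ fun φ hφ hs => by
    obtain ⟨h1, h2⟩ := key φ hφ hs
    have h3 := congrArg Complex.im h1
    rw [← RCLike.im_eq_complex_im, ← integral_im h2] at h3
    simpa using h3
  refine ⟨fun x => y x + z x * Complex.I, fun x => y₁ x + z₁ x * Complex.I, fun x => ?_,
    fun x => ?_, ?_⟩
  · exact (hy x).ofReal_comp.add ((hz x).ofReal_comp.mul_const _)
  · have := (hy₁ x).ofReal_comp.add ((hz₁ x).ofReal_comp.mul_const Complex.I)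
    convert! this using 1
    push_cast
    ring
  · filter_upwards [hvy, hvz] with x h1 h2
    rw [← h1, ← h2, Complex.re_add_im]

end Regularity

/-! ### Behaviour at both ends of real solutions of y'' = Qy -/

section SecondOrder

/-- `y' = y₁` and `y₁' = Q y`. -/
def IsSolution (Q y y₁ : ℝ → ℝ) : Prop :=
  ∀ x, HasDerivAt y (y₁ x) x ∧ HasDerivAt y₁ (Q x * y x) x

variable {Q y y₁ : ℝ → ℝ}

namespace IsSolution

lemma neg (h : IsSolution Q y y₁) : IsSolution Q (-y) (-y₁) := fun x =>
  ⟨(h x).1.neg, by simpa using! (h x).2.neg⟩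

lemma continuous (h : IsSolution Q y y₁) : Continuous y :=
  continuous_iff_continuousAt.2 fun x => (h x).1.continuousAt

/-- Uniqueness for the Cauchy problem of the first order system, whose Lipschitz constant is bounded
on compact intervals. -/
lemma eq_zero (h : IsSolution Q y y₁) (hQ : Continuous Q) {a : ℝ} (h0 : y a = 0) (h1 : y₁ a = 0)
    (x : ℝ) : y x = 0 := by
  set A := min a x - 1
  set B := max a x + 1
  obtain ⟨M, hM⟩ := (isCompact_Icc (a := A) (b := B)).exists_bound_of_continuousOn hQ.continuousOn
  have ha : a ∈ Ioo A B := ⟨by linarith [min_le_left a x, show A = min a x - 1 from rfl],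
    by linarith [le_max_left a x, show B = max a x + 1 from rfl]⟩
  have hx : x ∈ Ioo A B := ⟨by linarith [min_le_right a x, show A = min a x - 1 from rfl],
    by linarith [le_max_right a x, show B = max a x + 1 from rfl]⟩
  have key := ODE_solution_unique_of_mem_Ioo (E := ℝ × ℝ) (v := fun t p => (p.2, Q t * p.1))
    (s := fun _ => univ) (K := (max 1 M).toNNReal) (f := fun t => (y t, y₁ t)) (g := fun _ => 0)
    (t₀ := a) (a := A) (b := B)
    (fun t ht => LipschitzWith.lipschitzOnWith (LipschitzWith.of_dist_le_mul fun p q => by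
      have hMt : |Q t| ≤ max 1 M := (hM t (Ioo_subset_Icc_self ht)).trans (le_max_right _ _)
      rw [Real.coe_toNNReal _ (by positivity), Prod.dist_eq, Prod.dist_eq]
      refine max_le ?_ ?_
      · calc dist p.2 q.2 ≤ max (dist p.1 q.1) (dist p.2 q.2) := le_max_right _ _
          _ ≤ _ := le_mul_of_one_le_left (by positivity) (le_max_left _ _)
      · simp only [Real.dist_eq, ← mul_sub, abs_mul]
        gcongr
        exact le_max_left _ _))
    ha (fun t _ => ⟨(h t).1.prodMk (h t).2, mem_univ _⟩)
    (fun t _ => ⟨by simpa using! hasDerivAt_const t (0 : ℝ × ℝ), mem_univ _⟩)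
    (by simp [h0, h1])
  exact congrArg Prod.fst (key hx)

lemma hasDerivAt_sq (h : IsSolution Q y y₁) (x : ℝ) :
    HasDerivAt (fun t => y t ^ 2) (2 * (y x * y₁ x)) x := by
  convert! (h x).1.pow 2 using 1
  ring

/-- A square integrable solution is decreasing in modulus where `Q` is nonnegative. -/
lemma mul_deriv_nonpos (h : IsSolution Q y y₁) {X : ℝ} (hQ : ∀ x, X ≤ x → 0 ≤ Q x)
    (hi : IntegrableOn (fun x => y x ^ 2) (Ioi X)) {x : ℝ} (hx : X ≤ x) : y x * y₁ x ≤ 0 := by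
  -- Since (y y')' = y'² + Q y² ≥ 0, a positive value k of y y' persists to the right, and y² grows
  -- at least linearly, which contradicts integrability.
  by_contra! hpos
  have hp : ∀ t, HasDerivAt (fun t => y t * y₁ t) (y₁ t ^ 2 + Q t * y t ^ 2) t := fun t => by
    convert! (h t).1.mul (h t).2 using 1
    ring
  have hmono : MonotoneOn (fun t => y t * y₁ t) (Ici X) :=
    monotoneOn_of_deriv_nonneg (convex_Ici X)
      (fun t _ => (hp t).continuousAt.continuousWithinAt)
      (fun t _ => (hp t).differentiableAt.differentiableWithinAt) fun t ht => by
        rw [interior_Ici] at ht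
        rw [(hp t).deriv]
        have := hQ t (le_of_lt ht)
        positivity
  set k := y x * y₁ x
  have hg : ∀ t, HasDerivAt (fun t => y t ^ 2 - 2 * k * t) (2 * (y t * y₁ t) - 2 * k) t :=
    fun t => by simpa using! (h.hasDerivAt_sq t).sub ((hasDerivAt_id t).const_mul (2 * k))
  have hmono2 : MonotoneOn (fun t => y t ^ 2 - 2 * k * t) (Ici x) :=
    monotoneOn_of_deriv_nonneg (convex_Ici x)
      (fun t _ => (hg t).continuousAt.continuousWithinAt)
      (fun t _ => (hg t).differentiableAt.differentiableWithinAt) fun t ht => by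
        rw [interior_Ici] at ht
        rw [(hg t).deriv]
        have : k ≤ y t * y₁ t := hmono hx (hx.trans ht.le) ht.le
        linarith
  have hlow : ∀ t ∈ Ioi (x + 1), k ≤ y t ^ 2 := fun t ht => by
    have ht' : x + 1 < t := ht
    have h1 : y x ^ 2 - 2 * k * x ≤ y t ^ 2 - 2 * k * t :=
      hmono2 self_mem_Ici (show x ≤ t by linarith) (by linarith)
    nlinarith [sq_nonneg (y x)]
  have hint : IntegrableOn (fun _ : ℝ => k) (Ioi (x + 1)) := by
    refine Integrable.mono' (hi.mono_set (Ioi_subset_Ioi (by linarith : X ≤ x + 1)))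
      aestronglyMeasurable_const ?_
    filter_upwards [ae_restrict_mem measurableSet_Ioi] with t ht
    rw [Real.norm_of_nonneg hpos.le]
    exact hlow t ht
  rw [integrableOn_const_iff] at hint
  simp [hpos.ne'] at hint

/-- To the right of X, y² is nonincreasing, so a zero at X forces y = 0 from there on; the Cauchy
data at X + 1 then vanish. -/
lemma eq_zero_of_eq_zero (h : IsSolution Q y y₁) (hQc : Continuous Q) {X : ℝ}
    (hQ : ∀ x, X ≤ x → 0 ≤ Q x) (hi : IntegrableOn (fun x => y x ^ 2) (Ioi X)) (h0 : y X = 0)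
    (x : ℝ) : y x = 0 := by
  have hanti : AntitoneOn (fun t => y t ^ 2) (Ici X) :=
    antitoneOn_of_deriv_nonpos (convex_Ici X)
      (fun t _ => (h.hasDerivAt_sq t).continuousAt.continuousWithinAt)
      (fun t _ => (h.hasDerivAt_sq t).differentiableAt.differentiableWithinAt) fun t ht => by
        rw [interior_Ici] at ht
        rw [(h.hasDerivAt_sq t).deriv]
        linarith [h.mul_deriv_nonpos hQ hi (le_of_lt ht)]
  have hz : ∀ t, X ≤ t → y t = 0 := fun t ht => by
    have h1 : y t ^ 2 ≤ y X ^ 2 := hanti self_mem_Ici ht ht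
    rw [h0] at h1
    exact pow_eq_zero_iff two_ne_zero |>.1 (le_antisymm (by simpa using h1) (sq_nonneg _))
  have hev : y =ᶠ[𝓝 (X + 1)] fun _ => 0 := by
    filter_upwards [Ioi_mem_nhds (show X < X + 1 by linarith)] with t ht using hz t (le_of_lt ht)
  have h1 : y₁ (X + 1) = 0 :=
    (h (X + 1)).1.unique ((hasDerivAt_const _ _).congr_of_eventuallyEq hev)
  exact h.eq_zero hQc (hz _ (by linarith)) h1 x

/-- A solution positive at x₀ stays positive to the left and grows there at least like e^(-νt). As α
≤ 2ν, this violates integrability against e^(αt) at -∞. -/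
lemma nonpos_of_integrable (h : IsSolution Q y y₁) {α ν : ℝ} (hα : 0 < α) (hν : α ≤ 2 * ν)
    (hQ : ∀ x, ν ^ 2 ≤ Q x) (hi : Integrable fun x => Real.exp (α * x) * y x ^ 2) (x₀ : ℝ) :
    y x₀ ≤ 0 := by
  by_contra! hpos
  have hν0 : 0 < ν := by linarith
  have hyy : ∀ x, y x * y₁ x ≤ 0 := fun x => by
    refine h.mul_deriv_nonpos (X := x) (fun t _ => (sq_nonneg ν).trans (hQ t)) ?_ le_rfl
    refine Integrable.mono' (hi.integrableOn.const_mul (Real.exp (-(α * x))))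
      (h.continuous.pow 2).aestronglyMeasurable ?_
    filter_upwards [ae_restrict_mem measurableSet_Ioi] with t ht
    rw [Real.norm_of_nonneg (sq_nonneg _), ← mul_assoc, ← Real.exp_add]
    refine le_mul_of_one_le_left (sq_nonneg _) (Real.one_le_exp ?_)
    have : x < t := ht
    nlinarith
  have hanti : Antitone fun t => y t ^ 2 := antitone_of_deriv_nonpos
    (fun t => (h.hasDerivAt_sq t).differentiableAt) fun t => by
      rw [(h.hasDerivAt_sq t).deriv]; linarith [hyy t]
  have hne : ∀ x, x ≤ x₀ → y x ≠ 0 := fun x hx h0 => by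
    have h1 : y x₀ ^ 2 ≤ y x ^ 2 := hanti hx
    rw [h0] at h1
    nlinarith
  have hypos : ∀ x, x ≤ x₀ → 0 < y x := fun x hx => by
    by_contra! hle
    obtain ⟨z, hz, hz0⟩ := intermediate_value_Icc hx h.continuous.continuousOn
      (show (0 : ℝ) ∈ Icc (y x) (y x₀) from ⟨hle, hpos.le⟩)
    exact hne z hz.2 hz0
  -- Up to the factor e^(-2νt), F = e^(νt)(y' - νy) is the derivative of e^(-νt) y. It increases
  -- where y > 0, so F ≤ F(x₀) = -k < 0 on the left.
  have hF : ∀ t, HasDerivAt (fun t => Real.exp (ν * t) * (y₁ t - ν * y t))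
      (Real.exp (ν * t) * ((Q t - ν ^ 2) * y t)) t := fun t => by
    have h1 : HasDerivAt (fun t => Real.exp (ν * t)) (Real.exp (ν * t) * ν) t := by
      simpa using ((hasDerivAt_id t).const_mul ν).exp
    convert! h1.mul ((h t).2.sub ((h t).1.const_mul ν)) using 1
    simp only [Pi.sub_apply]
    ring
  have hFmono : MonotoneOn (fun t => Real.exp (ν * t) * (y₁ t - ν * y t)) (Iic x₀) :=
    monotoneOn_of_deriv_nonneg (convex_Iic x₀)
      (fun t _ => (hF t).continuousAt.continuousWithinAt)
      (fun t _ => (hF t).differentiableAt.differentiableWithinAt) fun t ht => by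
        rw [interior_Iic] at ht
        rw [(hF t).deriv]
        exact mul_nonneg (Real.exp_nonneg _)
          (mul_nonneg (sub_nonneg.2 (hQ t)) (hypos t ht.le).le)
  obtain ⟨k, hk, hkF⟩ : ∃ k, 0 < k ∧ Real.exp (ν * x₀) * (y₁ x₀ - ν * y x₀) = -k := by
    refine ⟨_, ?_, (neg_neg _).symm⟩
    rw [← mul_neg]
    refine mul_pos (Real.exp_pos _) ?_
    have : y₁ x₀ ≤ 0 := by
      by_contra! hc
      exact absurd (hyy x₀) (not_le.2 (mul_pos hpos hc))
    nlinarith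
  set κ := k / (2 * ν) with hκ
  have hκ0 : 0 < κ := by positivity
  -- The integrated form of (e^(-νt) y)' ≤ -k e^(-2νt): the constant κ = k/(2ν) makes the difference
  -- nonincreasing.
  have hG : ∀ t, HasDerivAt (fun t => Real.exp (-ν * t) * y t - κ * Real.exp (-(2 * ν) * t))
      (Real.exp (-(2 * ν) * t) * (Real.exp (ν * t) * (y₁ t - ν * y t) + k)) t := fun t => by
    have h1 : HasDerivAt (fun t => Real.exp (-ν * t)) (Real.exp (-ν * t) * -ν) t := by
      simpa using ((hasDerivAt_id t).const_mul (-ν)).exp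
    have h2 : HasDerivAt (fun t => Real.exp (-(2 * ν) * t))
        (Real.exp (-(2 * ν) * t) * -(2 * ν)) t := by
      simpa using ((hasDerivAt_id t).const_mul (-(2 * ν))).exp
    convert! (h1.mul (h t).1).sub (h2.const_mul κ) using 1
    have e : Real.exp (-ν * t) = Real.exp (-(2 * ν) * t) * Real.exp (ν * t) := by
      rw [← Real.exp_add]; ring_nf
    have e2 : k = κ * (2 * ν) := by rw [hκ]; field_simp
    rw [e, e2]
    ring
  have hGanti : AntitoneOn (fun t => Real.exp (-ν * t) * y t - κ * Real.exp (-(2 * ν) * t))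
      (Iic x₀) := antitoneOn_of_deriv_nonpos (convex_Iic x₀)
      (fun t _ => (hG t).continuousAt.continuousWithinAt)
      (fun t _ => (hG t).differentiableAt.differentiableWithinAt) fun t ht => by
        rw [interior_Iic] at ht
        rw [(hG t).deriv]
        have h1 : Real.exp (ν * t) * (y₁ t - ν * y t) ≤ -k := by
          rw [← hkF]
          exact hFmono (mem_Iic.2 (le_of_lt ht)) self_mem_Iic (le_of_lt ht)
        exact mul_nonpos_of_nonneg_of_nonpos (Real.exp_nonneg _) (by linarith)
  set g := Real.exp (-ν * x₀) * y x₀ - κ * Real.exp (-(2 * ν) * x₀) with hg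
  -- Far to the left the integration constant g is at most half of κ e^(-2νt), so y ≥ (κ/2) e^(-νt).
  have hlim : Tendsto (fun t : ℝ => |g| * Real.exp (2 * ν * t)) atBot (𝓝 (|g| * 0)) :=
    (Real.tendsto_exp_atBot.comp (tendsto_id.const_mul_atBot (by positivity))).const_mul _
  rw [mul_zero] at hlim
  obtain ⟨x₁, hx₁⟩ := eventually_atBot.1 (hlim.eventually (gt_mem_nhds (half_pos hκ0)))
  set X := min (min x₀ x₁) 0
  have hlow : ∀ t ∈ Iic X, (κ / 2) ^ 2 ≤ Real.exp (α * t) * y t ^ 2 := fun t ht => by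
    have ht0 : t ≤ x₀ := (mem_Iic.1 ht).trans ((min_le_left _ _).trans (min_le_left _ _))
    have ht1 : t ≤ x₁ := (mem_Iic.1 ht).trans ((min_le_left _ _).trans (min_le_right _ _))
    have ht2 : t ≤ 0 := (mem_Iic.1 ht).trans (min_le_right _ _)
    have h1 : g ≤ Real.exp (-ν * t) * y t - κ * Real.exp (-(2 * ν) * t) :=
      hGanti ht0 self_mem_Iic ht0
    have h2 := hx₁ t ht1
    have e1 : Real.exp (2 * ν * t) * Real.exp (-(2 * ν) * t) = 1 := by
      rw [← Real.exp_add]; simp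
    have e2 : Real.exp (-(2 * ν) * t) = Real.exp (-ν * t) * Real.exp (-ν * t) := by
      rw [← Real.exp_add]; ring_nf
    have h3 : |g| ≤ κ / 2 * Real.exp (-(2 * ν) * t) := by
      calc |g| = |g| * Real.exp (2 * ν * t) * Real.exp (-(2 * ν) * t) := by
            rw [mul_assoc, e1, mul_one]
        _ ≤ _ := by gcongr
    have h4 : κ / 2 * Real.exp (-ν * t) ≤ y t := by
      refine le_of_mul_le_mul_left ?_ (Real.exp_pos (-ν * t))
      have := neg_abs_le g
      rw [e2] at h1 h3
      linarith
    have h5 : (1 : ℝ) ≤ Real.exp (α * t) * Real.exp (-ν * t) ^ 2 := by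
      rw [← Real.exp_nat_mul, ← Real.exp_add]
      refine Real.one_le_exp ?_
      push_cast
      nlinarith
    calc (κ / 2) ^ 2 ≤ (κ / 2) ^ 2 * (Real.exp (α * t) * Real.exp (-ν * t) ^ 2) :=
          le_mul_of_one_le_right (sq_nonneg _) h5
      _ = Real.exp (α * t) * (κ / 2 * Real.exp (-ν * t)) ^ 2 := by ring
      _ ≤ _ := by gcongr
  have hint : IntegrableOn (fun _ : ℝ => (κ / 2) ^ 2) (Iic X) := by
    refine Integrable.mono' hi.integrableOn aestronglyMeasurable_const ?_
    filter_upwards [ae_restrict_mem measurableSet_Iic] with t ht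
    rw [Real.norm_of_nonneg (sq_nonneg _)]
    exact hlow t ht
  rw [integrableOn_const_iff] at hint
  simp [hκ0.ne'] at hint

lemma eq_zero_of_integrable (h : IsSolution Q y y₁) {α ν : ℝ} (hα : 0 < α) (hν : α ≤ 2 * ν)
    (hQ : ∀ x, ν ^ 2 ≤ Q x) (hi : Integrable fun x => Real.exp (α * x) * y x ^ 2) (x : ℝ) :
    y x = 0 := by
  refine le_antisymm (h.nonpos_of_integrable hα hν hQ hi x) ?_
  have := h.neg.nonpos_of_integrable hα hν hQ (by simpa using hi) x
  simpa using this

end IsSolution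

end SecondOrder

/-! ### Injectivity of the adjoint and simplicity of the eigenvalues -/

section Kernel

variable {α : ℝ}

lemma integrable_expMeasure_iff {F : Type*} [NormedAddCommGroup F] [NormedSpace ℝ F] {f : ℝ → F} :
    Integrable f (expMeasure α) ↔ Integrable fun t => Real.exp (α * t) • f t := by
  rw [expMeasure, integrable_withDensity_iff_integrable_smul' (by fun_prop) (by simp)]
  simp [ENNReal.toReal_ofReal, Real.exp_nonneg]

lemma integrableOn_expMeasure_iff {F : Type*} [NormedAddCommGroup F] [NormedSpace ℝ F] {f : ℝ → F}
    {s : Set ℝ} (hs : MeasurableSet s) :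
    IntegrableOn f s (expMeasure α) ↔ IntegrableOn (fun t => Real.exp (α * t) • f t) s := by
  rw [IntegrableOn, expMeasure, restrict_withDensity hs,
    integrable_withDensity_iff_integrable_smul' (by fun_prop) (by simp)]
  simp [ENNReal.toReal_ofReal, Real.exp_nonneg, IntegrableOn]

lemma integrable_exp_mul_norm_sq (x : Lp ℂ 2 (expMeasure α)) :
    Integrable fun t => Real.exp (α * t) * ‖x t‖ ^ 2 :=
  integrable_expMeasure_iff.1 ((Lp.memLp x).integrable_norm_pow (by simp))

lemma locallyIntegrable_Lp_expMeasure (x : Lp ℂ 2 (expMeasure α)) : LocallyIntegrable x := by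
  have h : LocallyIntegrable x (expMeasure α) := (Lp.memLp x).locallyIntegrable (by norm_num)
  have h2 : LocallyIntegrable fun t => Real.exp (α * t) • x t := locallyIntegrable_iff.2
    fun K hK => (integrableOn_expMeasure_iff hK.measurableSet).1 (h.integrableOn_isCompact hK)
  have h3 := (h2.locallyIntegrableOn univ).continuousOn_smul isOpen_univ.isLocallyClosed
    (show Continuous fun t => Real.exp (-(α * t)) by fun_prop).continuousOn
  rw [locallyIntegrableOn_univ] at h3
  convert! h3 using 1
  funext t
  rw [smul_smul, ← Real.exp_add]
  simp

/-- The complex conjugate of a test function. -/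
def testConj (φ : testSpace) : testSpace :=
  ⟨fun x => (starRingEnd ℂ) ((φ : ℝ → ℂ) x), Complex.conjCLE.contDiff.comp φ.2.1,
    φ.2.2.comp_left (map_zero _)⟩

lemma testConj_apply (φ : testSpace) (x : ℝ) :
    (testConj φ : ℝ → ℂ) x = (starRingEnd ℂ) ((φ : ℝ → ℂ) x) := rfl

lemma testDeriv_testConj (φ : testSpace) : testDeriv (testConj φ) = testConj (testDeriv φ) := by
  ext x
  exact ((testSpace_hasDerivAt φ x).star).deriv

variable {V : C(ℝ, ℝ)}

/-- The weak eigenvalue equation, multiplied out by the weight, is the distributional equation y'' =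
(V - l e^(αt)) y. -/
lemma exists_eq_solution_of_inner {x : Lp ℂ 2 (expMeasure α)} {l : ℝ}
    (hx : ∀ φ, inner ℂ (lineOp α V φ) x = inner ℂ (lineIncl α φ) ((l : ℂ) • x)) :
    ∃ y y₁ : ℝ → ℂ, (∀ t, HasDerivAt y (y₁ t) t) ∧
      (∀ t, HasDerivAt y₁ (((V t - l * Real.exp (α * t) : ℝ) : ℂ) * y t) t) ∧
      ∀ᵐ t, x t = y t := by
  have hloc := locallyIntegrable_Lp_expMeasure x
  refine exists_eq_solution hloc (by fun_prop) fun φ => ?_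
  -- Conjugating the test function removes the conjugation from the pairing.
  have h := hx (testConj φ)
  rw [inner_smul_right] at h
  have e1 : inner ℂ (lineOp α V (testConj φ)) x =
      ∫ t, ((V t : ℂ) * (φ : ℝ → ℂ) t - (testDeriv (testDeriv φ) : ℝ → ℂ) t) * x t := by
    rw [lineOp, LinearMap.comp_apply, inner_ccToLp, integral_expMeasure]
    refine integral_congr_ae (Eventually.of_forall fun t => ?_)
    simp only [lineExpr_apply, testDeriv_testConj, testConj_apply, map_mul, map_sub,
      Complex.conj_conj, Complex.conj_ofReal, Complex.real_smul]
    have e : ((Real.exp (α * t) : ℝ) : ℂ) * ((Real.exp (-α * t) : ℝ) : ℂ) = 1 := by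
      rw [← Complex.ofReal_mul, ← Real.exp_add]; simp
    rw [← mul_assoc, ← mul_assoc, e, one_mul]
  have e2 : inner ℂ (lineIncl α (testConj φ)) x =
      ∫ t, (Real.exp (α * t) : ℂ) * (φ : ℝ → ℂ) t * x t := by
    rw [lineIncl, LinearMap.comp_apply, inner_ccToLp, integral_expMeasure]
    refine integral_congr_ae (Eventually.of_forall fun t => ?_)
    change Real.exp (α * t) • ((starRingEnd ℂ) ((starRingEnd ℂ) ((φ : ℝ → ℂ) t)) * x t) = _
    rw [Complex.conj_conj, Complex.real_smul]
    exact (mul_assoc _ _ _).symm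
  have hint : ∀ g : ℝ → ℂ, Continuous g → HasCompactSupport g → Integrable fun t => g t * x t :=
    fun g hg hgs => hloc.integrable_smul_left_of_hasCompactSupport hg hgs
  have i1 : Integrable fun t =>
      ((V t : ℂ) * (φ : ℝ → ℂ) t - (testDeriv (testDeriv φ) : ℝ → ℂ) t) * x t :=
    hint _ (((Complex.continuous_ofReal.comp V.continuous).mul φ.2.1.continuous).sub
      (testDeriv (testDeriv φ)).2.1.continuous)
      (φ.2.2.mul_left.sub (testDeriv (testDeriv φ)).2.2)
  have i2 : Integrable fun t => (Real.exp (α * t) : ℂ) * (φ : ℝ → ℂ) t * x t :=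
    hint _ ((by fun_prop : Continuous fun t : ℝ => (Real.exp (α * t) : ℂ)).mul φ.2.1.continuous)
      φ.2.2.mul_left
  rw [e1, e2, ← integral_const_mul, ← sub_eq_zero, ← integral_sub i1 (i2.const_mul _),
    ← neg_eq_zero, ← integral_neg] at h
  rw [← h]
  refine integral_congr_ae (Eventually.of_forall fun t => ?_)
  push_cast
  ring

lemma isSolution_re {Q : ℝ → ℝ} {y y₁ : ℝ → ℂ} (hy : ∀ t, HasDerivAt y (y₁ t) t)
    (hy₁ : ∀ t, HasDerivAt y₁ ((Q t : ℂ) * y t) t) :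
    IsSolution Q (fun t => (y t).re) fun t => (y₁ t).re := fun t =>
  ⟨Complex.reCLM.hasFDerivAt.comp_hasDerivAt t (hy t), by
    simpa using! Complex.reCLM.hasFDerivAt.comp_hasDerivAt t (hy₁ t)⟩

lemma isSolution_im {Q : ℝ → ℝ} {y y₁ : ℝ → ℂ} (hy : ∀ t, HasDerivAt y (y₁ t) t)
    (hy₁ : ∀ t, HasDerivAt y₁ ((Q t : ℂ) * y t) t) :
    IsSolution Q (fun t => (y t).im) fun t => (y₁ t).im := fun t =>
  ⟨Complex.imCLM.hasFDerivAt.comp_hasDerivAt t (hy t), by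
    simpa using! Complex.imCLM.hasFDerivAt.comp_hasDerivAt t (hy₁ t)⟩

lemma integrable_exp_mul_re_im {y : ℝ → ℂ} (hc : Continuous y) {x : Lp ℂ 2 (expMeasure α)}
    (hx : ∀ᵐ t, x t = y t) :
    Integrable (fun t => Real.exp (α * t) * (y t).re ^ 2) ∧
      Integrable fun t => Real.exp (α * t) * (y t).im ^ 2 := by
  have h := integrable_exp_mul_norm_sq x
  have hre : Continuous fun t => (y t).re := Complex.continuous_re.comp hc
  have him : Continuous fun t => (y t).im := Complex.continuous_im.comp hc
  constructor
  · refine h.mono' (by fun_prop) ?_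
    filter_upwards [hx] with t ht
    rw [Real.norm_of_nonneg (by positivity), ht, ← Complex.normSq_eq_norm_sq, Complex.normSq_apply]
    gcongr
    nlinarith [sq_nonneg (y t).im]
  · refine h.mono' (by fun_prop) ?_
    filter_upwards [hx] with t ht
    rw [Real.norm_of_nonneg (by positivity), ht, ← Complex.normSq_eq_norm_sq, Complex.normSq_apply]
    gcongr
    nlinarith [sq_nonneg (y t).re]

lemma eq_zero_of_ae {x : Lp ℂ 2 (expMeasure α)} (h : ∀ᵐ t, x t = 0) : x = 0 := by
  refine Lp.ext (EventuallyEq.trans ?_ (Lp.coeFn_zero ℂ 2 (expMeasure α)).symm)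
  exact ae_expMeasure_iff.2 h

/-- The adjoint of `1 + T` is injective if the inverse square potential is strong enough. -/
theorem eq_zero_of_inner_lineIncl_add_lineOp (hα : 0 < α) (hV : ∀ t, (α / 2) ^ 2 ≤ V t)
    {x : Lp ℂ 2 (expMeasure α)} (hx : ∀ φ, inner ℂ (lineIncl α φ + lineOp α V φ) x = 0) :
    x = 0 := by
  obtain ⟨y, y₁, hy, hy₁, hxy⟩ := exists_eq_solution_of_inner (V := V) (x := x) (l := -1)
    fun φ => by
      have := hx φ
      rw [inner_add_left] at this
      rw [inner_smul_right]
      push_cast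
      linear_combination this
  have hc : Continuous y := continuous_iff_continuousAt.2 fun t => (hy t).continuousAt
  have hQ : ∀ t, (α / 2) ^ 2 ≤ V t - -1 * Real.exp (α * t) := fun t => by
    linarith [hV t, Real.exp_pos (α * t)]
  obtain ⟨i1, i2⟩ := integrable_exp_mul_re_im hc hxy
  have h0 : ∀ t, y t = 0 := fun t => Complex.ext
    ((isSolution_re hy hy₁).eq_zero_of_integrable hα (by linarith) hQ i1 t)
    ((isSolution_im hy hy₁).eq_zero_of_integrable hα (by linarith) hQ i2 t)
  refine eq_zero_of_ae ?_
  filter_upwards [hxy] with t h1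
  rw [h1, h0]

/-- For t ≥ X ≥ 0 the weight e^(αt) is at least 1, so membership in the weighted space gives plain
square integrability at +∞; the real and imaginary parts are treated separately. -/
lemma eq_zero_of_solution_eq_zero (hα : 0 < α) {Q : ℝ → ℝ} (hQc : Continuous Q) {X : ℝ}
    (hX : 0 ≤ X) (hQ : ∀ t, X ≤ t → 0 ≤ Q t) {y y₁ : ℝ → ℂ} (hy : ∀ t, HasDerivAt y (y₁ t) t)
    (hy₁ : ∀ t, HasDerivAt y₁ ((Q t : ℂ) * y t) t) {x : Lp ℂ 2 (expMeasure α)}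
    (hxy : ∀ᵐ t, x t = y t) (h0 : y X = 0) : x = 0 := by
  have hc : Continuous y := continuous_iff_continuousAt.2 fun t => (hy t).continuousAt
  obtain ⟨i1, i2⟩ := integrable_exp_mul_re_im hc hxy
  have hon : ∀ f : ℝ → ℝ, Continuous f → (Integrable fun t => Real.exp (α * t) * f t ^ 2) →
      IntegrableOn (fun t => f t ^ 2) (Ioi X) := fun f hf hi => by
    refine Integrable.mono' hi.integrableOn (hf.pow 2).aestronglyMeasurable ?_
    filter_upwards [ae_restrict_mem measurableSet_Ioi] with t ht
    rw [Real.norm_of_nonneg (sq_nonneg _)]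
    exact le_mul_of_one_le_left (sq_nonneg _)
      (Real.one_le_exp (mul_nonneg hα.le (hX.trans (le_of_lt ht))))
  have hz : ∀ t, y t = 0 := fun t => Complex.ext
    ((isSolution_re hy hy₁).eq_zero_of_eq_zero hQc hQ
      (hon _ (Complex.continuous_re.comp hc) i1) (by simp [h0]) t)
    ((isSolution_im hy hy₁).eq_zero_of_eq_zero hQc hQ
      (hon _ (Complex.continuous_im.comp hc) i2) (by simp [h0]) t)
  refine eq_zero_of_ae ?_
  filter_upwards [hxy] with t h1
  rw [h1, hz]

/-- The eigenvalues are simple. -/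
theorem exists_smul_eq_of_inner (hα : 0 < α) (hα4 : α < 4) {b : ℝ} (hb : 0 < b)
    (hV : ∀ t, b * Real.exp (4 * t) ≤ V t) {l : ℝ} {x z : Lp ℂ 2 (expMeasure α)}
    (hx : ∀ φ, inner ℂ (lineOp α V φ) x = inner ℂ (lineIncl α φ) ((l : ℂ) • x))
    (hz : ∀ φ, inner ℂ (lineOp α V φ) z = inner ℂ (lineIncl α φ) ((l : ℂ) • z))
    (hx0 : x ≠ 0) : ∃ c : ℂ, z = c • x := by
  obtain ⟨y, y₁, hy, hy₁, hxy⟩ := exists_eq_solution_of_inner hx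
  obtain ⟨w, w₁, hw, hw₁, hzw⟩ := exists_eq_solution_of_inner hz
  -- As α < 4, the potential dominates |l| e^(αt) from some X on, where the coefficient of the
  -- equation is therefore nonnegative.
  obtain ⟨X, hX0, hX⟩ : ∃ X : ℝ, 0 ≤ X ∧ |l| ≤ b * Real.exp ((4 - α) * X) := by
    have hlim : Tendsto (fun t : ℝ => b * Real.exp ((4 - α) * t)) atTop atTop :=
      (Real.tendsto_exp_atTop.comp (tendsto_id.const_mul_atTop (sub_pos.2 hα4))).const_mul_atTop hb
    obtain ⟨X, h1, h2⟩ := ((hlim.eventually_ge_atTop |l|).and (eventually_ge_atTop 0)).exists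
    exact ⟨X, h2, h1⟩
  have hQ : ∀ t, X ≤ t → 0 ≤ V t - l * Real.exp (α * t) := fun t ht => by
    have h1 : |l| ≤ b * Real.exp ((4 - α) * t) := hX.trans (by gcongr)
    have h2 : l * Real.exp (α * t) ≤ b * Real.exp ((4 - α) * t) * Real.exp (α * t) := by
      gcongr
      exact (le_abs_self l).trans h1
    rw [mul_assoc, ← Real.exp_add, ← add_mul, sub_add_cancel] at h2
    linarith [hV t]
  have hQc : Continuous fun t => V t - l * Real.exp (α * t) := by fun_prop
  have hyX : y X ≠ 0 := fun h => hx0 (eq_zero_of_solution_eq_zero hα hQc hX0 hQ hy hy₁ hxy h)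
  refine ⟨w X / y X, sub_eq_zero.1 ?_⟩
  -- This combination of the two eigenfunctions vanishes at X, hence everywhere.
  refine eq_zero_of_solution_eq_zero hα hQc hX0 hQ (y := fun t => w t - w X / y X * y t)
    (y₁ := fun t => w₁ t - w X / y X * y₁ t) (fun t => (hw t).sub ((hy t).const_mul _))
    (fun t => ?_) ?_ ?_
  · convert! (hw₁ t).sub ((hy₁ t).const_mul (w X / y X)) using 1
    ring
  · have h1 := ae_expMeasure_iff.1 (Lp.coeFn_sub z ((w X / y X) • x))
    have h2 := ae_expMeasure_iff.1 (Lp.coeFn_smul (w X / y X) x)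
    filter_upwards [h1, h2, hxy, hzw] with t h1 h2 h3 h4
    rw [h1, Pi.sub_apply, h2, Pi.smul_apply, h3, h4, smul_eq_mul]
  · simp [hyX]

end Kernel

/-! ### Transport along unitary operators -/

section Unitary

universe u v

variable {E : Type u} [NormedAddCommGroup E] [InnerProductSpace ℂ E]
variable {E' : Type v} [NormedAddCommGroup E'] [InnerProductSpace ℂ E']
variable {K : Type*} [NormedAddCommGroup K] [InnerProductSpace ℂ K]
variable {W : Type*} [AddCommGroup W] [Module ℂ W]
variable {i τ : W →ₗ[ℂ] E} {δ : W →ₗ[ℂ] K} {T : E →ₗ.[ℂ] E} {T' : E' →ₗ.[ℂ] E'}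

/-- The unitary operator `U` carries `T` onto `T'`. -/
def Intertwines (U : E ≃ₗᵢ[ℂ] E') (T : E →ₗ.[ℂ] E) (T' : E' →ₗ.[ℂ] E') : Prop :=
  ∀ x y, (x, y) ∈ T.graph ↔ (U x, U y) ∈ T'.graph

lemma Intertwines.symm {U : E ≃ₗᵢ[ℂ] E'} (h : Intertwines U T T') : Intertwines U.symm T' T :=
  fun x y => by rw [h]; simp

/-- The energy space K and the map δ stay the same; only the realisation in the Hilbert space moves.
-/
lemma IsFormFactor.map (h : IsFormFactor T i τ δ) {U : E ≃ₗᵢ[ℂ] E'} (hU : Intertwines U T T') :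
    IsFormFactor T' (U.toLinearEquiv.toLinearMap ∘ₗ i) (U.toLinearEquiv.toLinearMap ∘ₗ τ) δ where
  mem_graph x y := by
    rw [hU.symm, h.mem_graph]
    refine exists_congr fun w => ?_
    rw [LinearIsometryEquiv.eq_symm_apply, LinearIsometryEquiv.eq_symm_apply]
    rfl
  denseRange := U.surjective.denseRange.comp h.denseRange U.continuous
  inner_eq w w' := (U.inner_map_map _ _).trans (h.inner_eq w w')

lemma exists_formIncl_map (U : E ≃ₗᵢ[ℂ] E') (v : formSpace i δ) :
    ∃ v' : formSpace (U.toLinearEquiv.toLinearMap ∘ₗ i) δ,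
      formIncl (U.toLinearEquiv.toLinearMap ∘ₗ i) δ v' = U (formIncl i δ v) := by
  let f : WithLp 2 (E × K) → WithLp 2 (E' × K) := fun p => WithLp.toLp 2 (U p.fst, p.snd)
  have hf : Continuous f := (WithLp.prod_continuous_toLp 2 E' K).comp
    ((U.continuous.comp (WithLp.fstL 2 ℂ E K).continuous).prodMk
      (WithLp.sndL 2 ℂ E K).continuous)
  have hv : f v ∈ formSpace (U.toLinearEquiv.toLinearMap ∘ₗ i) δ := by
    refine map_mem_closure hf v.2 ?_
    rintro _ ⟨w, rfl⟩
    exact ⟨w, rfl⟩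
  exact ⟨⟨f v, hv⟩, rfl⟩

lemma Intertwines.exists_isEigenbasis {U : E ≃ₗᵢ[ℂ] E'} (hU : Intertwines U T T') {ev : ℕ → ℝ}
    {b : HilbertBasis ℕ ℂ E} (hb : IsEigenbasis T ev b) :
    ∃ b' : HilbertBasis ℕ ℂ E', IsEigenbasis T' ev b' := by
  refine ⟨HilbertBasis.ofRepr (U.symm.trans b.repr), fun j => ?_⟩
  have e : (HilbertBasis.ofRepr (U.symm.trans b.repr) : HilbertBasis ℕ ℂ E') j = U (b j) := by
    rw [← HilbertBasis.repr_symm_single, ← HilbertBasis.repr_symm_single]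
    rfl
  rw [e, ← map_smul, ← hU]
  exact hb j

variable [CompleteSpace E] [CompleteSpace E'] [CompleteSpace K]

lemma IsFormFactor.friedrichs_le_map (h : IsFormFactor T i τ δ) {U : E ≃ₗᵢ[ℂ] E'}
    (hU : Intertwines U T T') {x y : E} (hxy : (x, y) ∈ (friedrichs T).graph) :
    (U x, U y) ∈ (friedrichs T').graph := by
  obtain ⟨⟨v, rfl⟩, hv⟩ := (h.mem_friedrichs_graph x y).1 hxy
  refine ((h.map hU).mem_friedrichs_graph _ _).2 ⟨exists_formIncl_map U v, fun w => ?_⟩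
  exact (U.inner_map_map _ _).trans ((hv w).trans (U.inner_map_map _ _).symm)

theorem IsFormFactor.intertwines_friedrichs (h : IsFormFactor T i τ δ) {U : E ≃ₗᵢ[ℂ] E'}
    (hU : Intertwines U T T') : Intertwines U (friedrichs T) (friedrichs T') := fun x y =>
  ⟨h.friedrichs_le_map hU, fun hxy => by
    simpa using (h.map hU).friedrichs_le_map hU.symm hxy⟩

end Unitary

/-! ### The model operator as a partially defined operator -/

section Line

variable {α : ℝ} {V : C(ℝ, ℝ)}

/-- Makes the pairs (φ, operator applied to φ) a single-valued graph, since `Submodule.toLinearPMap`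
describes the operator only for such submodules. -/
lemma lineIncl_injective (α : ℝ) : Function.Injective (lineIncl α) := by
  rw [injective_iff_map_eq_zero]
  intro φ hφ
  have h1 : ∀ᵐ x, (φ : ℝ → ℂ) x = 0 := by
    have h2 := coeFn_ccToLp (expMeasure α) (testVal φ)
    have h3 : ccToLp (expMeasure α) (testVal φ) = 0 := hφ
    rw [h3] at h2
    have h4 := h2.symm.trans (Lp.coeFn_zero ℂ 2 (expMeasure α))
    exact ae_expMeasure_iff.1 h4
  have h2 : (φ : ℝ → ℂ) = fun _ => 0 :=
    (Continuous.ae_eq_iff_eq volume φ.2.1.continuous continuous_const).1 h1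
  exact Subtype.ext h2

/-- The operator `φ ↦ e^{-αx} (-φ'' + V φ)` on `C_c^∞(ℝ)` in `L²(e^{αx} dx)`. -/
def lineOperator (α : ℝ) (V : C(ℝ, ℝ)) : Lp ℂ 2 (expMeasure α) →ₗ.[ℂ] Lp ℂ 2 (expMeasure α) :=
  (LinearMap.range ((lineIncl α).prod (lineOp α V))).toLinearPMap

lemma mem_graph_lineOperator (x y : Lp ℂ 2 (expMeasure α)) :
    (x, y) ∈ (lineOperator α V).graph ↔ ∃ φ, lineIncl α φ = x ∧ lineOp α V φ = y := by
  rw [lineOperator, Submodule.toLinearPMap_graph_eq]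
  · simp [LinearMap.mem_range, Prod.ext_iff]
  · rintro _ ⟨φ, rfl⟩ h0
    have : φ = 0 := lineIncl_injective α (by simpa using h0)
    simp [this]

lemma isFormFactor_lineOperator (hV : ∀ x, 0 ≤ V x) :
    IsFormFactor (lineOperator α V) (lineIncl α) (lineOp α V) (lineGrad V) where
  mem_graph := mem_graph_lineOperator
  denseRange := denseRange_lineIncl α
  inner_eq := inner_lineOp hV α

end Line

/-! ### The logarithmic substitution t = e^x on L² spaces -/

section HalfLine

/-- The Jacobian dt = e^x dx accounts for the shift of the exponent by one. -/
lemma map_exp_expMeasure {α q : ℝ} (h : α = q + 1) :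
    (expMeasure α).map Real.exp = powMeasure q := by
  subst h
  ext s hs
  have hms : MeasurableSet (Real.exp ⁻¹' s) := Real.measurable_exp hs
  rw [Measure.map_apply Real.measurable_exp hs, expMeasure, powMeasure, withDensity_apply _ hms,
    withDensity_apply _ hs, Measure.restrict_restrict hs]
  have himg : s ∩ Ioi 0 = Real.exp '' (Real.exp ⁻¹' s) := by
    rw [image_preimage_eq_inter_range, Real.range_exp]
  rw [himg, lintegral_image_eq_lintegral_abs_deriv_mul hms
    (fun x _ => (Real.hasDerivAt_exp x).hasDerivWithinAt) Real.exp_injective.injOn]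
  refine lintegral_congr fun x => ?_
  rw [← ENNReal.ofReal_mul (abs_nonneg _), abs_of_pos (Real.exp_pos _), ← Real.exp_mul,
    ← Real.exp_add]
  ring_nf

lemma ae_powMeasure_iff {q : ℝ} {p : ℝ → Prop} :
    (∀ᵐ t ∂(powMeasure q), p t) ↔ ∀ᵐ x, p (Real.exp x) := by
  have hexp : Measure.QuasiMeasurePreserving Real.exp (expMeasure (q + 1)) (powMeasure q) :=
    ⟨Real.measurable_exp, (map_exp_expMeasure rfl).le.absolutelyContinuous⟩
  have hlog : Measure.QuasiMeasurePreserving Real.log (powMeasure q) (expMeasure (q + 1)) := by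
    refine ⟨Real.measurable_log, ?_⟩
    rw [← map_exp_expMeasure rfl, Measure.map_map Real.measurable_log Real.measurable_exp]
    have : Real.log ∘ Real.exp = id := funext Real.log_exp
    rw [this, Measure.map_id]
  rw [← ae_expMeasure_iff (α := q + 1)]
  constructor
  · exact fun h => hexp.ae h
  · intro h
    filter_upwards [hlog.ae h, ae_pos_powMeasure q] with t h1 h2
    rwa [Real.exp_log h2] at h1

lemma aestronglyMeasurable_expMeasure_iff {α : ℝ} {f : ℝ → ℂ} :
    AEStronglyMeasurable f (expMeasure α) ↔ AEStronglyMeasurable f volume := by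
  constructor <;> refine fun h => h.mono_ac ?_
  · exact (Measure.ae_le_iff_absolutelyContinuous).1 (ae_expMeasure α).ge
  · exact (Measure.ae_le_iff_absolutelyContinuous).1 (ae_expMeasure α).le

/-- The square of the factor e^(sx) is absorbed by changing the exponent of the weight by 2s. -/
lemma eLpNorm_exp_mul (s : ℝ) {α β : ℝ} (h : α = β - 2 * s) (f : ℝ → ℂ) :
    eLpNorm (fun x => (Real.exp (s * x) : ℂ) * f x) 2 (expMeasure α) =
      eLpNorm f 2 (expMeasure β) := by
  rw [eLpNorm_eq_lintegral_rpow_enorm_toReal (by simp) (by simp),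
    eLpNorm_eq_lintegral_rpow_enorm_toReal (by simp) (by simp), expMeasure, expMeasure,
    lintegral_withDensity_eq_lintegral_mul_non_measurable _ (by fun_prop) (by simp),
    lintegral_withDensity_eq_lintegral_mul_non_measurable _ (by fun_prop) (by simp)]
  congr 1
  refine lintegral_congr fun x => ?_
  simp only [Pi.mul_apply, enorm_mul, ENNReal.toReal_ofNat, ENNReal.rpow_ofNat, mul_pow, ← mul_assoc]
  congr 1
  have e : ‖(Real.exp (s * x) : ℂ)‖ₑ = ENNReal.ofReal (Real.exp (s * x)) := by
    rw [← ofReal_norm, Complex.norm_real,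
      Real.norm_of_nonneg (Real.exp_nonneg _)]
  rw [e, ← ENNReal.ofReal_pow (Real.exp_nonneg _), ← ENNReal.ofReal_mul (Real.exp_nonneg _),
    ← Real.exp_nat_mul, ← Real.exp_add, h]
  push_cast
  ring_nf

lemma memLp_exp_mul (s : ℝ) {α β : ℝ} (h : α = β - 2 * s) {f : ℝ → ℂ}
    (hf : MemLp f 2 (expMeasure β)) :
    MemLp (fun x => (Real.exp (s * x) : ℂ) * f x) 2 (expMeasure α) := by
  refine ⟨aestronglyMeasurable_expMeasure_iff.2 (Continuous.aestronglyMeasurable (by fun_prop) |>.mul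
    (aestronglyMeasurable_expMeasure_iff.1 hf.1)), ?_⟩
  rw [eLpNorm_exp_mul s h]
  exact hf.2

variable {α q s : ℝ}

lemma memLp_comp_exp (w : L2pow q) : MemLp (fun x => w (Real.exp x)) 2 (expMeasure (q + 1)) := by
  exact (Lp.memLp w).comp_measurePreserving ⟨Real.measurable_exp, map_exp_expMeasure rfl⟩

/-- The isometry `w ↦ e^{sx} w(e^x)`. -/
def logIsometry (h : α = q + 1 - 2 * s) : L2pow q →ₗᵢ[ℂ] Lp ℂ 2 (expMeasure α) where
  toFun w := (memLp_exp_mul s h (memLp_comp_exp w)).toLp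
  map_add' w w' := by
    rw [← MemLp.toLp_add, MemLp.toLp_eq_toLp_iff]
    refine ae_expMeasure_iff.2 ?_
    filter_upwards [ae_powMeasure_iff.1 (Lp.coeFn_add w w')] with x hx
    rw [hx, Pi.add_apply, Pi.add_apply, mul_add]
  map_smul' c w := by
    rw [RingHom.id_apply, ← MemLp.toLp_const_smul, MemLp.toLp_eq_toLp_iff]
    refine ae_expMeasure_iff.2 ?_
    filter_upwards [ae_powMeasure_iff.1 (Lp.coeFn_smul c w)] with x hx
    rw [hx, Pi.smul_apply, Pi.smul_apply, smul_eq_mul, smul_eq_mul, mul_left_comm]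
  norm_map' w := by
    have e : eLpNorm (fun x => w (Real.exp x)) 2 (expMeasure (q + 1)) =
        eLpNorm w 2 (powMeasure q) :=
      eLpNorm_comp_measurePreserving (Lp.aestronglyMeasurable w)
        ⟨Real.measurable_exp, map_exp_expMeasure rfl⟩
    change ‖(memLp_exp_mul s h (memLp_comp_exp w)).toLp‖ = _
    rw [Lp.norm_toLp, eLpNorm_exp_mul s h, e, Lp.norm_def]

lemma coeFn_logIsometry (h : α = q + 1 - 2 * s) (w : L2pow q) :
    ∀ᵐ x, logIsometry h w x = (Real.exp (s * x) : ℂ) * w (Real.exp x) :=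
  ae_expMeasure_iff.1 (MemLp.coeFn_toLp (memLp_exp_mul s h (memLp_comp_exp w)))

lemma logIsometry_surjective (h : α = q + 1 - 2 * s) : Function.Surjective (logIsometry h) := by
  intro g
  have hm : MemLp (fun t => (Real.exp (-s * Real.log t) : ℂ) * g (Real.log t)) 2
      (powMeasure q) := by
    have h1 : MemLp (fun x => (Real.exp (-s * x) : ℂ) * g x) 2 (expMeasure (q + 1)) :=
      memLp_exp_mul (-s) (by rw [h]; ring) (Lp.memLp g)
    have hlog : MeasurePreserving Real.log (powMeasure q) (expMeasure (q + 1)) := by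
      refine ⟨Real.measurable_log, ?_⟩
      rw [← map_exp_expMeasure rfl, Measure.map_map Real.measurable_log Real.measurable_exp]
      have : Real.log ∘ Real.exp = id := funext Real.log_exp
      rw [this, Measure.map_id]
    exact h1.comp_measurePreserving hlog
  refine ⟨hm.toLp, Lp.ext (ae_expMeasure_iff.2 ?_)⟩
  filter_upwards [coeFn_logIsometry h hm.toLp, ae_powMeasure_iff.1 hm.coeFn_toLp] with x h1 h2
  rw [h1, h2, Real.log_exp, ← mul_assoc,
    ← Complex.ofReal_mul, ← Real.exp_add]
  simp

/-- The unitary operator `w ↦ e^{sx} w(e^x)`. -/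
def logEquiv (h : α = q + 1 - 2 * s) : L2pow q ≃ₗᵢ[ℂ] Lp ℂ 2 (expMeasure α) :=
  LinearIsometryEquiv.ofSurjective (logIsometry h) (logIsometry_surjective h)

lemma coeFn_logEquiv (h : α = q + 1 - 2 * s) (w : L2pow q) :
    ∀ᵐ x, logEquiv h w x = (Real.exp (s * x) : ℂ) * w (Real.exp x) :=
  coeFn_logIsometry h w

end HalfLine

/-! ### The substitution on test functions and on the differential expression -/

section TestFunctions

/-- The test function `x ↦ e^{sx} u(e^x)` on the line. -/
def logTest (s : ℝ) (u : ℝ → ℂ) (hu : IsTest u) : testSpace :=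
  ⟨fun x => (Real.exp (s * x) : ℂ) * u (Real.exp x),
    ((Complex.ofRealCLM.contDiff.comp (by fun_prop : ContDiff ℝ ∞ fun x : ℝ => Real.exp (s * x))).mul
      (hu.1.comp Real.contDiff_exp)), by
    refine HasCompactSupport.intro (K := Real.log '' tsupport u) ?_ fun x hx => ?_
    · exact hu.2.1.isCompact.image_of_continuousOn
        (Real.continuousOn_log.mono fun t ht => (hu.2.2 ht).ne')
    · rw [image_eq_zero_of_notMem_tsupport (f := u), mul_zero]
      exact fun h => hx ⟨_, h, Real.log_exp x⟩⟩

lemma logTest_apply (s : ℝ) (u : ℝ → ℂ) (hu : IsTest u) (x : ℝ) :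
    (logTest s u hu : ℝ → ℂ) x = (Real.exp (s * x) : ℂ) * u (Real.exp x) := rfl

/-- Each test function on the line comes from a test function on the half line. -/
lemma exists_logTest_eq (s : ℝ) (φ : testSpace) : ∃ (u : ℝ → ℂ) (hu : IsTest u), logTest s u hu = φ := by
  set K : Set ℝ := Real.exp '' tsupport (φ : ℝ → ℂ) with hK
  have hKc : IsCompact K := φ.2.2.isCompact.image Real.continuous_exp
  have hKpos : K ⊆ Ioi 0 := by
    rintro _ ⟨x, -, rfl⟩
    exact Real.exp_pos x
  set u : ℝ → ℂ := K.indicator fun t => (Real.exp (-s * Real.log t) : ℂ) * (φ : ℝ → ℂ) (Real.log t)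
    with hu
  have hupos : ∀ t, 0 < t →
      u t = (Real.exp (-s * Real.log t) : ℂ) * (φ : ℝ → ℂ) (Real.log t) := fun t ht => by
    by_cases htK : t ∈ K
    · exact indicator_of_mem htK _
    · rw [hu, indicator_of_notMem htK, image_eq_zero_of_notMem_tsupport (f := (φ : ℝ → ℂ)), mul_zero]
      exact fun h => htK ⟨_, h, Real.exp_log ht⟩
  have hsupp : tsupport u ⊆ K :=
    closure_minimal (Function.support_subset_iff'.2 fun t ht => indicator_of_notMem ht _)
      hKc.isClosed
  have htest : IsTest u := by
    refine ⟨contDiff_iff_contDiffAt.2 fun t => ?_, hKc.of_isClosed_subset (isClosed_tsupport u) hsupp,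
      hsupp.trans hKpos⟩
    rcases lt_or_ge 0 t with ht | ht
    · have hlog : ContDiffAt ℝ ∞ Real.log t := Real.contDiffAt_log.2 ht.ne'
      have h1 : ContDiffAt ℝ ∞
          (fun t => (Real.exp (-s * Real.log t) : ℂ) * (φ : ℝ → ℂ) (Real.log t)) t :=
        (Complex.ofRealCLM.contDiff.contDiffAt.comp t
          (Real.contDiff_exp.contDiffAt.comp t (contDiffAt_const.mul hlog))).mul
          (φ.2.1.contDiffAt.comp t hlog)
      exact h1.congr_of_eventuallyEq (eventually_of_mem (Ioi_mem_nhds ht) hupos)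
    · have hz : u =ᶠ[𝓝 t] fun _ => 0 :=
        eventually_of_mem (hKc.isClosed.isOpen_compl.mem_nhds fun h => not_lt.2 ht (hKpos h))
          fun x hx => indicator_of_notMem hx _
      exact contDiffAt_const.congr_of_eventuallyEq hz
  refine ⟨u, htest, Subtype.ext (funext fun x => ?_)⟩
  rw [logTest_apply, hupos _ (Real.exp_pos x), Real.log_exp, ← mul_assoc, ← Complex.ofReal_mul,
    ← Real.exp_add]
  simp

lemma hasDerivAt_exp_mul_comp_exp (s : ℝ) {u : ℝ → ℂ} (hu : Differentiable ℝ u) (x : ℝ) :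
    HasDerivAt (fun x : ℝ => (Real.exp (s * x) : ℂ) * u (Real.exp x))
      ((s : ℂ) * ((Real.exp (s * x) : ℂ) * u (Real.exp x)) +
        (Real.exp ((s + 1) * x) : ℂ) * deriv u (Real.exp x)) x := by
  have h1 : HasDerivAt (fun x : ℝ => (Real.exp (s * x) : ℂ)) ((Real.exp (s * x) * s : ℝ) : ℂ) x := by
    refine HasDerivAt.ofReal_comp ?_
    simpa using ((hasDerivAt_id x).const_mul s).exp
  have h2 : HasDerivAt (fun x : ℝ => u (Real.exp x)) (Real.exp x • deriv u (Real.exp x)) x :=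
    (hu (Real.exp x)).hasDerivAt.scomp x (Real.hasDerivAt_exp x)
  convert! h1.mul h2 using 1
  rw [add_mul, Real.exp_add, one_mul, Complex.real_smul]
  push_cast
  ring

lemma testDeriv_testDeriv_logTest (s : ℝ) (u : ℝ → ℂ) (hu : IsTest u) (x : ℝ) :
    (testDeriv (testDeriv (logTest s u hu)) : ℝ → ℂ) x =
      (s : ℂ) ^ 2 * ((Real.exp (s * x) : ℂ) * u (Real.exp x)) +
        (2 * s + 1) * ((Real.exp ((s + 1) * x) : ℂ) * deriv u (Real.exp x)) +
        (Real.exp ((s + 2) * x) : ℂ) * deriv (deriv u) (Real.exp x) := by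
  have hd : Differentiable ℝ (deriv u) :=
    ((contDiff_infty_iff_deriv.1 hu.1).2).differentiable (by simp)
  have h1 : (testDeriv (logTest s u hu) : ℝ → ℂ) = fun x =>
      (s : ℂ) * ((Real.exp (s * x) : ℂ) * u (Real.exp x)) +
        (Real.exp ((s + 1) * x) : ℂ) * deriv u (Real.exp x) :=
    funext fun x => (hasDerivAt_exp_mul_comp_exp s hu.differentiable x).deriv
  rw [testDeriv_apply, h1]
  refine HasDerivAt.deriv ?_
  convert! ((hasDerivAt_exp_mul_comp_exp s hu.differentiable x).const_mul (s : ℂ)).add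
    (hasDerivAt_exp_mul_comp_exp (s + 1) hd x) using 1
  rw [add_assoc s 1 1]
  push_cast
  norm_num
  ring

/-- For φ(x) = e^(sx) u(e^x), the choice s = (k - 1)/2 turns the flux term into -φ'' + s²φ without a
first derivative. Hence the constant c = s² - a in the potential. -/
lemma expr_exp {n : ℕ} {k a b s c : ℝ} (hs : s = (k - 1) / 2) (hc : c = s ^ 2 - a) {V : C(ℝ, ℝ)}
    (hV : ∀ x, V x = c + b * Real.exp (4 * x)) (u : ℝ → ℂ) (hu : IsTest u) (x : ℝ) :
    (Real.exp (s * x) : ℂ) * expr n k a b u (Real.exp x) =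
      (lineExpr (4 - 4 / n) V (logTest s u hu) : ℝ → ℂ) x := by
  have hd : Differentiable ℝ (deriv u) :=
    ((contDiff_infty_iff_deriv.1 hu.1).2).differentiable (by simp)
  have hflux : HasDerivAt (fun t : ℝ => ((t ^ k : ℝ) : ℂ) * deriv u t)
      (((k * Real.exp x ^ (k - 1) : ℝ) : ℂ) * deriv u (Real.exp x) +
        ((Real.exp x ^ k : ℝ) : ℂ) * deriv (deriv u) (Real.exp x)) (Real.exp x) :=
    (Real.hasDerivAt_rpow_const (Or.inl (Real.exp_pos x).ne')).ofReal_comp.mul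
      (hd (Real.exp x)).hasDerivAt
  rw [expr, hflux.deriv, lineExpr_apply, testDeriv_testDeriv_logTest, logTest_apply, hV, hc]
  simp only [← Real.exp_mul]
  have hk : k = 2 * s + 1 := by rw [hs]; ring
  -- After the substitution each of the four terms is a product of exponentials, and only the
  -- exponents have to be compared.
  have hcast : ∀ p q r v w : ℝ, p + q + r = v + w →
      (Real.exp p : ℂ) * Real.exp q * Real.exp r = (Real.exp v : ℂ) * Real.exp w := by
    intro p q r v w hpq
    rw [← Complex.ofReal_mul, ← Complex.ofReal_mul, ← Complex.ofReal_mul, ← Real.exp_add,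
      ← Real.exp_add, ← Real.exp_add, hpq]
  have e1 := hcast (s * x) (x * -wt n k) (x * (k - 1)) (-(4 - 4 / n) * x) ((s + 1) * x)
    (by rw [wt, hk]; ring)
  have e2 := hcast (s * x) (x * -wt n k) (x * k) (-(4 - 4 / n) * x) ((s + 2) * x)
    (by rw [wt, hk]; ring)
  have e3 := hcast (s * x) (x * -wt n k) (x * (k - 2)) (-(4 - 4 / n) * x) (s * x)
    (by rw [wt, hk]; ring)
  have e4 := hcast (s * x) (x * -wt n k) (x * (k + 2)) (-(4 - 4 / n) * x) (s * x + 4 * x)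
    (by rw [wt, hk]; ring)
  rw [Real.exp_add (s * x)] at e4
  have hkc : (k : ℂ) = 2 * s + 1 := by rw [hk]; push_cast; ring
  simp only [Complex.ofReal_mul, Complex.ofReal_add, Complex.ofReal_sub, Complex.ofReal_pow] at e4 ⊢
  linear_combination (-(k : ℂ) * deriv u (Real.exp x)) * e1
    - deriv (deriv u) (Real.exp x) * e2 - a * u (Real.exp x) * e3 + b * u (Real.exp x) * e4
    - ((Real.exp (-(4 - 4 / n) * x) : ℂ) * Real.exp ((s + 1) * x) * deriv u (Real.exp x)) * hkc

lemma minGraph_iff {n : ℕ} {k a b s c : ℝ} (hs : s = (k - 1) / 2) (hc : c = s ^ 2 - a)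
    {V : C(ℝ, ℝ)} (hV : ∀ x, V x = c + b * Real.exp (4 * x))
    (h : 4 - 4 / (n : ℝ) = wt n k + 1 - 2 * s) (x y : L2pow (wt n k)) :
    (x, y) ∈ minGraph n k a b ↔
      ∃ φ, lineIncl (4 - 4 / n) φ = logEquiv h x ∧ lineOp (4 - 4 / n) V φ = logEquiv h y := by
  have key : ∀ (u : ℝ → ℂ) (hu : IsTest u), (x =ᵐ[powMeasure (wt n k)] u ∧
      y =ᵐ[powMeasure (wt n k)] expr n k a b u) ↔
      lineIncl (4 - 4 / n) (logTest s u hu) = logEquiv h x ∧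
        lineOp (4 - 4 / n) V (logTest s u hu) = logEquiv h y := by
    intro u hu
    have gen : ∀ (z : L2pow (wt n k)) (v : ℝ → ℂ) (ψ : ccSpace),
        (∀ x, (ψ : ℝ → ℂ) x = (Real.exp (s * x) : ℂ) * v (Real.exp x)) →
        (z =ᵐ[powMeasure (wt n k)] v ↔ ccToLp (expMeasure (4 - 4 / n)) ψ = logEquiv h z) := by
      intro z v ψ hψ
      rw [EventuallyEq, ae_powMeasure_iff, Lp.ext_iff, EventuallyEq, ae_expMeasure_iff]
      have h1 := coeFn_logEquiv h z
      have h2 := ae_expMeasure_iff.1 (coeFn_ccToLp (expMeasure (4 - 4 / n)) ψ)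
      constructor <;> intro h3
      · filter_upwards [h1, h2, h3] with t h1 h2 h3
        rw [h1, h2, h3, hψ]
      · filter_upwards [h1, h2, h3] with t h1 h2 h3
        rw [h1, h2, hψ] at h3
        refine (mul_left_cancel₀ ?_ h3).symm
        exact Complex.ofReal_ne_zero.2 (Real.exp_ne_zero _)
    rw [gen x u (testVal (logTest s u hu)) fun t => rfl,
      gen y (expr n k a b u) (lineExpr (4 - 4 / n) V (logTest s u hu))
        fun t => (expr_exp hs hc hV u hu t).symm]
    rfl
  constructor
  · rintro ⟨u, hu, hxy⟩
    exact ⟨_, (key u hu).1 hxy⟩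
  · rintro ⟨φ, hφ⟩
    obtain ⟨u, hu, rfl⟩ := exists_logTest_eq s φ
    exact ⟨u, hu, (key u hu).2 hφ⟩

/-- The logarithmic substitution carries the operator on the half line onto the one on the line. -/
theorem intertwines_logEquiv {n : ℕ} {k a b s c : ℝ} (hs : s = (k - 1) / 2) (hc : c = s ^ 2 - a)
    {V : C(ℝ, ℝ)} (hV : ∀ x, V x = c + b * Real.exp (4 * x))
    (h : 4 - 4 / (n : ℝ) = wt n k + 1 - 2 * s) :
    Intertwines (logEquiv h) (minOperator n k a b) (lineOperator (4 - 4 / n) V) := by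
  intro x y
  rw [mem_graph_lineOperator, ← minGraph_iff hs hc hV h, minOperator, Submodule.toLinearPMap_graph_eq]
  -- Single-valuedness of the minimal graph, inherited from the line.
  rintro ⟨x, y⟩ hxy (rfl : x = 0)
  obtain ⟨φ, h1, h2⟩ := (minGraph_iff hs hc hV h 0 y).1 hxy
  rw [map_zero] at h1
  have : φ = 0 := lineIncl_injective _ (h1.trans (map_zero _).symm)
  rw [this, map_zero] at h2
  exact (logEquiv h).map_eq_zero_iff.1 h2.symm

end TestFunctions

/-! ### Results for the potential c + b e^(4x) -/

section Main

/-- The potential `c + b e^{4x}`. -/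
def linePotential (c b : ℝ) : C(ℝ, ℝ) := ⟨fun x => c + b * Real.exp (4 * x), by fun_prop⟩

lemma linePotential_apply (c b x : ℝ) : linePotential c b x = c + b * Real.exp (4 * x) := rfl

variable {c b : ℝ}

lemma isFormFactor_linePotential (hc : 0 < c) (hb : 0 < b) (α : ℝ) :
    IsFormFactor (lineOperator α (linePotential c b)) (lineIncl α)
      (lineOp α (linePotential c b)) (lineGrad (linePotential c b)) :=
  isFormFactor_lineOperator fun x => by rw [linePotential_apply]; positivity

lemma four_sub_div_pos {n : ℕ} (hn : 2 ≤ n) : 0 < 4 - 4 / (n : ℝ) := by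
  have hn' : (2 : ℝ) ≤ n := by exact_mod_cast hn
  have : 4 / (n : ℝ) ≤ 2 := by rw [div_le_iff₀ (by linarith)]; linarith
  linarith

lemma four_sub_div_lt {n : ℕ} (hn : 2 ≤ n) : 4 - 4 / (n : ℝ) < 4 := by
  have hn' : (2 : ℝ) ≤ n := by exact_mod_cast hn
  have : 0 < 4 / (n : ℝ) := by positivity
  linarith

theorem exists_eigenbasis_line {n : ℕ} (hn : 2 ≤ n) (hc : 0 < c) (hb : 0 < b) :
    ∃ ev : ℕ → ℝ, 0 < ev 0 ∧ StrictMono ev ∧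
      (∃ e, IsEigenbasis (friedrichs (lineOperator (4 - 4 / n) (linePotential c b))) ev e) ∧
      ∀ β : ℝ≥0, 0 < β → Summable fun i => Real.exp (-(β : ℝ) * ev i) := by
  have hα := four_sub_div_pos hn
  have hα4 := four_sub_div_lt hn
  have h := isFormFactor_linePotential hc hb (4 - 4 / n)
  have hVc : ∀ x, c ≤ linePotential c b x := fun x => by
    rw [linePotential_apply]
    exact le_add_of_nonneg_right (by positivity)
  have hVb : ∀ x, b * Real.exp (4 * x) ≤ linePotential c b x := fun x => by
    rw [linePotential_apply]
    linarith
  obtain ⟨C, p, hco⟩ := exists_lineGrad_coercive hn hb hc hVc hVb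
  refine h.exists_eigenbasis (lt_min hc hb) ?_ hco ?_ (not_finiteDimensional_expMeasure _)
  · refine lineIncl_le_lineGrad (fun x => hc.le.trans (hVc x)) fun x => ?_
    rw [linePotential_apply]
    -- The spectral gap min c b: for x ≤ 0 the constant dominates because the weight is at most 1,
    -- for x ≥ 0 the exponential does because 4 exceeds 4 - 4/n.
    rcases le_total x 0 with hx | hx
    · have h1 : Real.exp ((4 - 4 / n) * x) ≤ 1 :=
        Real.exp_le_one_iff.2 (mul_nonpos_of_nonneg_of_nonpos hα.le hx)
      calc min c b * Real.exp ((4 - 4 / n) * x) ≤ c * 1 := by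
            gcongr
            exact min_le_left _ _
        _ ≤ _ := by rw [mul_one]; exact le_add_of_nonneg_right (by positivity)
    · calc min c b * Real.exp ((4 - 4 / n) * x) ≤ b * Real.exp (4 * x) := by
            gcongr
            exact min_le_right _ _
        _ ≤ _ := le_add_of_nonneg_left hc.le
  · intro l x y hx hy hx0
    exact exists_smul_eq_of_inner hα hα4 hb hVb ((h.mem_friedrichs_graph _ _).1 hx).2
      ((h.mem_friedrichs_graph _ _).1 hy).2 hx0

lemma closure_eq_friedrichs_of_intertwines {n : ℕ} (hn : 2 ≤ n) (hb : 0 < b)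
    (hc : 4 * (1 - 1 / (n : ℝ)) ^ 2 ≤ c) {E : Type*} [NormedAddCommGroup E]
    [InnerProductSpace ℂ E] [CompleteSpace E] {T : E →ₗ.[ℂ] E}
    {U : E ≃ₗᵢ[ℂ] Lp ℂ 2 (expMeasure (4 - 4 / n))}
    (hU : Intertwines U T (lineOperator (4 - 4 / n) (linePotential c b))) :
    T.closure = friedrichs T := by
  have hα := four_sub_div_pos hn
  -- The threshold in the theorem is (α/2)², the borderline of square integrability at -∞.
  have hsq : ((4 - 4 / (n : ℝ)) / 2) ^ 2 = 4 * (1 - 1 / (n : ℝ)) ^ 2 := by ring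
  have hc0 : 0 < c := lt_of_lt_of_le (by rw [← hsq]; positivity) hc
  refine ((isFormFactor_linePotential hc0 hb _).map hU.symm).closure_eq_friedrichs fun x hx => ?_
  have h0 : U x = 0 := by
    refine eq_zero_of_inner_lineIncl_add_lineOp (V := linePotential c b) hα (fun t => ?_)
      fun φ => ?_
    · rw [linePotential_apply, hsq]
      exact hc.trans (le_add_of_nonneg_right (by positivity))
    · rw [← hx φ, ← U.inner_map_map]
      simp
  exact U.map_eq_zero_iff.1 h0

end Main

end WeightedBessel

end

theorem theorem6p4 (n : ℕ) (hn : 17 ≤ n) (r L : ℝ) (hμ : WeightedBessel.muBar n r < 0)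
    (hL : L < 0) :
    -- `H₀` and the temporal Hamiltonian are self-adjoint
    IsSelfAdjoint (WeightedBessel.H0 n r L) ∧
    IsSelfAdjoint (WeightedBessel.hatH0 n r L) ∧
    -- they are the closures of the operators on the test functions
    (4 * (1 - 1 / (n : ℝ)) ^ 2 ≤ -WeightedBessel.muBar n r →
      (WeightedBessel.H0min n r L).closure = WeightedBessel.H0 n r L ∧
      (WeightedBessel.hatH0min n r L).closure = WeightedBessel.hatH0 n r L) ∧
    -- they are unitarily equivalent through `w ↦ t ^ ((m - 1) / 2) w`
    (∃ U : WeightedBessel.L2pow (WeightedBessel.wt n (WeightedBessel.mExp n)) ≃ₗᵢ[ℂ]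
        WeightedBessel.L2pow (WeightedBessel.wt n 1),
      (∀ w, ∀ᵐ t ∂(WeightedBessel.powMeasure (WeightedBessel.wt n 1)),
        U w t = ((t ^ ((WeightedBessel.mExp n - 1) / 2) : ℝ) : ℂ) * w t) ∧
      ∀ x y, (x, y) ∈ (WeightedBessel.hatH0 n r L).graph ↔
        (U x, U y) ∈ (WeightedBessel.H0 n r L).graph) ∧
    -- they have the eigenvalues `ev i`, and the exponentials are of trace class
    ∃ ev : ℕ → ℝ, 0 < ev 0 ∧ StrictMono ev ∧
      (∃ b, WeightedBessel.IsEigenbasis (WeightedBessel.H0 n r L) ev b) ∧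
      (∃ b, WeightedBessel.IsEigenbasis (WeightedBessel.hatH0 n r L) ev b) ∧
      (∀ β : ℝ≥0, 0 < β → Summable fun i => Real.exp (-(β : ℝ) * ev i)) ∧
      (∃ T, WeightedBessel.IsExpSemigroup (WeightedBessel.H0 n r L) T ∧
        ∀ β : ℝ≥0, 0 < β → WeightedBessel.IsTraceClass (T β) ∧
          WeightedBessel.HasTrace (T β) ((∑' i, Real.exp (-(β : ℝ) * ev i) : ℝ) : ℂ)) ∧
      (∃ T, WeightedBessel.IsExpSemigroup (WeightedBessel.hatH0 n r L) T ∧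
        ∀ β : ℝ≥0, 0 < β → WeightedBessel.IsTraceClass (T β) ∧
          WeightedBessel.HasTrace (T β) ((∑' i, Real.exp (-(β : ℝ) * ev i) : ℝ) : ℂ)) := by
  open WeightedBessel in
  have hn2 : 2 ≤ n := by omega
  have hc : 0 < -muBar n r := neg_pos.2 hμ
  have hb : 0 < m2 n * |L| := by
    have hn' : (17 : ℝ) ≤ n := by exact_mod_cast hn
    refine mul_pos ?_ (abs_pos.2 hL.ne)
    exact div_pos (mul_pos (mul_pos (by norm_num) (by linarith)) (by linarith)) (by linarith)
  -- The conjugating exponents are 0 for H₀ and (m - 1)/2 for the temporal Hamiltonian; both lead to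
  -- the weight e^((4 - 4/n)x), and both constants equal -μ̄.
  have e1 : 4 - 4 / (n : ℝ) = wt n 1 + 1 - 2 * 0 := by rw [wt]; ring
  have e2 : 4 - 4 / (n : ℝ) = wt n (mExp n) + 1 - 2 * ((mExp n - 1) / 2) := by rw [wt]; ring
  have h1 : Intertwines (logEquiv e1) (H0min n r L)
      (lineOperator (4 - 4 / n) (linePotential (-muBar n r) (m2 n * |L|))) :=
    intertwines_logEquiv (by norm_num) (by ring) (linePotential_apply _ _) e1
  have h2 : Intertwines (logEquiv e2) (hatH0min n r L)
      (lineOperator (4 - 4 / n) (linePotential (-muBar n r) (m2 n * |L|))) :=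
    intertwines_logEquiv rfl (show -muBar n r = _ ^ 2 - mu0 n r by rw [muBar]; ring)
      (fun x => by rw [linePotential_apply, abs_of_neg hL, mul_neg]) e2
  have h := isFormFactor_linePotential hc hb (4 - 4 / n)
  have f1 : Intertwines (logEquiv e1).symm _ (H0 n r L) := h.intertwines_friedrichs h1.symm
  have f2 : Intertwines (logEquiv e2).symm _ (hatH0 n r L) := h.intertwines_friedrichs h2.symm
  have s1 : IsSelfAdjoint (H0 n r L) := (h.map h1.symm).isSelfAdjoint_friedrichs
  have s2 : IsSelfAdjoint (hatH0 n r L) := (h.map h2.symm).isSelfAdjoint_friedrichs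
  refine ⟨s1, s2, fun hle => ⟨closure_eq_friedrichs_of_intertwines hn2 hb hle h1,
    closure_eq_friedrichs_of_intertwines hn2 hb hle h2⟩,
    ⟨(logEquiv e2).trans (logEquiv e1).symm, fun w => ?_, fun x y => ?_⟩, ?_⟩
  · rw [ae_powMeasure_iff]
    have g1 := coeFn_logEquiv e1 (((logEquiv e2).trans (logEquiv e1).symm) w)
    rw [LinearIsometryEquiv.trans_apply, LinearIsometryEquiv.apply_symm_apply] at g1
    filter_upwards [g1, coeFn_logEquiv e2 w] with x g1 g2
    rw [g2, zero_mul, Real.exp_zero, Complex.ofReal_one, one_mul] at g1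
    rw [LinearIsometryEquiv.trans_apply, ← g1, ← Real.exp_mul, mul_comm x]
  · exact (f2.symm x y).trans (f1 _ _)
  -- A single eigenbasis on the line is carried to both spaces, so the two operators share the
  -- sequence `ev`.
  · obtain ⟨ev, h0, hmono, ⟨e, he⟩, hsum⟩ := exists_eigenbasis_line hn2 hc hb
    have hev : ∀ i, 0 ≤ ev i := fun i => h0.le.trans (hmono.monotone i.zero_le)
    obtain ⟨b₁, hb₁⟩ := f1.exists_isEigenbasis he
    obtain ⟨b₂, hb₂⟩ := f2.exists_isEigenbasis he
    exact ⟨ev, h0, hmono, ⟨b₁, hb₁⟩, ⟨b₂, hb₂⟩, hsum,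
      hb₁.exists_traceClass_expSemigroup s1 hev hsum,
      hb₂.exists_traceClass_expSemigroup s2 hev hsum⟩
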